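/- **Setting.** Let $(\Omega_1,\mathcal A_1)$, $(\Omega_2,\mathcal A_2)$ be measurable spaces, $\mathcal P$, $\mathcal Q$ sets of probability measures on them, $P_0\in\mathcal P$, $Q_0\in\mathcal Q$, and $\mathcal P\otimes\mathcal Q=\{P\otimes Q: P\in\mathcal P, Q\in\mathcal Q\}$. For a family $\mathcal F$ of probability measures and $R_0\in\mathcal F$, a curve $(-\varepsilon,\varepsilon)\to\mathcal F$, $t\mapsto R_t$ (with the given value $R_0$ at $t=0$) is *$L_2(R_0)$-differentiable with tangent $g\in L_2(R_0)$* if, as $t\to0$, $$\Big\|2\Big(\big(\tfrac{dR_t}{dR_0}\big)^{1/2}-1\Big)-tg\Big\|_{L_2(R_0)}=o(|t|),\qquad R_t\Big(\Big\{\tfrac{dR_t}{dR_0}=\infty\Big\}\Big)=o(t^2),$$ where $\frac{dR_t}{dR_0}$ is the $[0,\infty]$-valued likelihood ratio. The *tangent cone* $K(R_0,\mathcal F)$ is the set of all such tangents $g$ (they satisfy $\int g\,dR_0=0$), and the *tangent space* $T(R_0,\mathcal F)$ is the $L_2(R_0)$-closure of its linear span. A functional $k:\mathcal F\to\mathbb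 R$ is *differentiable at $R_0$ with gradient $\dot k\in L_2(R_0)$*, $\int\dot k\,dR_0=0$, if $\lim_{t\downarrow0}\frac1t(k(R_t)-k(R_0))=\int\dot k g\,dR_0$ for every such curve with tangent $g$. Its *canonical gradient* $\widetilde k$ is the gradient lying in $T(R_0,\mathcal F)$ (equivalently, the gradient of smallest norm). Let $k:\mathcal P\otimes\mathcal Q\to\mathbb R$ be differentiable at $P_0\otimes Q_0$ with canonical gradient $\widetilde k$, and let $\int\widetilde k^2\,dP_0\otimes Q_0\neq0$. Put $\widetilde k_1(\omega_1)=\int\widetilde k(\omega_1,\omega_2)\,dQ_0(\omega_2)$ and $\widetilde k_2(\omega_2)=\int\widetilde k(\omega_1,\omega_2)\,dP_0(\omega_1)$. Let $(n_1)_{n\in\mathbb N}$, $(n_2)_{n\in\mathbb N}$ be sequences of natural numbers with $n_1+n_2=n$ for all $n$ and $n_2/n\to d\in(0,1)$. Let $\alpha\in(0,1)$, let $\Phi$ be the standard normal distribution function and $u_{1-\alpha}=\Phi^{-1}(1-\alpha)$. On $\Omega_1^{n_1}\times\Omega_2^{n_2}$ let $$T_n=\frac{\sqrt n}{n_1}\sum_{i=1}^{n_1}\widetilde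 k_1(\omega_{1,i})+\frac{\sqrt n}{n_2}\sum_{j=1}^{n_2}\widetilde k_2(\omega_{2,j}),\qquad c=u_{1-\alpha}\Big(\tfrac1{1-d}\int\widetilde k_1^2\,dP_0+\tfrac1d\int\widetilde k_2^2\,dQ_0\Big)^{1/2},$$ and let $\psi_n=1$ if $T_n>c$, $\psi_n=0$ if $T_n\le c$. A *test sequence* $(\phi_n)$ consists of measurable functions $\phi_n:\Omega_1^{n_1}\times\Omega_2^{n_2}\to[0,1]$. It is *asymptotically $\{0\}$-$\alpha$-similar* if $\lim_{n\to\infty}\int\phi_n\,dP_0^{n_1}\otimes Q_0^{n_2}=\alpha$. For $\vartheta>0$ let $\mathcal K_1(\vartheta)$ (the *implicit alternatives* with parameter $\vartheta$) be the set of all sequences $(P_{t_n}\otimes Q_{t_n})_{n\in\mathbb N}$ such that $t\mapsto P_t\otimes Q_t$ is an $L_2(P_0\otimes Q_0)$-differentiable curve in $\mathcal P\otimes\mathcal Q$ defined on some interval $(-\varepsilon,\varepsilon)$ containing all $t_n$, with value $P_0\otimes Q_0$ at $t=0$, $t_n\to0$, the limit $\lim_{n\to\infty}t_n\sqrt n$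 exists in $(0,\infty)$, and $$\lim_{n\to\infty}\sqrt n\,\big(k(P_{t_n}\otimes Q_{t_n})-k(P_0\otimes Q_0)\big)=\vartheta .$$ **Theorem.** In this setting, assume that the tangent cone $K(P_0\otimes Q_0,\mathcal P\otimes\mathcal Q)$ is convex, and let $\vartheta>0$. Then $(\psi_n)$ is an asymptotic maximin-$\alpha$ test sequence for the hypotheses $(P_0^{n_1}\otimes Q_0^{n_2})_{n\in\mathbb N}$ against the implicit alternatives in $\mathcal K_1(\vartheta)$. That is: $\mathcal K_1(\vartheta)$ is non-empty, $(\psi_n)$ is asymptotically $\{0\}$-$\alpha$-similar, the limit $\lim_{n\to\infty}\int\psi_n\,dP_{t_n}^{n_1}\otimes Q_{t_n}^{n_2}$ exists for every element of $\mathcal K_1(\vartheta)$, and $$\inf_{\mathcal K_1(\vartheta)}\lim_{n\to\infty}\int\psi_n\,dP_{t_n}^{n_1}\otimes Q_{t_n}^{n_2}=\max_{(\phi_n)}\ \inf_{\mathcal K_1(\vartheta)}\limsup_{n\to\infty}\int\phi_n\,dP_{t_n}^{n_1}\otimes Q_{t_n}^{n_2},$$ where the infima are over all $(P_{t_n}\otimes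 Q_{t_n})_{n\in\mathbb N}\in\mathcal K_1(\vartheta)$ and the maximum, which is attained, is over all asymptotically $\{0\}$-$\alpha$-similar test sequences. -/

import Mathlib

open MeasureTheory ProbabilityTheory Filter Topology Asymptotics Set

noncomputable section

namespace TwoSample

section OneFamily

variable {Ω : Type*} [MeasurableSpace Ω]

/-- `L` is a density quotient (likelihood ratio) of `P` with respect to `Q`. -/
structure IsDensityQuotient (P Q : ProbabilityMeasure Ω) (L : Ω → ENNReal) : Prop where
  measurable : Measurable L
  apply_eq : ∀ A : Set Ω, MeasurableSet A →
    (P : Measure Ω) A = ∫⁻ ω in A, L ω ∂(Q : Measure Ω) + (P : Measure Ω) (A ∩ {ω | L ω = ⊤})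
  ae_lt_top : ∀ᵐ ω ∂(Q : Measure Ω), L ω < ⊤

/-- Every density quotient `L` of `P` with respect to `Q` is `Q`-a.e. Mathlib's `rnDeriv`, and the
mass `P {L = ∞}` is the total mass of the part of `P` that is singular to `Q`. -/
theorem IsDensityQuotient.eq_rnDeriv_and_singularPart {P Q : ProbabilityMeasure Ω}
    {L : Ω → ENNReal} (h : IsDensityQuotient P Q L) :
    L =ᵐ[(Q : Measure Ω)] (P : Measure Ω).rnDeriv (Q : Measure Ω) ∧
    (P : Measure Ω) {ω | L ω = ⊤} =
      (P : Measure Ω).singularPart (Q : Measure Ω) Set.univ := by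
  have hms : MeasurableSet {ω | L ω = ⊤} := h.measurable (measurableSet_singleton _)
  have hadd : (P : Measure Ω) =
      (P : Measure Ω).restrict {ω | L ω = ⊤} + (Q : Measure Ω).withDensity L := by
    ext A hA
    rw [Measure.add_apply, Measure.restrict_apply hA, withDensity_apply _ hA, add_comm]
    exact h.apply_eq A hA
  have hsing : (P : Measure Ω).restrict {ω | L ω = ⊤} ⟂ₘ (Q : Measure Ω) := by
    refine ⟨{ω | L ω = ⊤}ᶜ, hms.compl, ?_, ?_⟩
    · rw [Measure.restrict_apply hms.compl]; simp
    · rw [compl_compl]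
      have := h.ae_lt_top
      rw [ae_iff] at this
      simpa using this
  refine ⟨Measure.eq_rnDeriv h.measurable hsing hadd, ?_⟩
  rw [← Measure.eq_singularPart h.measurable hsing hadd]
  simp

/-- The curve `t ↦ f t` of probability measures passes through `P` at `t = 0` and is
`L₂(P)`-differentiable there with tangent `g`:
`‖2 ((dP_t/dP)^{1/2} - 1) - t g‖_{L₂(P)} = o(|t|)` and `P_t {dP_t/dP = ∞} = o(t²)` as `t → 0`. -/
def IsL2DifferentiableAt (f : ℝ → ProbabilityMeasure Ω) (P : ProbabilityMeasure Ω)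
    (g : Lp ℝ 2 (P : Measure Ω)) : Prop :=
  f 0 = P ∧
  (fun t : ℝ => (eLpNorm (fun ω =>
      2 * (Real.sqrt (((f t : Measure Ω).rnDeriv (P : Measure Ω) ω).toReal) - 1) - t * g ω)
      2 (P : Measure Ω)).toReal) =o[𝓝 0] (fun t : ℝ => t) ∧
  (fun t : ℝ => ((f t : Measure Ω).singularPart (P : Measure Ω)).real Set.univ)
      =o[𝓝 0] (fun t : ℝ => t ^ 2)

/-- `f`, restricted to `(-ε, ε)`, is an `L₂(P)`-differentiable curve in the family `𝓕`
with tangent `g` and `f 0 = P`. -/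
def IsL2CurveIn (𝓕 : Set (ProbabilityMeasure Ω)) (P : ProbabilityMeasure Ω) (ε : ℝ)
    (f : ℝ → ProbabilityMeasure Ω) (g : Lp ℝ 2 (P : Measure Ω)) : Prop :=
  0 < ε ∧ (∀ t ∈ Set.Ioo (-ε) ε, f t ∈ 𝓕) ∧ IsL2DifferentiableAt f P g

/-- The tangent cone `K(P, 𝓕)`: all `g ∈ L₂⁽⁰⁾(P)` that are tangents of curves in `𝓕`
through `P`. -/
def tangentCone (P : ProbabilityMeasure Ω) (𝓕 : Set (ProbabilityMeasure Ω)) :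
    Set (Lp ℝ 2 (P : Measure Ω)) :=
  {g | ∫ ω, g ω ∂(P : Measure Ω) = 0 ∧ ∃ ε f, IsL2CurveIn 𝓕 P ε f g}

/-- The tangent space `T(P, 𝓕)`: the `L₂(P)`-closure of the linear span of the tangent cone. -/
def tangentSpace (P : ProbabilityMeasure Ω) (𝓕 : Set (ProbabilityMeasure Ω)) :
    Submodule ℝ (Lp ℝ 2 (P : Measure Ω)) :=
  (Submodule.span ℝ (tangentCone P 𝓕)).topologicalClosure

/-- `κ ∈ L₂⁽⁰⁾(P)` is a gradient at `P` of the statistical functional `k` on `𝓕`. Only the values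
of `k` on `𝓕` matter. -/
def IsGradient (𝓕 : Set (ProbabilityMeasure Ω)) (k : ProbabilityMeasure Ω → ℝ)
    (P : ProbabilityMeasure Ω) (κ : Lp ℝ 2 (P : Measure Ω)) : Prop :=
  ∫ ω, κ ω ∂(P : Measure Ω) = 0 ∧
  ∀ (ε : ℝ) (f : ℝ → ProbabilityMeasure Ω) (g : Lp ℝ 2 (P : Measure Ω)),
    IsL2CurveIn 𝓕 P ε f g →
    Tendsto (fun t : ℝ => (k (f t) - k P) / t) (𝓝[>] 0)
      (𝓝 (∫ ω, κ ω * g ω ∂(P : Measure Ω)))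

/-- `κ` is the canonical gradient of `k` at `P`: the gradient that lies in the tangent space.
By `IsCanonicalGradient.norm_le` and `IsCanonicalGradient.eq_of_norm_le` it is the unique gradient
of smallest norm. -/
def IsCanonicalGradient (𝓕 : Set (ProbabilityMeasure Ω)) (k : ProbabilityMeasure Ω → ℝ)
    (P : ProbabilityMeasure Ω) (κ : Lp ℝ 2 (P : Measure Ω)) : Prop :=
  IsGradient 𝓕 k P κ ∧ κ ∈ tangentSpace P 𝓕

theorem IsCanonicalGradient.norm_sq {𝓕 : Set (ProbabilityMeasure Ω)}
    {k : ProbabilityMeasure Ω → ℝ} {P : ProbabilityMeasure Ω} {κ κ' : Lp ℝ 2 (P : Measure Ω)}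
    (h : IsCanonicalGradient 𝓕 k P κ) (h' : IsGradient 𝓕 k P κ') :
    ‖κ'‖ ^ 2 = ‖κ‖ ^ 2 + ‖κ' - κ‖ ^ 2 := by
  have hinner : ∀ a b : Lp ℝ 2 (P : Measure Ω),
      inner ℝ a b = ∫ ω, b ω * a ω ∂(P : Measure Ω) := fun a b => by
    simp [L2.inner_def]
  have hK : ∀ g ∈ tangentCone P 𝓕, inner ℝ g (κ' - κ) = 0 := by
    rintro g ⟨-, ε, f, hf⟩
    have := tendsto_nhds_unique (h.1.2 ε f g hf) (h'.2 ε f g hf)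
    rw [inner_sub_right, hinner, hinner, this, sub_self]
  have hT : tangentSpace P 𝓕 ≤ (Submodule.span ℝ {κ' - κ})ᗮ := by
    refine Submodule.topologicalClosure_minimal _ ?_ (Submodule.isClosed_orthogonal _)
    refine Submodule.span_le.2 fun g hg => ?_
    rw [SetLike.mem_coe, Submodule.mem_orthogonal_singleton_iff_inner_left]
    exact hK g hg
  have h0 : inner ℝ κ (κ' - κ) = 0 :=
    Submodule.mem_orthogonal_singleton_iff_inner_left.1 (hT h.2)
  have hsum := norm_add_sq_eq_norm_sq_add_norm_sq_of_inner_eq_zero κ (κ' - κ) h0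
  rw [add_sub_cancel] at hsum
  nlinarith [hsum]

theorem IsCanonicalGradient.norm_le {𝓕 : Set (ProbabilityMeasure Ω)}
    {k : ProbabilityMeasure Ω → ℝ} {P : ProbabilityMeasure Ω} {κ κ' : Lp ℝ 2 (P : Measure Ω)}
    (h : IsCanonicalGradient 𝓕 k P κ) (h' : IsGradient 𝓕 k P κ') : ‖κ‖ ≤ ‖κ'‖ := by
  refine le_of_sq_le_sq ?_ (norm_nonneg _)
  rw [h.norm_sq h']
  nlinarith [sq_nonneg ‖κ' - κ‖]

theorem IsCanonicalGradient.eq_of_norm_le {𝓕 : Set (ProbabilityMeasure Ω)}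
    {k : ProbabilityMeasure Ω → ℝ} {P : ProbabilityMeasure Ω} {κ κ' : Lp ℝ 2 (P : Measure Ω)}
    (h : IsCanonicalGradient 𝓕 k P κ) (h' : IsGradient 𝓕 k P κ') (hle : ‖κ'‖ ≤ ‖κ‖) :
    κ' = κ := by
  have h1 := h.norm_sq h'
  have h2 : ‖κ' - κ‖ ^ 2 ≤ 0 := by nlinarith [norm_nonneg κ', norm_nonneg κ]
  have h3 : ‖κ' - κ‖ = 0 := by
    have := sq_nonneg ‖κ' - κ‖
    exact pow_eq_zero_iff (two_ne_zero) |>.1 (le_antisymm h2 this)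
  exact sub_eq_zero.1 (norm_eq_zero.1 h3)

end OneFamily

/-- The quantile function `Φ⁻¹` of the standard normal distribution, for arguments in `(0, 1)`. -/
def stdNormalQuantile (p : ℝ) : ℝ :=
  sInf {x : ℝ | p ≤ cdf (gaussianReal 0 1) x}

section Product

variable {Ω₁ Ω₂ : Type*} [MeasurableSpace Ω₁] [MeasurableSpace Ω₂]

/-- The family `𝓜₁ ⊗ 𝓜₂` of product measures. -/
def productFamily (𝓜₁ : Set (ProbabilityMeasure Ω₁)) (𝓜₂ : Set (ProbabilityMeasure Ω₂)) :
    Set (ProbabilityMeasure (Ω₁ × Ω₂)) :=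
  {R | ∃ P ∈ 𝓜₁, ∃ Q ∈ 𝓜₂, R = P.prod Q}

/-- The implicit alternatives with implicit parameter `ϑ`: sequences `(P_{t_n} ⊗ Q_{t_n})` taken
along an `L₂(P₀ ⊗ Q₀)`-differentiable curve in `𝓜₁ ⊗ 𝓜₂` at a null sequence `t_n` with
`lim √n t_n > 0`, such that `√n (k(P_{t_n} ⊗ Q_{t_n}) - k(P₀ ⊗ Q₀)) → ϑ`. Such a sequence is given
by its pairs of factors. For `ϑ > 0` these are the elements of `𝒦₁` with parameter `ϑ`. -/
def implicitAlternatives (𝓜₁ : Set (ProbabilityMeasure Ω₁)) (𝓜₂ : Set (ProbabilityMeasure Ω₂))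
    (k : ProbabilityMeasure (Ω₁ × Ω₂) → ℝ)
    (P₀ : ProbabilityMeasure Ω₁) (Q₀ : ProbabilityMeasure Ω₂) (ϑ : ℝ) :
    Set (ℕ → ProbabilityMeasure Ω₁ × ProbabilityMeasure Ω₂) :=
  {R | (∃ (t : ℕ → ℝ) (t' ε : ℝ) (f : ℝ → ProbabilityMeasure (Ω₁ × Ω₂))
        (g : Lp ℝ 2 (P₀.prod Q₀ : Measure (Ω₁ × Ω₂))),
        Tendsto t atTop (𝓝 0) ∧
        Tendsto (fun n : ℕ => t n * Real.sqrt n) atTop (𝓝 t') ∧ 0 < t' ∧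
        IsL2CurveIn (productFamily 𝓜₁ 𝓜₂) (P₀.prod Q₀) ε f g ∧
        ∀ n, t n ∈ Set.Ioo (-ε) ε ∧ f (t n) = (R n).1.prod (R n).2) ∧
      Tendsto (fun n : ℕ => Real.sqrt n * (k ((R n).1.prod (R n).2) - k (P₀.prod Q₀)))
        atTop (𝓝 ϑ)}

/-- The two-sample space `Ω₁^{m₁} × Ω₂^{m₂}`. -/
abbrev SampleSpace (Ω₁ Ω₂ : Type*) (m₁ m₂ : ℕ) : Type _ :=
  (Fin m₁ → Ω₁) × (Fin m₂ → Ω₂)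

/-- The law `P^{m₁} ⊗ Q^{m₂}` of two independent samples of sizes `m₁`, `m₂`. -/
def sampleLaw (P : ProbabilityMeasure Ω₁) (Q : ProbabilityMeasure Ω₂) (m₁ m₂ : ℕ) :
    Measure (SampleSpace Ω₁ Ω₂ m₁ m₂) :=
  (Measure.pi fun _ : Fin m₁ => (P : Measure Ω₁)).prod
    (Measure.pi fun _ : Fin m₂ => (Q : Measure Ω₂))

/-- A sequence of (randomized) tests for sample sizes `n₁ n`, `n₂ n`. -/
def IsTestSequence {n₁ n₂ : ℕ → ℕ} (φ : ∀ n, SampleSpace Ω₁ Ω₂ (n₁ n) (n₂ n) → ℝ) : Prop :=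
  ∀ n, Measurable (φ n) ∧ ∀ x, φ n x ∈ Set.Icc (0 : ℝ) 1

/-- The sequence `∫ φ_n d(P_n^{n₁} ⊗ Q_n^{n₂})` of powers along a sequence `R_n = (P_n, Q_n)`. -/
def power {n₁ n₂ : ℕ → ℕ} (φ : ∀ n, SampleSpace Ω₁ Ω₂ (n₁ n) (n₂ n) → ℝ)
    (R : ℕ → ProbabilityMeasure Ω₁ × ProbabilityMeasure Ω₂) (n : ℕ) : ℝ :=
  ∫ x, φ n x ∂(sampleLaw (R n).1 (R n).2 (n₁ n) (n₂ n))

/-- `φ` is an asymptotically `{0}`-`α`-similar test sequence: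
`∫ φ_n d(P₀^{n₁} ⊗ Q₀^{n₂}) → α`. -/
def IsAsympSimilar {n₁ n₂ : ℕ → ℕ} (P₀ : ProbabilityMeasure Ω₁) (Q₀ : ProbabilityMeasure Ω₂)
    (α : ℝ) (φ : ∀ n, SampleSpace Ω₁ Ω₂ (n₁ n) (n₂ n) → ℝ) : Prop :=
  IsTestSequence φ ∧ Tendsto (power φ fun _ => (P₀, Q₀)) atTop (𝓝 α)

/-- First component `ω₁ ↦ ∫ κ(ω₁, ω₂) dQ₀(ω₂)` of the canonical gradient. -/
def gradFst (Q₀ : ProbabilityMeasure Ω₂) (κ : Ω₁ × Ω₂ → ℝ) (ω₁ : Ω₁) : ℝ :=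
  ∫ ω₂, κ (ω₁, ω₂) ∂(Q₀ : Measure Ω₂)

/-- Second component `ω₂ ↦ ∫ κ(ω₁, ω₂) dP₀(ω₁)` of the canonical gradient. -/
def gradSnd (P₀ : ProbabilityMeasure Ω₁) (κ : Ω₁ × Ω₂ → ℝ) (ω₂ : Ω₂) : ℝ :=
  ∫ ω₁, κ (ω₁, ω₂) ∂(P₀ : Measure Ω₁)

/-- The test statistic
`T_n = (√n / n₁) ∑ κ₁(ω_{1,i}) + (√n / n₂) ∑ κ₂(ω_{2,j})` with `n = n₁ + n₂`. -/
def testStatistic (P₀ : ProbabilityMeasure Ω₁) (Q₀ : ProbabilityMeasure Ω₂) (κ : Ω₁ × Ω₂ → ℝ)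
    (m₁ m₂ : ℕ) (x : SampleSpace Ω₁ Ω₂ m₁ m₂) : ℝ :=
  Real.sqrt ((m₁ + m₂ : ℕ) : ℝ) / m₁ * ∑ i, gradFst Q₀ κ (x.1 i) +
    Real.sqrt ((m₁ + m₂ : ℕ) : ℝ) / m₂ * ∑ j, gradSnd P₀ κ (x.2 j)

/-- The critical value `c = u_{1-α} (1/(1-d) ∫ κ₁² dP₀ + 1/d ∫ κ₂² dQ₀)^{1/2}`. -/
def criticalValue (P₀ : ProbabilityMeasure Ω₁) (Q₀ : ProbabilityMeasure Ω₂) (κ : Ω₁ × Ω₂ → ℝ)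
    (d α : ℝ) : ℝ :=
  stdNormalQuantile (1 - α) *
    Real.sqrt (1 / (1 - d) * ∫ ω, gradFst Q₀ κ ω ^ 2 ∂(P₀ : Measure Ω₁) +
      1 / d * ∫ ω, gradSnd P₀ κ ω ^ 2 ∂(Q₀ : Measure Ω₂))

open scoped Classical in
/-- The one-sided tests `ψ_n = 1` if `T_n > c` and `ψ_n = 0` if `T_n ≤ c`. -/
def oneSidedTest (n₁ n₂ : ℕ → ℕ) (P₀ : ProbabilityMeasure Ω₁) (Q₀ : ProbabilityMeasure Ω₂)
    (κ : Ω₁ × Ω₂ → ℝ) (d α : ℝ) (n : ℕ) (x : SampleSpace Ω₁ Ω₂ (n₁ n) (n₂ n)) : ℝ :=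
  if criticalValue P₀ Q₀ κ d α < testStatistic P₀ Q₀ κ (n₁ n) (n₂ n) x then 1 else 0

end Product

end TwoSample

end

open TwoSample

/-!
The proof works with half densities `(dR/dR₀)^{1/2}` as vectors of the Hilbert space `L₂(R₀)`.
Differentiability of a curve at `R₀` with tangent `g` says that `2 c ((dR/dR₀)^{1/2} - 1) → g` in
`L₂(R₀)` with `c = 1 / t`, and that the singular mass is `o(1 / c²)`. This relation
(`HasLocalTangent`) makes sense along any filter, so it also describes the alternatives at sample
size `n`, with `c = √n`. The half density of a product measure is the tensor product of the half
densities of its factors. Hence the marginals of a differentiable product curve are differentiable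
(`HasLocalTangent.fst`, `HasLocalTangent.snd`), and the tangent is the sum of a function of `ω₁` and
a function of `ω₂` (`HasLocalTangent.eq_add`).

*Power of the one-sided test.* Expanding characteristic functions to order `1 / n` under a local
alternative with marginal tangents `h₁`, `h₂` (`HasLocalTangent.tendsto_charFun_statistic`) shows
that the statistic `T_n` is asymptotically normal, with variance
`σ² = (1 - d)⁻¹ ‖κ₁‖² + d⁻¹ ‖κ₂‖²` and mean `⟨κ₁, h₁⟩ + ⟨κ₂, h₂⟩`. Since `κ` is the sum of its
components, this mean is `⟨κ, h⟩`, which is the derivative of the functional along the alternative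
and therefore equals `ϑ` for *every* implicit alternative. So the power of the test converges to
`1 - Φ(u - ϑ / σ)` regardless of the alternative, and with `h = 0` the test is asymptotically of
level `α` (`tendsto_power_oneSidedTest`).

*Upper bound.* For a single local alternative, the Neyman–Pearson inequality bounds the power of a
test by its level and the truncated mean of the likelihood ratio under the null hypothesis
(`power_le_of_withDensity_le`). The log-likelihood ratio tends in law to `N(-τ²/2, τ²)` with
`τ² = (1 - d) ‖h₁‖² + d ‖h₂‖²` (`HasLocalTangent.tendsto_charFun_log`), so a similar test has
asymptotic power at most `1 - Φ(u - τ)` (`limsup_power_le`). Under the constraint `⟨κ, h⟩ = ϑ`, the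
least value of `τ` is `ϑ / σ`; it belongs to the direction `(1 - d)⁻¹ κ₁ + d⁻¹ κ₂`.

*Convexity.* Curves can be run backwards and at any speed, so a convex tangent cone is a linear
subspace and is dense in the tangent space, which contains `κ` (`tangentSpace_subset_closure`).
Freezing one factor of a product curve shows that the cone contains both components of each of its
elements. Therefore it contains `(1 - d)⁻¹ g₁ + d⁻¹ g₂` for tangents `g` arbitrarily close to `κ`.
The implicit alternatives in these directions have bounds that converge to `1 - Φ(u - ϑ / σ)`
(`maximinPower_le`), which the one-sided test attains.
-/

noncomputable section

namespace TwoSample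

/-! ### Half densities and local tangents -/

section HalfDensity

variable {Ω : Type*} [MeasurableSpace Ω]

theorem inner_eq_integral_mul {μ : Measure Ω} (a b : Lp ℝ 2 μ) :
    inner ℝ a b = ∫ ω, a ω * b ω ∂μ := by
  simp [L2.inner_def, mul_comm]

theorem norm_sq_eq_integral_sq {μ : Measure Ω} (a : Lp ℝ 2 μ) :
    ‖a‖ ^ 2 = ∫ ω, a ω ^ 2 ∂μ := by
  rw [← real_inner_self_eq_norm_sq, inner_eq_integral_mul]
  simp [sq]

/-- The mass of the part of `R` that is singular to `R₀`. -/
def singularMass (R R₀ : ProbabilityMeasure Ω) : ℝ :=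
  ((R : Measure Ω).singularPart (R₀ : Measure Ω)).real univ

theorem singularMass_nonneg (R R₀ : ProbabilityMeasure Ω) : 0 ≤ singularMass R R₀ :=
  measureReal_nonneg

theorem integral_rnDeriv_eq (R R₀ : ProbabilityMeasure Ω) :
    ∫ ω, ((R : Measure Ω).rnDeriv (R₀ : Measure Ω) ω).toReal ∂(R₀ : Measure Ω) =
      1 - singularMass R R₀ := by
  have h := congrArg (fun μ : Measure Ω => μ.real univ)
    (Measure.haveLebesgueDecomposition_add (R : Measure Ω) (R₀ : Measure Ω))
  beta_reduce at h
  rw [probReal_univ, measureReal_add_apply] at h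
  rw [integral_toReal (Measure.measurable_rnDeriv _ _).aemeasurable (Measure.rnDeriv_lt_top _ _)]
  have h2 : ((R₀ : Measure Ω).withDensity ((R : Measure Ω).rnDeriv (R₀ : Measure Ω))).real univ =
      (∫⁻ a, (R : Measure Ω).rnDeriv (R₀ : Measure Ω) a ∂(R₀ : Measure Ω)).toReal := by
    simp [measureReal_def]
  rw [singularMass]
  linarith

theorem memLp_sqrt_rnDeriv (R R₀ : ProbabilityMeasure Ω) :
    MemLp (fun ω => √((R : Measure Ω).rnDeriv (R₀ : Measure Ω) ω).toReal) 2
      (R₀ : Measure Ω) := by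
  have hm : Measurable fun ω => √((R : Measure Ω).rnDeriv (R₀ : Measure Ω) ω).toReal :=
    (Measure.measurable_rnDeriv _ _).ennreal_toReal.sqrt
  rw [memLp_two_iff_integrable_sq hm.aestronglyMeasurable]
  simpa [Real.sq_sqrt ENNReal.toReal_nonneg] using Measure.integrable_toReal_rnDeriv

/-- The square root of the density of the absolutely continuous part of `R` with respect to `R₀`,
as an element of `L₂(R₀)`. -/
def halfDensity (R R₀ : ProbabilityMeasure Ω) : Lp ℝ 2 (R₀ : Measure Ω) :=
  (memLp_sqrt_rnDeriv R R₀).toLp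

theorem coeFn_halfDensity (R R₀ : ProbabilityMeasure Ω) :
    halfDensity R R₀ =ᵐ[(R₀ : Measure Ω)]
      fun ω => √((R : Measure Ω).rnDeriv (R₀ : Measure Ω) ω).toReal :=
  MemLp.coeFn_toLp _

theorem norm_halfDensity_sq (R R₀ : ProbabilityMeasure Ω) :
    ‖halfDensity R R₀‖ ^ 2 = 1 - singularMass R R₀ := by
  rw [norm_sq_eq_integral_sq, ← integral_rnDeriv_eq]
  refine integral_congr_ae ?_
  filter_upwards [coeFn_halfDensity R R₀] with ω h
  rw [h, Real.sq_sqrt ENNReal.toReal_nonneg]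

theorem norm_halfDensity_le_one (R R₀ : ProbabilityMeasure Ω) : ‖halfDensity R R₀‖ ≤ 1 := by
  have := norm_halfDensity_sq R R₀
  have := singularMass_nonneg R R₀
  nlinarith [norm_nonneg (halfDensity R R₀)]

/-- The constant function `1` as an element of `L₂(μ)`. -/
abbrev oneLp (μ : Measure Ω) [IsFiniteMeasure μ] : Lp ℝ 2 μ := Lp.const 2 μ (1 : ℝ)

theorem coeFn_oneLp (μ : Measure Ω) [IsFiniteMeasure μ] : oneLp μ =ᵐ[μ] fun _ => (1 : ℝ) :=
  Lp.coeFn_const 2 μ 1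

theorem norm_oneLp (μ : Measure Ω) [IsProbabilityMeasure μ] : ‖oneLp μ‖ = 1 := by
  simp [oneLp, Lp.norm_const]

theorem inner_oneLp (μ : Measure Ω) [IsFiniteMeasure μ] (a : Lp ℝ 2 μ) :
    inner ℝ a (oneLp μ) = ∫ ω, a ω ∂μ := by
  rw [inner_eq_integral_mul]
  refine integral_congr_ae ?_
  filter_upwards [coeFn_oneLp μ] with ω h
  rw [h, mul_one]

theorem halfDensity_self (R₀ : ProbabilityMeasure Ω) :
    halfDensity R₀ R₀ = oneLp (R₀ : Measure Ω) := by
  refine Lp.ext ?_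
  filter_upwards [coeFn_halfDensity R₀ R₀, coeFn_oneLp (R₀ : Measure Ω),
    Measure.rnDeriv_self (R₀ : Measure Ω)] with ω h1 h2 h3
  rw [h1, h2, h3]
  simp

theorem singularMass_self (R₀ : ProbabilityMeasure Ω) : singularMass R₀ R₀ = 0 := by
  have := norm_halfDensity_sq R₀ R₀
  rw [halfDensity_self, norm_oneLp] at this
  linarith

/-- The Hellinger affinity of `R` and `R₀`. -/
def affinity (R R₀ : ProbabilityMeasure Ω) : ℝ :=
  inner ℝ (halfDensity R R₀) (oneLp (R₀ : Measure Ω))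

theorem affinity_eq_integral (R R₀ : ProbabilityMeasure Ω) :
    affinity R R₀ = ∫ ω, halfDensity R R₀ ω ∂(R₀ : Measure Ω) :=
  inner_oneLp _ _

theorem affinity_nonneg (R R₀ : ProbabilityMeasure Ω) : 0 ≤ affinity R R₀ := by
  rw [affinity_eq_integral]
  refine integral_nonneg_of_ae ?_
  filter_upwards [coeFn_halfDensity R R₀] with ω h
  rw [h]
  exact Real.sqrt_nonneg _

theorem affinity_le_one (R R₀ : ProbabilityMeasure Ω) : affinity R R₀ ≤ 1 := by
  refine (real_inner_le_norm _ _).trans ?_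
  rw [norm_oneLp, mul_one]
  exact norm_halfDensity_le_one R R₀

/-- The affinity is second-order close to one: its defect is controlled by the squared Hellinger
distance and the singular mass. -/
theorem two_mul_one_sub_affinity (R R₀ : ProbabilityMeasure Ω) :
    2 * (1 - affinity R R₀) =
      ‖halfDensity R R₀ - oneLp (R₀ : Measure Ω)‖ ^ 2 + singularMass R R₀ := by
  rw [norm_sub_sq_real, norm_halfDensity_sq, norm_oneLp, affinity]
  ring

variable {ι : Type*}

/-- Along the filter `l`, the measures `R i` approach `R₀` at rate `1 / c i` in the Hellinger sense
with tangent `h`: `2 c ((dR/dR₀)^{1/2} - 1) → h` in `L₂(R₀)`, and the singular mass of `R i` is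
`o(1 / c²)`. Curves correspond to `c t = 1 / t` and `t → 0`, local sequences of alternatives to
`c n = √n`. -/
def HasLocalTangent (l : Filter ι) (c : ι → ℝ) (R : ι → ProbabilityMeasure Ω)
    (R₀ : ProbabilityMeasure Ω) (h : Lp ℝ 2 (R₀ : Measure Ω)) : Prop :=
  Tendsto (fun i => (2 * c i) • (halfDensity (R i) R₀ - oneLp (R₀ : Measure Ω))) l (𝓝 h) ∧
    Tendsto (fun i => c i ^ 2 * singularMass (R i) R₀) l (𝓝 0)

theorem hasLocalTangent_self (l : Filter ι) (c : ι → ℝ) (R₀ : ProbabilityMeasure Ω) :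
    HasLocalTangent l c (fun _ => R₀) R₀ 0 := by
  simp [HasLocalTangent, halfDensity_self, singularMass_self, tendsto_const_nhds]

theorem eLpNorm_halfDensity_toReal (R R₀ : ProbabilityMeasure Ω) (t : ℝ)
    (g : Lp ℝ 2 (R₀ : Measure Ω)) :
    (eLpNorm (fun ω => 2 * (Real.sqrt (((R : Measure Ω).rnDeriv (R₀ : Measure Ω) ω).toReal) - 1)
      - t * g ω) 2 (R₀ : Measure Ω)).toReal =
      ‖(2 : ℝ) • (halfDensity R R₀ - oneLp (R₀ : Measure Ω)) - t • g‖ := by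
  rw [Lp.norm_def]
  congr 1
  refine eLpNorm_congr_ae ?_
  filter_upwards [coeFn_halfDensity R R₀, coeFn_oneLp (R₀ : Measure Ω),
    Lp.coeFn_sub ((2 : ℝ) • (halfDensity R R₀ - oneLp (R₀ : Measure Ω))) (t • g),
    Lp.coeFn_smul (2 : ℝ) (halfDensity R R₀ - oneLp (R₀ : Measure Ω)), Lp.coeFn_smul t g,
    Lp.coeFn_sub (halfDensity R R₀) (oneLp (R₀ : Measure Ω))] with ω h1 h2 h3 h4 h5 h6
  rw [h3, Pi.sub_apply, h4, h5, Pi.smul_apply, Pi.smul_apply, h6, Pi.sub_apply, h1, h2,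
    smul_eq_mul, smul_eq_mul]

theorem isL2DifferentiableAt_iff {f : ℝ → ProbabilityMeasure Ω} {R₀ : ProbabilityMeasure Ω}
    {g : Lp ℝ 2 (R₀ : Measure Ω)} :
    IsL2DifferentiableAt f R₀ g ↔ f 0 = R₀ ∧ HasLocalTangent (𝓝[≠] 0) (fun t => t⁻¹) f R₀ g := by
  unfold IsL2DifferentiableAt HasLocalTangent
  refine and_congr_right fun h0 => and_congr ?_ ?_
  · simp only [eLpNorm_halfDensity_toReal]
    rw [tendsto_iff_norm_sub_tendsto_zero]
    have key : (fun t : ℝ => ‖(2 : ℝ) • (halfDensity (f t) R₀ - oneLp (R₀ : Measure Ω)) - t • g‖)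
        =o[𝓝 0] (fun t : ℝ => t) ↔
        (fun t : ℝ => ‖(2 : ℝ) • (halfDensity (f t) R₀ - oneLp (R₀ : Measure Ω)) - t • g‖)
        =o[𝓝[≠] 0] (fun t : ℝ => t) := by
      refine ⟨fun h => h.mono nhdsWithin_le_nhds, fun h => ?_⟩
      have := h.insert (by simp [h0, halfDensity_self])
      rwa [show insert (0 : ℝ) {0}ᶜ = univ by ext; simp [em], nhdsWithin_univ] at this
    rw [key, ← isLittleO_norm_right, isLittleO_iff_tendsto']
    · refine tendsto_congr' ?_
      filter_upwards [self_mem_nhdsWithin] with t (ht : t ≠ 0)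
      rw [div_eq_inv_mul, ← norm_inv, ← norm_smul, smul_sub, smul_smul, smul_smul,
        inv_mul_cancel₀ ht, one_smul, mul_comm]
    · filter_upwards [self_mem_nhdsWithin] with t (ht : t ≠ 0) h
      exact absurd (norm_eq_zero.1 h) ht
  · have key : (fun t : ℝ => singularMass (f t) R₀) =o[𝓝 0] (fun t : ℝ => t ^ 2) ↔
        (fun t : ℝ => singularMass (f t) R₀) =o[𝓝[≠] 0] (fun t : ℝ => t ^ 2) := by
      refine ⟨fun h => h.mono nhdsWithin_le_nhds, fun h => ?_⟩
      have := h.insert (by simp [h0, singularMass_self])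
      rwa [show insert (0 : ℝ) {0}ᶜ = univ by ext; simp [em], nhdsWithin_univ] at this
    refine key.trans ?_
    rw [isLittleO_iff_tendsto']
    · refine tendsto_congr' ?_
      filter_upwards with t
      rw [inv_pow, div_eq_inv_mul]
    · filter_upwards [self_mem_nhdsWithin] with t (ht : t ≠ 0) h
      exact absurd (pow_eq_zero_iff two_ne_zero |>.1 h) ht

/-- Passing from a curve to a sequence with `c i * t i → t'` rescales the tangent by `t'`. -/
theorem HasLocalTangent.comp {κ : Type*} {l : Filter ι} {R : ι → ProbabilityMeasure Ω}
    {R₀ : ProbabilityMeasure Ω} {h : Lp ℝ 2 (R₀ : Measure Ω)} {b : ι → ℝ}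
    (hR : HasLocalTangent l b R R₀ h) {l' : Filter κ} {t : κ → ι} (ht : Tendsto t l' l)
    {c : κ → ℝ} {t' : ℝ} (hc : Tendsto (fun n => c n * (b (t n))⁻¹) l' (𝓝 t'))
    (hb : ∀ᶠ n in l', b (t n) ≠ 0) :
    HasLocalTangent l' c (fun n => R (t n)) R₀ (t' • h) := by
  refine ⟨?_, ?_⟩
  · refine (hc.smul (hR.1.comp ht)).congr' ?_
    filter_upwards [hb] with n hn
    simp only [Function.comp, smul_smul]
    congr 1
    field_simp
  · have := (hc.pow 2).mul (hR.2.comp ht)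
    rw [mul_zero] at this
    refine this.congr' ?_
    filter_upwards [hb] with n hn
    simp only [Function.comp]
    field_simp

end HalfDensity

/-! ### Product structure -/

section ProductStructure

variable {Ω₁ Ω₂ : Type*} [MeasurableSpace Ω₁] [MeasurableSpace Ω₂]
  (P₀ : ProbabilityMeasure Ω₁) (Q₀ : ProbabilityMeasure Ω₂)

theorem measurePreserving_fst_prod :
    MeasurePreserving Prod.fst (P₀.prod Q₀ : Measure (Ω₁ × Ω₂)) (P₀ : Measure Ω₁) :=
  measurePreserving_fst (μ := (P₀ : Measure Ω₁)) (ν := (Q₀ : Measure Ω₂))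

theorem measurePreserving_snd_prod :
    MeasurePreserving Prod.snd (P₀.prod Q₀ : Measure (Ω₁ × Ω₂)) (Q₀ : Measure Ω₂) :=
  measurePreserving_snd (μ := (P₀ : Measure Ω₁)) (ν := (Q₀ : Measure Ω₂))

/-- The embedding `a ↦ a ∘ fst` of `L₂(P₀)` into `L₂(P₀ ⊗ Q₀)`. -/
def liftFst : Lp ℝ 2 (P₀ : Measure Ω₁) →ₗᵢ[ℝ] Lp ℝ 2 (P₀.prod Q₀ : Measure (Ω₁ × Ω₂)) :=
  Lp.compMeasurePreservingₗᵢ ℝ Prod.fst (measurePreserving_fst_prod P₀ Q₀)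

/-- The embedding `b ↦ b ∘ snd` of `L₂(Q₀)` into `L₂(P₀ ⊗ Q₀)`. -/
def liftSnd : Lp ℝ 2 (Q₀ : Measure Ω₂) →ₗᵢ[ℝ] Lp ℝ 2 (P₀.prod Q₀ : Measure (Ω₁ × Ω₂)) :=
  Lp.compMeasurePreservingₗᵢ ℝ Prod.snd (measurePreserving_snd_prod P₀ Q₀)

/-- Integrating out the second coordinate, as the adjoint of `liftFst`; it agrees with `gradFst`
almost everywhere by `margFst_ae_eq`. -/
def margFst : Lp ℝ 2 (P₀.prod Q₀ : Measure (Ω₁ × Ω₂)) →L[ℝ] Lp ℝ 2 (P₀ : Measure Ω₁) :=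
  ContinuousLinearMap.adjoint (liftFst P₀ Q₀).toContinuousLinearMap

/-- Integrating out the first coordinate, as the adjoint of `liftSnd`; it agrees with `gradSnd`
almost everywhere by `margSnd_ae_eq`. -/
def margSnd : Lp ℝ 2 (P₀.prod Q₀ : Measure (Ω₁ × Ω₂)) →L[ℝ] Lp ℝ 2 (Q₀ : Measure Ω₂) :=
  ContinuousLinearMap.adjoint (liftSnd P₀ Q₀).toContinuousLinearMap

variable {P₀ Q₀}

theorem inner_margFst (g : Lp ℝ 2 (P₀.prod Q₀ : Measure (Ω₁ × Ω₂)))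
    (a : Lp ℝ 2 (P₀ : Measure Ω₁)) :
    inner ℝ (margFst P₀ Q₀ g) a = inner ℝ g (liftFst P₀ Q₀ a) :=
  ContinuousLinearMap.adjoint_inner_left _ _ _

theorem inner_margSnd (g : Lp ℝ 2 (P₀.prod Q₀ : Measure (Ω₁ × Ω₂)))
    (b : Lp ℝ 2 (Q₀ : Measure Ω₂)) :
    inner ℝ (margSnd P₀ Q₀ g) b = inner ℝ g (liftSnd P₀ Q₀ b) :=
  ContinuousLinearMap.adjoint_inner_left _ _ _

theorem coeFn_liftFst (a : Lp ℝ 2 (P₀ : Measure Ω₁)) :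
    liftFst P₀ Q₀ a =ᵐ[(P₀.prod Q₀ : Measure (Ω₁ × Ω₂))] fun ω => a ω.1 :=
  Lp.coeFn_compMeasurePreserving a (measurePreserving_fst_prod P₀ Q₀)

theorem coeFn_liftSnd (b : Lp ℝ 2 (Q₀ : Measure Ω₂)) :
    liftSnd P₀ Q₀ b =ᵐ[(P₀.prod Q₀ : Measure (Ω₁ × Ω₂))] fun ω => b ω.2 :=
  Lp.coeFn_compMeasurePreserving b (measurePreserving_snd_prod P₀ Q₀)

theorem margFst_ae_eq {F : Ω₁ × Ω₂ → ℝ} (hF : MemLp F 2 (P₀.prod Q₀ : Measure (Ω₁ × Ω₂))) :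
    margFst P₀ Q₀ (hF.toLp F) =ᵐ[(P₀ : Measure Ω₁)] gradFst Q₀ F := by
  have hFi : Integrable F ((P₀ : Measure Ω₁).prod (Q₀ : Measure Ω₂)) :=
    hF.integrable one_le_two
  refine Integrable.ae_eq_of_forall_setIntegral_eq _ _
    ((Lp.memLp _).integrable one_le_two) hFi.integral_prod_left fun s hs _ => ?_
  have hp : MeasurableSet (Prod.fst ⁻¹' s : Set (Ω₁ × Ω₂)) := measurable_fst hs
  have h1 := L2.inner_indicatorConstLp_one (𝕜 := ℝ) hs
    (measure_ne_top (P₀ : Measure Ω₁) s) (margFst P₀ Q₀ (hF.toLp F))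
  have h2 : liftFst P₀ Q₀ (indicatorConstLp 2 hs (measure_ne_top (P₀ : Measure Ω₁) s) (1 : ℝ)) =
      indicatorConstLp 2 hp (measure_ne_top _ _) (1 : ℝ) :=
    (Lp.indicatorConstLp_compMeasurePreserving hs (measure_ne_top _ _) 1
      (measurePreserving_fst_prod P₀ Q₀)).symm
  rw [← h1, real_inner_comm, inner_margFst, h2, real_inner_comm, L2.inner_indicatorConstLp_one,
    setIntegral_congr_ae (g := F) hp (by filter_upwards [hF.coeFn_toLp] with ω h _ using h)]
  have h3 : (P₀.prod Q₀ : Measure (Ω₁ × Ω₂)).restrict (Prod.fst ⁻¹' s) =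
      ((P₀ : Measure Ω₁).restrict s).prod (Q₀ : Measure Ω₂) := by
    conv_rhs => rw [← Measure.restrict_univ (μ := (Q₀ : Measure Ω₂))]
    rw [Measure.prod_restrict, prod_univ]
    rfl
  have h4 : Integrable F (((P₀ : Measure Ω₁).restrict s).prod (Q₀ : Measure Ω₂)) := by
    rw [← h3]; exact hFi.restrict
  rw [h3, integral_prod _ h4]
  rfl

theorem margSnd_ae_eq {F : Ω₁ × Ω₂ → ℝ} (hF : MemLp F 2 (P₀.prod Q₀ : Measure (Ω₁ × Ω₂))) :
    margSnd P₀ Q₀ (hF.toLp F) =ᵐ[(Q₀ : Measure Ω₂)] gradSnd P₀ F := by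
  have hFi : Integrable F ((P₀ : Measure Ω₁).prod (Q₀ : Measure Ω₂)) :=
    hF.integrable one_le_two
  refine Integrable.ae_eq_of_forall_setIntegral_eq _ _
    ((Lp.memLp _).integrable one_le_two) hFi.integral_prod_right fun s hs _ => ?_
  have hp : MeasurableSet (Prod.snd ⁻¹' s : Set (Ω₁ × Ω₂)) := measurable_snd hs
  have h1 := L2.inner_indicatorConstLp_one (𝕜 := ℝ) hs
    (measure_ne_top (Q₀ : Measure Ω₂) s) (margSnd P₀ Q₀ (hF.toLp F))
  have h2 : liftSnd P₀ Q₀ (indicatorConstLp 2 hs (measure_ne_top (Q₀ : Measure Ω₂) s) (1 : ℝ)) =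
      indicatorConstLp 2 hp (measure_ne_top _ _) (1 : ℝ) :=
    (Lp.indicatorConstLp_compMeasurePreserving hs (measure_ne_top _ _) 1
      (measurePreserving_snd_prod P₀ Q₀)).symm
  rw [← h1, real_inner_comm, inner_margSnd, h2, real_inner_comm, L2.inner_indicatorConstLp_one,
    setIntegral_congr_ae (g := F) hp (by filter_upwards [hF.coeFn_toLp] with ω h _ using h)]
  have h3 : (P₀.prod Q₀ : Measure (Ω₁ × Ω₂)).restrict (Prod.snd ⁻¹' s) =
      (P₀ : Measure Ω₁).prod ((Q₀ : Measure Ω₂).restrict s) := by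
    conv_rhs => rw [← Measure.restrict_univ (μ := (P₀ : Measure Ω₁))]
    rw [Measure.prod_restrict, univ_prod]
    rfl
  have h4 : Integrable F ((P₀ : Measure Ω₁).prod ((Q₀ : Measure Ω₂).restrict s)) := by
    rw [← h3]; exact hFi.restrict
  rw [h3, integral_prod_symm _ h4]
  rfl

theorem memLp_tensor (a : Lp ℝ 2 (P₀ : Measure Ω₁)) (b : Lp ℝ 2 (Q₀ : Measure Ω₂)) :
    MemLp (fun ω : Ω₁ × Ω₂ => a ω.1 * b ω.2) 2 (P₀.prod Q₀ : Measure (Ω₁ × Ω₂)) := by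
  have hm : AEStronglyMeasurable (fun ω : Ω₁ × Ω₂ => a ω.1 * b ω.2)
      (P₀.prod Q₀ : Measure (Ω₁ × Ω₂)) :=
    (Lp.aestronglyMeasurable a).comp_fst.mul (Lp.aestronglyMeasurable b).comp_snd
  rw [memLp_two_iff_integrable_sq hm]
  simp only [mul_pow]
  exact (Lp.memLp a).integrable_sq.mul_prod (Lp.memLp b).integrable_sq

/-- The function `a ⊗ b : (ω₁, ω₂) ↦ a ω₁ * b ω₂` in `L₂(P₀ ⊗ Q₀)`. -/
def tensorLp (a : Lp ℝ 2 (P₀ : Measure Ω₁)) (b : Lp ℝ 2 (Q₀ : Measure Ω₂)) :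
    Lp ℝ 2 (P₀.prod Q₀ : Measure (Ω₁ × Ω₂)) :=
  (memLp_tensor a b).toLp

theorem inner_tensorLp (a a' : Lp ℝ 2 (P₀ : Measure Ω₁)) (b b' : Lp ℝ 2 (Q₀ : Measure Ω₂)) :
    inner ℝ (tensorLp a b) (tensorLp a' b') = inner ℝ a a' * inner ℝ b b' := by
  rw [inner_eq_integral_mul, inner_eq_integral_mul, inner_eq_integral_mul, ← integral_prod_mul]
  refine integral_congr_ae ?_
  filter_upwards [(memLp_tensor a b).coeFn_toLp, (memLp_tensor a' b').coeFn_toLp] with ω h1 h2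
  rw [tensorLp, tensorLp, h1, h2]
  ring

theorem ae_fst {p : Ω₁ → Prop} (h : ∀ᵐ x ∂(P₀ : Measure Ω₁), p x) :
    ∀ᵐ ω ∂(P₀.prod Q₀ : Measure (Ω₁ × Ω₂)), p ω.1 :=
  (measurePreserving_fst_prod P₀ Q₀).quasiMeasurePreserving.ae h

theorem ae_snd {p : Ω₂ → Prop} (h : ∀ᵐ x ∂(Q₀ : Measure Ω₂), p x) :
    ∀ᵐ ω ∂(P₀.prod Q₀ : Measure (Ω₁ × Ω₂)), p ω.2 :=
  (measurePreserving_snd_prod P₀ Q₀).quasiMeasurePreserving.ae h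

theorem liftFst_eq_tensorLp (a : Lp ℝ 2 (P₀ : Measure Ω₁)) :
    liftFst P₀ Q₀ a = tensorLp a (oneLp (Q₀ : Measure Ω₂)) := by
  refine Lp.ext ?_
  filter_upwards [coeFn_liftFst (Q₀ := Q₀) a, (memLp_tensor a (oneLp (Q₀ : Measure Ω₂))).coeFn_toLp,
    ae_snd (P₀ := P₀) (coeFn_oneLp (Q₀ : Measure Ω₂))] with ω h1 h2 h3
  rw [tensorLp, h1, h2, h3, mul_one]

theorem liftSnd_eq_tensorLp (b : Lp ℝ 2 (Q₀ : Measure Ω₂)) :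
    liftSnd P₀ Q₀ b = tensorLp (oneLp (P₀ : Measure Ω₁)) b := by
  refine Lp.ext ?_
  filter_upwards [coeFn_liftSnd (P₀ := P₀) b, (memLp_tensor (oneLp (P₀ : Measure Ω₁)) b).coeFn_toLp,
    ae_fst (Q₀ := Q₀) (coeFn_oneLp (P₀ : Measure Ω₁))] with ω h1 h2 h3
  rw [tensorLp, h1, h2, h3, one_mul]

theorem oneLp_prod :
    oneLp (P₀.prod Q₀ : Measure (Ω₁ × Ω₂)) =
      tensorLp (oneLp (P₀ : Measure Ω₁)) (oneLp (Q₀ : Measure Ω₂)) := by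
  refine Lp.ext ?_
  filter_upwards [coeFn_oneLp (P₀.prod Q₀ : Measure (Ω₁ × Ω₂)),
    (memLp_tensor (oneLp (P₀ : Measure Ω₁)) (oneLp (Q₀ : Measure Ω₂))).coeFn_toLp,
    ae_fst (Q₀ := Q₀) (coeFn_oneLp (P₀ : Measure Ω₁)),
    ae_snd (P₀ := P₀) (coeFn_oneLp (Q₀ : Measure Ω₂))] with ω h1 h2 h3 h4
  rw [tensorLp, h1, h2, h3, h4, one_mul]

theorem margFst_tensorLp (a : Lp ℝ 2 (P₀ : Measure Ω₁)) (b : Lp ℝ 2 (Q₀ : Measure Ω₂)) :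
    margFst P₀ Q₀ (tensorLp a b) = (inner ℝ b (oneLp (Q₀ : Measure Ω₂)) : ℝ) • a := by
  refine ext_inner_right ℝ fun v => ?_
  rw [inner_margFst, liftFst_eq_tensorLp, inner_tensorLp, real_inner_smul_left, mul_comm]

theorem margSnd_tensorLp (a : Lp ℝ 2 (P₀ : Measure Ω₁)) (b : Lp ℝ 2 (Q₀ : Measure Ω₂)) :
    margSnd P₀ Q₀ (tensorLp a b) = (inner ℝ a (oneLp (P₀ : Measure Ω₁)) : ℝ) • b := by
  refine ext_inner_right ℝ fun v => ?_
  rw [inner_margSnd, liftSnd_eq_tensorLp, inner_tensorLp, real_inner_smul_left]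

theorem inner_oneLp_self {Ω : Type*} [MeasurableSpace Ω] (μ : Measure Ω) [IsProbabilityMeasure μ] :
    inner ℝ (oneLp μ) (oneLp μ) = (1 : ℝ) := by
  rw [real_inner_self_eq_norm_sq, norm_oneLp, one_pow]

theorem margFst_oneLp : margFst P₀ Q₀ (oneLp (P₀.prod Q₀ : Measure (Ω₁ × Ω₂))) =
    oneLp (P₀ : Measure Ω₁) := by
  rw [oneLp_prod, margFst_tensorLp, inner_oneLp_self, one_smul]

theorem margSnd_oneLp : margSnd P₀ Q₀ (oneLp (P₀.prod Q₀ : Measure (Ω₁ × Ω₂))) =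
    oneLp (Q₀ : Measure Ω₂) := by
  rw [oneLp_prod, margSnd_tensorLp, inner_oneLp_self, one_smul]

theorem rnDeriv_prod_ae_eq (P : ProbabilityMeasure Ω₁) (Q : ProbabilityMeasure Ω₂) :
    (fun ω : Ω₁ × Ω₂ => (P : Measure Ω₁).rnDeriv (P₀ : Measure Ω₁) ω.1 *
      (Q : Measure Ω₂).rnDeriv (Q₀ : Measure Ω₂) ω.2) =ᵐ[(P₀.prod Q₀ : Measure (Ω₁ × Ω₂))]
      (P.prod Q : Measure (Ω₁ × Ω₂)).rnDeriv (P₀.prod Q₀ : Measure (Ω₁ × Ω₂)) := by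
  set L₁ := (P : Measure Ω₁).rnDeriv (P₀ : Measure Ω₁)
  set L₂ := (Q : Measure Ω₂).rnDeriv (Q₀ : Measure Ω₂)
  have m₁ : Measurable L₁ := Measure.measurable_rnDeriv _ _
  have m₂ : Measurable L₂ := Measure.measurable_rnDeriv _ _
  set s₁ := (P : Measure Ω₁).singularPart (P₀ : Measure Ω₁)
  set s₂ := (Q : Measure Ω₂).singularPart (Q₀ : Measure Ω₂)
  have hs₁ : s₁ ⟂ₘ (P₀ : Measure Ω₁) := Measure.mutuallySingular_singularPart _ _
  have hs₂ : s₂ ⟂ₘ (Q₀ : Measure Ω₂) := Measure.mutuallySingular_singularPart _ _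
  have hP : s₁ + (P₀ : Measure Ω₁).withDensity L₁ = P :=
    (Measure.haveLebesgueDecomposition_add _ _).symm
  have hQ : s₂ + (Q₀ : Measure Ω₂).withDensity L₂ = Q :=
    (Measure.haveLebesgueDecomposition_add _ _).symm
  have : IsFiniteMeasure ((P₀ : Measure Ω₁).withDensity L₁) :=
    isFiniteMeasure_of_le (P : Measure Ω₁) (Measure.withDensity_rnDeriv_le _ _)
  have : IsFiniteMeasure ((Q₀ : Measure Ω₂).withDensity L₂) :=
    isFiniteMeasure_of_le (Q : Measure Ω₂) (Measure.withDensity_rnDeriv_le _ _)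
  -- the singular part of `P ⊗ Q` is `s₁ ⊗ Q + (L₁ P₀) ⊗ s₂`
  refine Measure.eq_rnDeriv (s := s₁.prod (Q : Measure Ω₂) +
    ((P₀ : Measure Ω₁).withDensity L₁).prod s₂) (by fun_prop) ?_ ?_
  · refine Measure.MutuallySingular.add_left ?_ ?_
    · obtain ⟨A, hA, h1, h2⟩ := hs₁
      refine ⟨A ×ˢ univ, hA.prod .univ, by simp [h1], ?_⟩
      have : (A ×ˢ (univ : Set Ω₂))ᶜ = Aᶜ ×ˢ univ := by ext; simp
      rw [this]
      simp [h2]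
    · obtain ⟨A, hA, h1, h2⟩ := hs₂
      refine ⟨univ ×ˢ A, .prod .univ hA, by simp [h1], ?_⟩
      have : ((univ : Set Ω₁) ×ˢ A)ᶜ = univ ×ˢ Aᶜ := by ext; simp
      rw [this]
      simp [h2]
  · change (P : Measure Ω₁).prod (Q : Measure Ω₂) = _
    have h3 : ((P₀.prod Q₀ : Measure (Ω₁ × Ω₂))).withDensity (fun ω => L₁ ω.1 * L₂ ω.2) =
        ((P₀ : Measure Ω₁).withDensity L₁).prod ((Q₀ : Measure Ω₂).withDensity L₂) :=
      (prod_withDensity m₁ m₂).symm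
    rw [h3, add_assoc, ← Measure.prod_add, hQ, ← Measure.add_prod, hP]

theorem halfDensity_prod (P : ProbabilityMeasure Ω₁) (Q : ProbabilityMeasure Ω₂) :
    halfDensity (P.prod Q) (P₀.prod Q₀) = tensorLp (halfDensity P P₀) (halfDensity Q Q₀) := by
  refine Lp.ext ?_
  filter_upwards [coeFn_halfDensity (P.prod Q) (P₀.prod Q₀), rnDeriv_prod_ae_eq P Q,
    (memLp_tensor (halfDensity P P₀) (halfDensity Q Q₀)).coeFn_toLp,
    ae_fst (Q₀ := Q₀) (coeFn_halfDensity P P₀),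
    ae_snd (P₀ := P₀) (coeFn_halfDensity Q Q₀)] with ω h1 h2 h3 h4 h5
  rw [h1, ← h2, tensorLp, h3, h4, h5, ENNReal.toReal_mul, Real.sqrt_mul ENNReal.toReal_nonneg]

theorem affinity_prod (P : ProbabilityMeasure Ω₁) (Q : ProbabilityMeasure Ω₂) :
    affinity (P.prod Q) (P₀.prod Q₀) = affinity P P₀ * affinity Q Q₀ := by
  rw [affinity, halfDensity_prod, oneLp_prod, inner_tensorLp]
  rfl

theorem norm_halfDensity_prod_sq (P : ProbabilityMeasure Ω₁) (Q : ProbabilityMeasure Ω₂) :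
    ‖halfDensity (P.prod Q) (P₀.prod Q₀)‖ ^ 2 =
      ‖halfDensity P P₀‖ ^ 2 * ‖halfDensity Q Q₀‖ ^ 2 := by
  rw [halfDensity_prod, ← real_inner_self_eq_norm_sq, inner_tensorLp, real_inner_self_eq_norm_sq,
    real_inner_self_eq_norm_sq]

/-- The absolutely continuous mass `1 - singularMass` is multiplicative, so the singular mass of a
factor is at most that of the product. -/
theorem singularMass_fst_le (P : ProbabilityMeasure Ω₁) (Q : ProbabilityMeasure Ω₂) :
    singularMass P P₀ ≤ singularMass (P.prod Q) (P₀.prod Q₀) := by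
  have h1 := norm_halfDensity_sq P P₀
  have h2 := norm_halfDensity_sq Q Q₀
  have h3 := norm_halfDensity_sq (P.prod Q) (P₀.prod Q₀)
  rw [norm_halfDensity_prod_sq] at h3
  nlinarith [sq_nonneg ‖halfDensity P P₀‖, singularMass_nonneg Q Q₀]

theorem singularMass_snd_le (P : ProbabilityMeasure Ω₁) (Q : ProbabilityMeasure Ω₂) :
    singularMass Q Q₀ ≤ singularMass (P.prod Q) (P₀.prod Q₀) := by
  have h1 := norm_halfDensity_sq P P₀
  have h2 := norm_halfDensity_sq Q Q₀
  have h3 := norm_halfDensity_sq (P.prod Q) (P₀.prod Q₀)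
  rw [norm_halfDensity_prod_sq] at h3
  nlinarith [sq_nonneg ‖halfDensity Q Q₀‖, singularMass_nonneg P P₀]

variable {ι : Type*} {l : Filter ι} {c : ι → ℝ}

/-- The affinity defect along a local sequence is of order `1 / c²`, hence `o(1 / c)`. -/
theorem HasLocalTangent.tendsto_mul_one_sub_affinity {Ω : Type*} [MeasurableSpace Ω]
    {R : ι → ProbabilityMeasure Ω} {R₀ : ProbabilityMeasure Ω} {h : Lp ℝ 2 (R₀ : Measure Ω)}
    (hR : HasLocalTangent l c R R₀ h) (hc : Tendsto (fun i => (c i)⁻¹) l (𝓝 0)) :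
    Tendsto (fun i => |c i| * (1 - affinity (R i) R₀)) l (𝓝 0) := by
  have h1 := (((hR.1.norm.pow 2).mul_const (1 / 4)).add hR.2).mul (hc.abs.mul_const (1 / 2))
  rw [abs_zero, zero_mul, mul_zero] at h1
  refine h1.congr fun i => ?_
  have h2 := two_mul_one_sub_affinity (R i) R₀
  rw [norm_smul, Real.norm_eq_abs, mul_pow, sq_abs]
  by_cases hci : c i = 0
  · simp [hci]
  · have h3 : (c i) ^ 2 * |(c i)⁻¹| = |c i| := by
      rw [abs_inv, ← sq_abs]
      field_simp
    rw [← h3]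
    linear_combination (-(1 / 2) * (c i) ^ 2 * |(c i)⁻¹|) * h2

variable {P : ι → ProbabilityMeasure Ω₁} {Q : ι → ProbabilityMeasure Ω₂}
  {h : Lp ℝ 2 (P₀.prod Q₀ : Measure (Ω₁ × Ω₂))}

/-- Local tangents pass to the first marginal. Integrating out the second coordinate multiplies the
half density by the affinity of the second factor, which is one up to `o(1 / c)`. -/
theorem HasLocalTangent.fst (hc : Tendsto (fun i => (c i)⁻¹) l (𝓝 0))
    (hR : HasLocalTangent l c (fun i => (P i).prod (Q i)) (P₀.prod Q₀) h) :
    HasLocalTangent l c P P₀ (margFst P₀ Q₀ h) := by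
  refine ⟨?_, ?_⟩
  · have h1 := ((margFst P₀ Q₀).continuous.tendsto h).comp hR.1
    have h2 : Tendsto (fun i => (2 * c i * (1 - affinity (Q i) Q₀)) • halfDensity (P i) P₀)
        l (𝓝 0) := by
      have h3 := (hR.tendsto_mul_one_sub_affinity hc).const_mul 2
      rw [mul_zero] at h3
      refine squeeze_zero_norm (fun i => ?_) h3
      rw [norm_smul, Real.norm_eq_abs, abs_mul, abs_mul, abs_two, affinity_prod,
        abs_of_nonneg (sub_nonneg.2 (affinity_le_one (Q i) Q₀))]
      have a1 := norm_halfDensity_le_one (P i) P₀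
      have a2 := affinity_le_one (Q i) Q₀
      have a3 := affinity_le_one (P i) P₀
      have a4 := affinity_nonneg (Q i) Q₀
      calc 2 * |c i| * (1 - affinity (Q i) Q₀) * ‖halfDensity (P i) P₀‖
          ≤ 2 * |c i| * (1 - affinity (Q i) Q₀) * 1 := by
            gcongr
        _ ≤ 2 * (|c i| * (1 - affinity (P i) P₀ * affinity (Q i) Q₀)) := by
            rw [mul_one, mul_assoc]
            gcongr
            nlinarith
    have h4 := h1.add h2
    rw [add_zero] at h4
    refine h4.congr fun i => ?_
    simp only [Function.comp, map_smul, map_sub, halfDensity_prod, margFst_tensorLp,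
      margFst_oneLp]
    change (2 * c i) • (affinity (Q i) Q₀ • _ - _) + _ = _
    module
  · refine squeeze_zero (fun i => mul_nonneg (sq_nonneg _) (singularMass_nonneg _ _))
      (fun i => ?_) hR.2
    exact mul_le_mul_of_nonneg_left (singularMass_fst_le _ _) (sq_nonneg _)

/-- Local tangents pass to the second marginal. -/
theorem HasLocalTangent.snd (hc : Tendsto (fun i => (c i)⁻¹) l (𝓝 0))
    (hR : HasLocalTangent l c (fun i => (P i).prod (Q i)) (P₀.prod Q₀) h) :
    HasLocalTangent l c Q Q₀ (margSnd P₀ Q₀ h) := by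
  refine ⟨?_, ?_⟩
  · have h1 := ((margSnd P₀ Q₀).continuous.tendsto h).comp hR.1
    have h2 : Tendsto (fun i => (2 * c i * (1 - affinity (P i) P₀)) • halfDensity (Q i) Q₀)
        l (𝓝 0) := by
      have h3 := (hR.tendsto_mul_one_sub_affinity hc).const_mul 2
      rw [mul_zero] at h3
      refine squeeze_zero_norm (fun i => ?_) h3
      rw [norm_smul, Real.norm_eq_abs, abs_mul, abs_mul, abs_two, affinity_prod,
        abs_of_nonneg (sub_nonneg.2 (affinity_le_one (P i) P₀))]
      have a1 := norm_halfDensity_le_one (Q i) Q₀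
      have a2 := affinity_le_one (Q i) Q₀
      have a3 := affinity_le_one (P i) P₀
      have a4 := affinity_nonneg (P i) P₀
      calc 2 * |c i| * (1 - affinity (P i) P₀) * ‖halfDensity (Q i) Q₀‖
          ≤ 2 * |c i| * (1 - affinity (P i) P₀) * 1 := by
            gcongr
        _ ≤ 2 * (|c i| * (1 - affinity (P i) P₀ * affinity (Q i) Q₀)) := by
            rw [mul_one, mul_assoc]
            gcongr
            nlinarith
    have h4 := h1.add h2
    rw [add_zero] at h4
    refine h4.congr fun i => ?_
    simp only [Function.comp, map_smul, map_sub, halfDensity_prod, margSnd_tensorLp,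
      margSnd_oneLp]
    change (2 * c i) • (affinity (P i) P₀ • _ - _) + _ = _
    module
  · refine squeeze_zero (fun i => mul_nonneg (sq_nonneg _) (singularMass_nonneg _ _))
      (fun i => ?_) hR.2
    exact mul_le_mul_of_nonneg_left (singularMass_snd_le _ _) (sq_nonneg _)

/-- Perturbing only the first factor: the tangent depends on the first coordinate only. -/
theorem HasLocalTangent.prod_const {a : Lp ℝ 2 (P₀ : Measure Ω₁)}
    (hP : HasLocalTangent l c P P₀ a) :
    HasLocalTangent l c (fun i => (P i).prod Q₀) (P₀.prod Q₀) (liftFst P₀ Q₀ a) := by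
  refine ⟨?_, hP.2.congr fun i => ?_⟩
  · refine (((liftFst P₀ Q₀).continuous.tendsto a).comp hP.1).congr fun i => ?_
    simp only [Function.comp, map_smul, map_sub, halfDensity_prod, halfDensity_self,
      oneLp_prod, liftFst_eq_tensorLp]
  · have h3 := norm_halfDensity_sq ((P i).prod Q₀) (P₀.prod Q₀)
    rw [norm_halfDensity_prod_sq, halfDensity_self, norm_oneLp, norm_halfDensity_sq] at h3
    congr 1
    linarith

/-- Perturbing only the second factor: the tangent depends on the second coordinate only. -/
theorem HasLocalTangent.const_prod {b : Lp ℝ 2 (Q₀ : Measure Ω₂)}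
    (hQ : HasLocalTangent l c Q Q₀ b) :
    HasLocalTangent l c (fun i => P₀.prod (Q i)) (P₀.prod Q₀) (liftSnd P₀ Q₀ b) := by
  refine ⟨?_, hQ.2.congr fun i => ?_⟩
  · refine (((liftSnd P₀ Q₀).continuous.tendsto b).comp hQ.1).congr fun i => ?_
    simp only [Function.comp, map_smul, map_sub, halfDensity_prod, halfDensity_self,
      oneLp_prod, liftSnd_eq_tensorLp]
  · have h3 := norm_halfDensity_sq (P₀.prod (Q i)) (P₀.prod Q₀)
    rw [norm_halfDensity_prod_sq, halfDensity_self, norm_oneLp, norm_halfDensity_sq] at h3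
    congr 1
    linarith

/-- A tangent of product measures is the sum of its marginal tangents: the remainder is
`(D₁ - 1) ⊗ (D₂ - 1)` for the half densities `D₁`, `D₂` of the factors, which is of second order. -/
theorem HasLocalTangent.eq_add (hc : Tendsto (fun i => (c i)⁻¹) l (𝓝 0)) [l.NeBot]
    (hR : HasLocalTangent l c (fun i => (P i).prod (Q i)) (P₀.prod Q₀) h) :
    h = liftFst P₀ Q₀ (margFst P₀ Q₀ h) + liftSnd P₀ Q₀ (margSnd P₀ Q₀ h) := by
  have h1 := ((liftFst P₀ Q₀).continuous.tendsto _).comp (hR.fst hc).1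
  have h2 := ((liftSnd P₀ Q₀).continuous.tendsto _).comp (hR.snd hc).1
  have h3 := (hR.1.sub h1).sub h2
  have h4 := ((hR.fst hc).1.norm.mul (hR.snd hc).1.norm).mul (hc.abs.mul_const (1 / 2))
  rw [abs_zero, zero_mul, mul_zero] at h4
  rw [← sub_eq_zero, ← sub_sub]
  refine tendsto_nhds_unique h3 (squeeze_zero_norm' ?_ h4)
  filter_upwards with i
  set D₁ := halfDensity (P i) P₀
  set D₂ := halfDensity (Q i) Q₀
  set e₁ := oneLp (P₀ : Measure Ω₁)
  set e₂ := oneLp (Q₀ : Measure Ω₂)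
  -- the remainder is `(D₁ - e₁) ⊗ (D₂ - e₂)`
  have h5 : ‖(tensorLp D₁ D₂ - tensorLp e₁ e₂) - (tensorLp D₁ e₂ - tensorLp e₁ e₂) -
      (tensorLp e₁ D₂ - tensorLp e₁ e₂)‖ = ‖D₁ - e₁‖ * ‖D₂ - e₂‖ := by
    rw [← sq_eq_sq₀ (norm_nonneg _) (by positivity), mul_pow]
    simp only [← real_inner_self_eq_norm_sq, inner_sub_left, inner_sub_right, inner_tensorLp,
      real_inner_comm D₁ e₁, real_inner_comm D₂ e₂]
    ring
  simp only [Function.comp, map_smul, map_sub, halfDensity_prod, oneLp_prod,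
    liftFst_eq_tensorLp, liftSnd_eq_tensorLp, ← smul_sub]
  rw [norm_smul, h5, norm_smul, norm_smul]
  by_cases hci : c i = 0
  · simp [hci]
  · refine le_of_eq ?_
    have h6 : |c i| ≠ 0 := abs_ne_zero.2 hci
    rw [Real.norm_eq_abs, abs_mul, abs_two, abs_inv]
    field_simp

end ProductStructure

/-! ### Limits of integrals against convergent sequences in `L₂` -/

section L2Limits

variable {Ω : Type*} [MeasurableSpace Ω] {μ : Measure Ω}

theorem integral_norm_mul_norm_le {u : Ω → ℝ} (hu : MemLp u 2 μ) (w : Lp ℝ 2 μ) :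
    ∫ ω, |u ω| * |w ω| ∂μ ≤ ‖hu.toLp u‖ * ‖w‖ := by
  have h := real_inner_le_norm (|hu.toLp u|) |w|
  rw [norm_abs_eq_norm, norm_abs_eq_norm, inner_eq_integral_mul] at h
  refine le_trans (le_of_eq (integral_congr_ae ?_)) h
  filter_upwards [hu.coeFn_toLp, Lp.coeFn_abs (hu.toLp u), Lp.coeFn_abs w] with ω h1 h2 h3
  rw [h2, h3, h1]

theorem integrable_mul_of_norm_le {F : Ω → ℂ} (hF : AEStronglyMeasurable F μ) {C : ℝ} {u : Ω → ℝ}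
    (hu : MemLp u 2 μ) (hb : ∀ ω, ‖F ω‖ ≤ C * |u ω|) (w : Lp ℝ 2 μ) :
    Integrable (fun ω => F ω * (w ω : ℂ)) μ := by
  refine Integrable.mono' (g := fun ω => C * |u ω * w ω|)
    ((hu.integrable_mul (Lp.memLp w)).abs.const_mul C)
    (hF.mul (Complex.continuous_ofReal.comp_aestronglyMeasurable (Lp.aestronglyMeasurable w))) ?_
  filter_upwards with ω
  rw [norm_mul, Complex.norm_real, Real.norm_eq_abs, abs_mul, ← mul_assoc]
  exact mul_le_mul_of_nonneg_right (hb ω) (abs_nonneg _)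

/-- Dominated convergence for products in which one factor converges in `L₂` and the other one
pointwise. -/
theorem tendsto_integral_mul_of_tendsto_Lp {F : ℕ → Ω → ℂ} {F' : Ω → ℂ}
    (hF : ∀ n, AEStronglyMeasurable (F n) μ) {C : ℝ} (hC : 0 ≤ C) {u : Ω → ℝ} (hu : MemLp u 2 μ)
    (hb : ∀ n ω, ‖F n ω‖ ≤ C * |u ω|) (hlim : ∀ᵐ ω ∂μ, Tendsto (fun n => F n ω) atTop (𝓝 (F' ω)))
    {w : ℕ → Lp ℝ 2 μ} {h : Lp ℝ 2 μ} (hw : Tendsto w atTop (𝓝 h)) :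
    Tendsto (fun n => ∫ ω, F n ω * (w n ω : ℂ) ∂μ) atTop (𝓝 (∫ ω, F' ω * (h ω : ℂ) ∂μ)) := by
  have h1 : Tendsto (fun n => ∫ ω, F n ω * (h ω : ℂ) ∂μ) atTop
      (𝓝 (∫ ω, F' ω * (h ω : ℂ) ∂μ)) := by
    refine tendsto_integral_of_dominated_convergence (fun ω => C * |u ω * h ω|)
      (fun n => (integrable_mul_of_norm_le (hF n) hu (hb n) h).aestronglyMeasurable)
      ((hu.integrable_mul (Lp.memLp h)).abs.const_mul C) (fun n => ?_) ?_
    · filter_upwards with ω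
      rw [norm_mul, Complex.norm_real, Real.norm_eq_abs, abs_mul, ← mul_assoc]
      exact mul_le_mul_of_nonneg_right (hb n ω) (abs_nonneg _)
    · filter_upwards [hlim] with ω hω
      exact hω.mul_const _
  have h2 : Tendsto (fun n => ∫ ω, F n ω * ((w n - h : Lp ℝ 2 μ) ω : ℂ) ∂μ) atTop (𝓝 0) := by
    have h3 : Tendsto (fun n => C * (‖hu.toLp u‖ * ‖w n - h‖)) atTop (𝓝 0) := by
      have := ((tendsto_iff_norm_sub_tendsto_zero.1 hw).const_mul ‖hu.toLp u‖).const_mul C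
      simpa using this
    refine squeeze_zero_norm (fun n => ?_) h3
    refine (norm_integral_le_integral_norm _).trans ?_
    refine le_trans ?_ (mul_le_mul_of_nonneg_left (integral_norm_mul_norm_le hu (w n - h)) hC)
    rw [← integral_const_mul]
    refine integral_mono (integrable_mul_of_norm_le (hF n) hu (hb n) (w n - h)).norm ?_ fun ω => ?_
    · simp only [← abs_mul]
      exact (hu.integrable_mul (Lp.memLp (w n - h))).abs.const_mul C
    · beta_reduce
      rw [norm_mul, Complex.norm_real, Real.norm_eq_abs, ← mul_assoc]
      exact mul_le_mul_of_nonneg_right (hb n ω) (abs_nonneg _)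
  have h4 := h1.add h2
  rw [add_zero] at h4
  refine h4.congr fun n => ?_
  rw [← integral_add (integrable_mul_of_norm_le (hF n) hu (hb n) h)
    (integrable_mul_of_norm_le (hF n) hu (hb n) (w n - h))]
  refine integral_congr_ae ?_
  filter_upwards [Lp.coeFn_sub (w n) h] with ω hω
  rw [hω, Pi.sub_apply, Complex.ofReal_sub]
  ring

theorem integrable_bounded_mul_sq {F : Ω → ℂ} (hF : AEStronglyMeasurable F μ) {C : ℝ}
    (hb : ∀ᵐ ω ∂μ, ‖F ω‖ ≤ C) (w : Lp ℝ 2 μ) :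
    Integrable (fun ω => F ω * (w ω : ℂ) ^ 2) μ := by
  refine Integrable.mono' (g := fun ω => C * w ω ^ 2)
    ((Lp.memLp w).integrable_sq.const_mul C)
    (hF.mul ((Complex.continuous_ofReal.comp_aestronglyMeasurable
      (Lp.aestronglyMeasurable w)).pow 2)) ?_
  filter_upwards [hb] with ω h
  rw [norm_mul, norm_pow, Complex.norm_real, Real.norm_eq_abs, sq_abs]
  exact mul_le_mul_of_nonneg_right h (sq_nonneg _)

/-- Bounded functions that vanish in the limit, integrated against the squares of a sequence that
converges in `L₂`. -/
theorem tendsto_integral_mul_sq_zero {F : ℕ → Ω → ℂ}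
    (hF : ∀ n, AEStronglyMeasurable (F n) μ) {C : ℝ}
    (hb : ∀ n, ∀ᵐ ω ∂μ, ‖F n ω‖ ≤ C) (hlim : ∀ᵐ ω ∂μ, Tendsto (fun n => F n ω) atTop (𝓝 0))
    {w : ℕ → Lp ℝ 2 μ} {h : Lp ℝ 2 μ} (hw : Tendsto w atTop (𝓝 h)) :
    Tendsto (fun n => ∫ ω, F n ω * (w n ω : ℂ) ^ 2 ∂μ) atTop (𝓝 0) := by
  have h1 : Tendsto (fun n => ∫ ω, ‖F n ω‖ * h ω ^ 2 ∂μ) atTop (𝓝 0) := by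
    have : Tendsto (fun n => ∫ ω, ‖F n ω‖ * h ω ^ 2 ∂μ) atTop (𝓝 (∫ ω, (0 : ℝ) ∂μ)) := by
      refine tendsto_integral_of_dominated_convergence (fun ω => C * h ω ^ 2)
        (fun n => (hF n).norm.mul ((Lp.aestronglyMeasurable h).pow 2))
        ((Lp.memLp h).integrable_sq.const_mul C) (fun n => ?_) ?_
      · filter_upwards [hb n] with ω hω
        rw [norm_mul, norm_norm, norm_pow, Real.norm_eq_abs, sq_abs]
        exact mul_le_mul_of_nonneg_right hω (sq_nonneg _)
      · filter_upwards [hlim] with ω hω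
        have := hω.norm.mul_const (h ω ^ 2)
        simpa using this
    simpa using this
  have h2 := (h1.const_mul 2).add
    (((tendsto_iff_norm_sub_tendsto_zero.1 hw).pow 2).const_mul (2 * C))
  rw [zero_pow two_ne_zero, mul_zero, mul_zero, add_zero] at h2
  refine squeeze_zero_norm (fun n => ?_) h2
  refine (norm_integral_le_integral_norm _).trans ?_
  have i1 : Integrable (fun ω => ‖F n ω‖ * h ω ^ 2) μ := by
    refine (integrable_bounded_mul_sq (hF n) (hb n) h).norm.congr (ae_of_all _ fun ω => ?_)
    simp [norm_pow]
  have i2 : Integrable (fun ω => C * (w n - h : Lp ℝ 2 μ) ω ^ 2) μ :=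
    (Lp.memLp (w n - h)).integrable_sq.const_mul C
  rw [norm_sq_eq_integral_sq, mul_assoc, ← integral_const_mul C, ← mul_add, ← integral_add i1 i2,
    ← integral_const_mul 2]
  refine integral_mono_ae (integrable_bounded_mul_sq (hF n) (hb n) (w n)).norm
    ((i1.add i2).const_mul 2) ?_
  filter_upwards [hb n, Lp.coeFn_sub (w n) h] with ω h3 h4
  rw [norm_mul, norm_pow, Complex.norm_real, Real.norm_eq_abs, sq_abs, h4, Pi.sub_apply]
  have h5 : w n ω ^ 2 ≤ 2 * h ω ^ 2 + 2 * (w n ω - h ω) ^ 2 := by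
    nlinarith [sq_nonneg (w n ω - 2 * h ω)]
  calc ‖F n ω‖ * w n ω ^ 2 ≤ ‖F n ω‖ * (2 * h ω ^ 2 + 2 * (w n ω - h ω) ^ 2) := by gcongr
    _ = 2 * (‖F n ω‖ * h ω ^ 2 + ‖F n ω‖ * (w n ω - h ω) ^ 2) := by ring
    _ ≤ 2 * (‖F n ω‖ * h ω ^ 2 + C * (w n ω - h ω) ^ 2) := by gcongr

end L2Limits

/-! ### Characteristic functions under local alternatives -/

section CharFun

variable {Ω : Type*} [MeasurableSpace Ω]

/-- The rescaled score `2 √n ((dR/dR₀)^{1/2} - 1)`, which converges to the tangent. -/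
def scaledScore (n : ℕ) (R R₀ : ProbabilityMeasure Ω) : Lp ℝ 2 (R₀ : Measure Ω) :=
  (2 * √(n : ℝ)) • (halfDensity R R₀ - oneLp (R₀ : Measure Ω))

theorem coeFn_scaledScore (n : ℕ) (R R₀ : ProbabilityMeasure Ω) :
    scaledScore n R R₀ =ᵐ[(R₀ : Measure Ω)] fun ω =>
      2 * √(n : ℝ) * (√((R : Measure Ω).rnDeriv (R₀ : Measure Ω) ω).toReal - 1) := by
  filter_upwards [coeFn_halfDensity R R₀, coeFn_oneLp (R₀ : Measure Ω),
    Lp.coeFn_smul (2 * √(n : ℝ)) (halfDensity R R₀ - oneLp (R₀ : Measure Ω)),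
    Lp.coeFn_sub (halfDensity R R₀) (oneLp (R₀ : Measure Ω))] with ω h1 h2 h3 h4
  rw [scaledScore, h3, Pi.smul_apply, h4, Pi.sub_apply, h1, h2, smul_eq_mul]

theorem integral_eq_add_singularPart (R R₀ : ProbabilityMeasure Ω) {f : Ω → ℂ}
    (hf : Measurable f) {C : ℝ} (hb : ∀ ω, ‖f ω‖ ≤ C) :
    ∫ ω, f ω ∂(R : Measure Ω) =
      ∫ ω, f ω ∂((R : Measure Ω).singularPart (R₀ : Measure Ω)) +
        ∫ ω, ((R : Measure Ω).rnDeriv (R₀ : Measure Ω) ω).toReal • f ω ∂(R₀ : Measure Ω) := by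
  have : IsFiniteMeasure ((R₀ : Measure Ω).withDensity
      ((R : Measure Ω).rnDeriv (R₀ : Measure Ω))) :=
    isFiniteMeasure_of_le (R : Measure Ω) (Measure.withDensity_rnDeriv_le _ _)
  have hi : ∀ (ν : Measure Ω) [IsFiniteMeasure ν], Integrable f ν := fun ν _ =>
    Integrable.of_bound hf.aestronglyMeasurable C (ae_of_all _ hb)
  conv_lhs => rw [Measure.haveLebesgueDecomposition_add (R : Measure Ω) (R₀ : Measure Ω)]
  rw [integral_add_measure (hi _) (hi _), integral_withDensity_eq_integral_toReal_smul
    (Measure.measurable_rnDeriv _ _) (Measure.rnDeriv_lt_top _ _)]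

/-- Change of measure from `R` to `R₀`, expanded in the scaled score `w`: up to the singular part,
`n (∫ f dR - ∫ f dR₀) = ∫ √n f w dR₀ + ∫ f w² / 4 dR₀`, because
`L - 1 = 2 (√L - 1) + (√L - 1)²` for the density `L`. -/
theorem nat_mul_integral_sub (n : ℕ) (R R₀ : ProbabilityMeasure Ω) {f : Ω → ℂ}
    (hf : Measurable f) {C : ℝ} (hb : ∀ ω, ‖f ω‖ ≤ C) :
    (n : ℂ) * (∫ ω, f ω ∂(R : Measure Ω) - ∫ ω, f ω ∂(R₀ : Measure Ω)) =
      n * ∫ ω, f ω ∂((R : Measure Ω).singularPart (R₀ : Measure Ω)) +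
      (∫ ω, (√(n : ℝ) * f ω) * (scaledScore n R R₀ ω : ℂ) ∂(R₀ : Measure Ω) +
        1 / 4 * ∫ ω, f ω * (scaledScore n R R₀ ω : ℂ) ^ 2 ∂(R₀ : Measure Ω)) := by
  have hfi : Integrable f (R₀ : Measure Ω) :=
    Integrable.of_bound hf.aestronglyMeasurable C (ae_of_all _ hb)
  have h1 : Integrable (fun ω => ((R : Measure Ω).rnDeriv (R₀ : Measure Ω) ω).toReal • f ω)
      (R₀ : Measure Ω) :=
    Measure.integrable_toReal_rnDeriv.smul_bdd C hf.aestronglyMeasurable (ae_of_all _ hb)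
  have h2 : Integrable (fun ω => (√(n : ℝ) * f ω) * (scaledScore n R R₀ ω : ℂ))
      (R₀ : Measure Ω) := by
    refine integrable_mul_of_norm_le (C := √(n : ℝ) * C) (u := fun _ => 1) (by fun_prop)
      (memLp_const 1) (fun ω => ?_) _
    rw [norm_mul, Complex.norm_real, Real.norm_eq_abs, abs_of_nonneg (Real.sqrt_nonneg _), abs_one,
      mul_one]
    exact mul_le_mul_of_nonneg_left (hb ω) (Real.sqrt_nonneg _)
  have h3 := integrable_bounded_mul_sq hf.aestronglyMeasurable (ae_of_all _ hb)
    (scaledScore n R R₀)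
  rw [integral_eq_add_singularPart R R₀ hf hb, add_sub_assoc, mul_add, ← integral_sub h1 hfi,
    ← integral_const_mul (μ := (R₀ : Measure Ω)) (n : ℂ),
    ← integral_const_mul (μ := (R₀ : Measure Ω)) (1 / 4 : ℂ), ← integral_add h2 (h3.const_mul _)]
  congr 1
  refine integral_congr_ae ?_
  filter_upwards [coeFn_scaledScore n R R₀] with ω hω
  rw [hω, Complex.real_smul]
  set L := ((R : Measure Ω).rnDeriv (R₀ : Measure Ω) ω).toReal
  have e1 : ((√(n : ℝ) : ℝ) : ℂ) ^ 2 = n := by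
    rw [← Complex.ofReal_pow, Real.sq_sqrt (Nat.cast_nonneg n)]; simp
  have e2 : ((√L : ℝ) : ℂ) ^ 2 = (L : ℂ) := by
    rw [← Complex.ofReal_pow, Real.sq_sqrt ENNReal.toReal_nonneg]
  push_cast
  rw [← e1, ← e2]
  ring

theorem tendsto_singularPart_integral {R : ℕ → ProbabilityMeasure Ω} {R₀ : ProbabilityMeasure Ω}
    {h : Lp ℝ 2 (R₀ : Measure Ω)}
    (hR : HasLocalTangent atTop (fun n : ℕ => √(n : ℝ)) R R₀ h) {f : ℕ → Ω → ℂ} {C : ℝ}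
    (hb : ∀ n ω, ‖f n ω‖ ≤ C) :
    Tendsto (fun n : ℕ =>
      (n : ℂ) * ∫ ω, f n ω ∂((R n : Measure Ω).singularPart (R₀ : Measure Ω))) atTop (𝓝 0) := by
  have h1 := hR.2.const_mul C
  rw [mul_zero] at h1
  refine squeeze_zero_norm (fun n => ?_) h1
  rw [norm_mul, Complex.norm_natCast, Real.sq_sqrt (Nat.cast_nonneg n)]
  have := norm_integral_le_of_norm_le_const
    (μ := (R n : Measure Ω).singularPart (R₀ : Measure Ω)) (ae_of_all _ (hb n))
  calc (n : ℝ) * _ ≤ n * (C * singularMass (R n) R₀) := by gcongr; exact this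
    _ = _ := by ring

theorem norm_cexp_mul_I_sub_one_le (x : ℝ) : ‖Complex.exp (x * Complex.I) - 1‖ ≤ |x| := by
  have := Real.norm_exp_I_mul_ofReal_sub_one_le (x := x)
  rwa [mul_comm, Real.norm_eq_abs] at this

theorem norm_cexp_mul_I_sub_one_sub_le (x : ℝ) :
    ‖Complex.exp (x * Complex.I) - 1 - x * Complex.I‖ ≤ 2 * x ^ 2 := by
  have hn : ‖(x * Complex.I : ℂ)‖ = |x| := by simp
  by_cases hx : |x| ≤ 1
  · have := Complex.norm_exp_sub_one_sub_id_le (x := x * Complex.I) (by rwa [hn])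
    rw [hn, sq_abs] at this
    nlinarith [sq_nonneg x]
  · refine (norm_sub_le _ _).trans ?_
    rw [hn]
    have := norm_cexp_mul_I_sub_one_le x
    nlinarith [sq_abs x]

theorem norm_cexp_sub_taylor_two_le {z : ℂ} (hz : ‖z‖ ≤ 1) :
    ‖Complex.exp z - 1 - z - z ^ 2 / 2‖ ≤ ‖z‖ ^ 3 := by
  have h := Complex.exp_bound hz (n := 3) (by norm_num)
  have e : Complex.exp z - 1 - z - z ^ 2 / 2 =
      Complex.exp z - ∑ m ∈ Finset.range 3, z ^ m / (m.factorial : ℂ) := by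
    simp [Finset.sum_range_succ, Nat.factorial]
    ring
  rw [e]
  refine h.trans ?_
  norm_num [Nat.factorial]
  nlinarith [pow_nonneg (norm_nonneg z) 3]

variable {a : ℕ → ℝ} {a' : ℝ}

theorem tendsto_zero_of_sqrt_mul (ha : Tendsto (fun n : ℕ => √(n : ℝ) * a n) atTop (𝓝 a')) :
    Tendsto a atTop (𝓝 0) := by
  have h1 : Tendsto (fun n : ℕ => (√(n : ℝ))⁻¹) atTop (𝓝 0) :=
    tendsto_inv_atTop_zero.comp (Real.tendsto_sqrt_atTop.comp tendsto_natCast_atTop_atTop)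
  have h2 := h1.mul ha
  rw [zero_mul] at h2
  refine h2.congr' ?_
  filter_upwards [eventually_gt_atTop 0] with n hn
  have : √(n : ℝ) ≠ 0 := (Real.sqrt_pos.2 (Nat.cast_pos.2 hn)).ne'
  field_simp

theorem tendsto_nat_mul_cexp_taylor (ha : Tendsto (fun n : ℕ => √(n : ℝ) * a n) atTop (𝓝 a'))
    (u : ℝ) :
    Tendsto (fun n : ℕ => (n : ℂ) * (Complex.exp ((a n * u : ℝ) * Complex.I) - 1 -
      (a n * u : ℝ) * Complex.I)) atTop (𝓝 ((-(a' * u) ^ 2 / 2 : ℝ) : ℂ)) := by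
  have ha0 := tendsto_zero_of_sqrt_mul ha
  have h1 : Tendsto (fun n : ℕ => (√(n : ℝ) * a n) ^ 2 * |u| ^ 3 * |a n|) atTop (𝓝 0) := by
    have := ((ha.pow 2).mul_const (|u| ^ 3)).mul ha0.abs
    rwa [abs_zero, mul_zero] at this
  have h2 : Tendsto (fun n : ℕ => (n : ℂ) * (Complex.exp ((a n * u : ℝ) * Complex.I) - 1 -
      (a n * u : ℝ) * Complex.I - ((a n * u : ℝ) * Complex.I) ^ 2 / 2)) atTop (𝓝 0) := by
    refine squeeze_zero_norm' ?_ h1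
    have h3 : Tendsto (fun n => |a n * u|) atTop (𝓝 0) := by
      have := (ha0.mul_const u).abs
      rwa [zero_mul, abs_zero] at this
    filter_upwards [h3.eventually_le_const (zero_lt_one' ℝ)] with n hn
    have hz : ‖((a n * u : ℝ) * Complex.I : ℂ)‖ = |a n * u| := by simp
    rw [norm_mul, Complex.norm_natCast]
    refine (mul_le_mul_of_nonneg_left (norm_cexp_sub_taylor_two_le (by rwa [hz]))
      (Nat.cast_nonneg n)).trans (le_of_eq ?_)
    rw [hz, abs_mul, mul_pow |a n|, mul_pow (√(n : ℝ)),
      Real.sq_sqrt (Nat.cast_nonneg n), ← sq_abs (a n)]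
    ring
  have h4 : Tendsto (fun n : ℕ => ((-((√(n : ℝ) * a n) * u) ^ 2 / 2 : ℝ) : ℂ)) atTop
      (𝓝 ((-(a' * u) ^ 2 / 2 : ℝ) : ℂ)) :=
    (Complex.continuous_ofReal.tendsto _).comp
      ((((ha.mul_const u).pow 2).neg).div_const 2)
  have h5 := h2.add h4
  rw [zero_add] at h5
  refine h5.congr fun n => ?_
  rw [mul_pow (√(n : ℝ) * a n), mul_pow (√(n : ℝ)), Real.sq_sqrt (Nat.cast_nonneg n), mul_pow,
    Complex.I_sq]
  push_cast
  ring

theorem tendsto_sqrt_mul_cexp_sub_one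
    (ha : Tendsto (fun n : ℕ => √(n : ℝ) * a n) atTop (𝓝 a')) (u : ℝ) :
    Tendsto (fun n : ℕ => ((√(n : ℝ) : ℝ) : ℂ) * (Complex.exp ((a n * u : ℝ) * Complex.I) - 1))
      atTop (𝓝 ((a' * u : ℝ) * Complex.I)) := by
  have ha0 := tendsto_zero_of_sqrt_mul ha
  have h1 : Tendsto (fun n : ℕ => 2 * |√(n : ℝ) * a n| * |a n| * u ^ 2) atTop (𝓝 0) := by
    have := ((ha.abs.const_mul 2).mul ha0.abs).mul_const (u ^ 2)
    rwa [abs_zero, mul_zero, zero_mul] at this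
  have h2 : Tendsto (fun n : ℕ => ((√(n : ℝ) : ℝ) : ℂ) *
      (Complex.exp ((a n * u : ℝ) * Complex.I) - 1 - (a n * u : ℝ) * Complex.I)) atTop (𝓝 0) := by
    refine squeeze_zero_norm (fun n => ?_) h1
    rw [norm_mul, Complex.norm_real, Real.norm_eq_abs]
    refine (mul_le_mul_of_nonneg_left (norm_cexp_mul_I_sub_one_sub_le _)
      (abs_nonneg _)).trans (le_of_eq ?_)
    rw [abs_mul, mul_pow, ← sq_abs (a n)]
    ring
  have h4 : Tendsto (fun n : ℕ => ((√(n : ℝ) * a n * u : ℝ) : ℂ) * Complex.I) atTop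
      (𝓝 ((a' * u : ℝ) * Complex.I)) :=
    ((Complex.continuous_ofReal.tendsto _).comp (ha.mul_const u)).mul_const _
  have h5 := h2.add h4
  rw [zero_add] at h5
  refine h5.congr fun n => ?_
  push_cast
  ring

/-- The characteristic function of a centred square-integrable statistic under local alternatives,
to the order `1 / n`. The drift term is the inner product of the statistic with the tangent. -/
theorem HasLocalTangent.tendsto_charFun_statistic {R : ℕ → ProbabilityMeasure Ω}
    {R₀ : ProbabilityMeasure Ω} {h : Lp ℝ 2 (R₀ : Measure Ω)}
    (hR : HasLocalTangent atTop (fun n : ℕ => √(n : ℝ)) R R₀ h) {u : Ω → ℝ} (hu : Measurable u)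
    (hu2 : MemLp u 2 (R₀ : Measure Ω)) (hu0 : ∫ ω, u ω ∂(R₀ : Measure Ω) = 0)
    (ha : Tendsto (fun n : ℕ => √(n : ℝ) * a n) atTop (𝓝 a')) :
    Tendsto (fun n : ℕ => (n : ℂ) *
        (∫ ω, Complex.exp ((a n * u ω : ℝ) * Complex.I) ∂(R n : Measure Ω) - 1)) atTop
      (𝓝 (((-a' ^ 2 / 2 * ∫ ω, u ω ^ 2 ∂(R₀ : Measure Ω) : ℝ) : ℂ) +
        ((a' * ∫ ω, u ω * h ω ∂(R₀ : Measure Ω) : ℝ) : ℂ) * Complex.I)) := by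
  set f : ℕ → Ω → ℂ := fun n ω => Complex.exp ((a n * u ω : ℝ) * Complex.I) - 1 with hf
  have hfm : ∀ n, Measurable (f n) := fun n => by fun_prop
  have hfb : ∀ n ω, ‖f n ω‖ ≤ 2 := fun n ω => by
    refine (norm_sub_le _ _).trans ?_
    rw [Complex.norm_exp_ofReal_mul_I, norm_one]
    norm_num
  obtain ⟨C, hC⟩ := ha.abs.bddAbove_range
  replace hC : ∀ n : ℕ, |√(n : ℝ) * a n| ≤ C := fun n => hC ⟨n, rfl⟩
  have hC0 : 0 ≤ C := (abs_nonneg _).trans (hC 0)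
  have ha0 := tendsto_zero_of_sqrt_mul ha
  -- the terms of `nat_mul_integral_sub`: singular part, drift, and a negligible quadratic term;
  -- `h4` is the expansion under `R₀` itself, whose linear term vanishes as `u` is centred
  have h1 := tendsto_singularPart_integral hR hfb
  have h2 : Tendsto (fun n : ℕ => ∫ ω, (√(n : ℝ) * f n ω) *
      (scaledScore n (R n) R₀ ω : ℂ) ∂(R₀ : Measure Ω)) atTop
      (𝓝 (∫ ω, ((a' * u ω : ℝ) * Complex.I) * (h ω : ℂ) ∂(R₀ : Measure Ω))) := by
    refine tendsto_integral_mul_of_tendsto_Lp (C := C) (fun n => by fun_prop) hC0 hu2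
      (fun n ω => ?_) (ae_of_all _ fun ω => tendsto_sqrt_mul_cexp_sub_one ha (u ω)) hR.1
    rw [norm_mul, Complex.norm_real, Real.norm_eq_abs]
    calc _ ≤ |√(n : ℝ)| * |a n * u ω| := by
          gcongr
          exact norm_cexp_mul_I_sub_one_le _
      _ = |√(n : ℝ) * a n| * |u ω| := by rw [abs_mul, abs_mul]; ring
      _ ≤ C * |u ω| := by gcongr; exact hC n
  have h3 : Tendsto (fun n : ℕ => ∫ ω, f n ω *
      (scaledScore n (R n) R₀ ω : ℂ) ^ 2 ∂(R₀ : Measure Ω)) atTop (𝓝 0) := by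
    refine tendsto_integral_mul_sq_zero (C := 2) (fun n => by fun_prop)
      (fun n => ae_of_all _ (hfb n)) (ae_of_all _ fun ω => ?_) hR.1
    have : Continuous fun x : ℝ => Complex.exp ((x * u ω : ℝ) * Complex.I) - 1 := by fun_prop
    have h := (this.tendsto 0).comp ha0
    simpa [hf, Function.comp_def] using h
  have hui : Integrable u (R₀ : Measure Ω) := hu2.integrable one_le_two
  have hfi : ∀ n, Integrable (f n) (R₀ : Measure Ω) := fun n =>
    Integrable.of_bound (hfm n).aestronglyMeasurable 2 (ae_of_all _ (hfb n))
  have h4 : Tendsto (fun n : ℕ => (n : ℂ) * ∫ ω, f n ω ∂(R₀ : Measure Ω)) atTop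
      (𝓝 ((-a' ^ 2 / 2 * ∫ ω, u ω ^ 2 ∂(R₀ : Measure Ω) : ℝ) : ℂ)) := by
    have h5 : Tendsto (fun n : ℕ => ∫ ω, (n : ℂ) * (f n ω - (a n * u ω : ℝ) * Complex.I)
        ∂(R₀ : Measure Ω)) atTop
        (𝓝 (∫ ω, ((-(a' * u ω) ^ 2 / 2 : ℝ) : ℂ) ∂(R₀ : Measure Ω))) := by
      refine tendsto_integral_of_dominated_convergence (fun ω => 2 * C ^ 2 * u ω ^ 2)
        (fun n => Measurable.aestronglyMeasurable (by fun_prop))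
        (hu2.integrable_sq.const_mul _) (fun n => ae_of_all _ fun ω => ?_)
        (ae_of_all _ fun ω => tendsto_nat_mul_cexp_taylor ha (u ω))
      rw [norm_mul, Complex.norm_natCast]
      calc _ ≤ (n : ℝ) * (2 * (a n * u ω) ^ 2) := by
            gcongr
            exact norm_cexp_mul_I_sub_one_sub_le _
        _ = 2 * |√(n : ℝ) * a n| ^ 2 * u ω ^ 2 := by
            rw [sq_abs, mul_pow (√(n : ℝ)), Real.sq_sqrt (Nat.cast_nonneg n)]; ring
        _ ≤ 2 * C ^ 2 * u ω ^ 2 := by gcongr; exact hC n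
    have h6 : ∫ ω, ((-(a' * u ω) ^ 2 / 2 : ℝ) : ℂ) ∂(R₀ : Measure Ω) =
        ((-a' ^ 2 / 2 * ∫ ω, u ω ^ 2 ∂(R₀ : Measure Ω) : ℝ) : ℂ) := by
      rw [integral_complex_ofReal, ← integral_const_mul]
      congr 2
      ext ω
      ring
    rw [h6] at h5
    refine h5.congr fun n => ?_
    have h7 : Integrable (fun ω => ((a n * u ω : ℝ) : ℂ) * Complex.I) (R₀ : Measure Ω) :=
      ((hui.const_mul (a n)).ofReal).mul_const _
    rw [integral_const_mul, integral_sub (hfi n) h7, integral_mul_const, integral_complex_ofReal,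
      integral_const_mul, hu0]
    simp
  have h8 : ∫ ω, ((a' * u ω : ℝ) * Complex.I) * (h ω : ℂ) ∂(R₀ : Measure Ω) =
      ((a' * ∫ ω, u ω * h ω ∂(R₀ : Measure Ω) : ℝ) : ℂ) * Complex.I := by
    rw [← integral_const_mul, ← integral_complex_ofReal, ← integral_mul_const]
    refine integral_congr_ae (ae_of_all _ fun ω => ?_)
    push_cast
    ring
  have h9 := h4.add (h1.add (h2.add (h3.const_mul (1 / 4))))
  rw [mul_zero, add_zero, zero_add, h8] at h9
  refine h9.congr fun n => ?_
  rw [← nat_mul_integral_sub n (R n) R₀ (hfm n) (hfb n)]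
  have h10 : ∫ ω, f n ω ∂(R n : Measure Ω) =
      ∫ ω, Complex.exp ((a n * u ω : ℝ) * Complex.I) ∂(R n : Measure Ω) - 1 := by
    rw [hf, integral_sub]
    · simp
    · refine Integrable.of_bound (Measurable.aestronglyMeasurable (by fun_prop)) 1
        (ae_of_all _ fun ω => ?_)
      rw [Complex.norm_exp_ofReal_mul_I]
    · exact integrable_const 1
  rw [← h10]
  ring

end CharFun

/-! ### Characteristic functions of log-likelihood ratios -/

section LogLikelihood

/-- The second-order Taylor remainder of `y ↦ exp (2 i s log (1 + y))` at `0`, divided by `y²`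
(and `0` at `y = 0`). It is applied to `y = √L - 1` for a density `L`, where
`2 log (1 + y) = log L`. -/
def logRemainder (s y : ℝ) : ℂ :=
  (Complex.exp ((s * (2 * Real.log (1 + y)) : ℝ) * Complex.I) - 1 -
    (2 * s * y : ℝ) * Complex.I - (-2 * s ^ 2 - s * Complex.I) * (y : ℂ) ^ 2) / (y : ℂ) ^ 2

theorem abs_log_one_add_sub_le {y : ℝ} (hy : |y| ≤ 1 / 2) :
    |Real.log (1 + y) - y + y ^ 2 / 2| ≤ 2 * |y| ^ 3 := by
  have h := Real.abs_log_sub_add_sum_range_le (x := -y) (by rw [abs_neg]; linarith) 2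
  simp only [Finset.sum_range_succ, Finset.sum_range_zero, abs_neg] at h
  rw [show Real.log (1 + y) - y + y ^ 2 / 2 =
    0 + (-y) ^ (0 + 1) / ((0 : ℕ) + 1) + (-y) ^ (1 + 1) / ((1 : ℕ) + 1) + Real.log (1 - -y) by
      rw [sub_neg_eq_add]; push_cast; ring]
  refine h.trans ?_
  rw [div_le_iff₀ (by linarith)]
  have h3 := mul_nonneg (pow_nonneg (abs_nonneg y) 3) (sub_nonneg.2 hy)
  have h4 : |y| ^ (2 + 1) = |y| ^ 3 := rfl
  rw [h4]
  linarith

theorem logRemainder_small (s : ℝ) :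
    ∃ δ > 0, ∃ K, ∀ y : ℝ, |y| ≤ δ → ‖logRemainder s y‖ ≤ K * |y| := by
  refine ⟨min (1 / 2) (1 / (4 * |s| + 1)), by positivity, (4 * |s|) ^ 3 + 4 * |s| + 12 * s ^ 2,
    fun y hy => ?_⟩
  have hy1 : |y| ≤ 1 / 2 := hy.trans (min_le_left _ _)
  have hy2 : |y| * (4 * |s| + 1) ≤ 1 :=
    (le_div_iff₀ (by positivity)).1 (hy.trans (min_le_right _ _))
  by_cases h0 : y = 0
  · simp [logRemainder, h0]
  have hy0 : 0 < |y| := abs_pos.2 h0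
  set ℓ := Real.log (1 + y)
  have h1 : |ℓ - y + y ^ 2 / 2| ≤ 2 * |y| ^ 3 := abs_log_one_add_sub_le hy1
  have h3 : |ℓ - y| ≤ 2 * |y| ^ 2 := by
    have : |ℓ - y| ≤ |ℓ - y + y ^ 2 / 2| + |y ^ 2 / 2| := by
      have := abs_sub (ℓ - y + y ^ 2 / 2) (y ^ 2 / 2)
      rwa [add_sub_cancel_right] at this
    rw [abs_of_nonneg (show 0 ≤ y ^ 2 / 2 by positivity)] at this
    nlinarith [sq_abs y, mul_nonneg (sq_nonneg |y|) (sub_nonneg.2 hy1)]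
  have h2 : |ℓ| ≤ 2 * |y| := by
    have : |ℓ| ≤ |ℓ - y| + |y| := by
      have := abs_add_le (ℓ - y) y
      rwa [sub_add_cancel] at this
    nlinarith
  have h4 : |ℓ + y| ≤ 3 * |y| := (abs_add_le _ _).trans (by linarith)
  set z : ℂ := (s * (2 * ℓ) : ℝ) * Complex.I with hz
  have hzn : ‖z‖ = 2 * |s| * |ℓ| := by
    rw [hz, norm_mul, Complex.norm_I, mul_one, Complex.norm_real, Real.norm_eq_abs, abs_mul,
      abs_mul, abs_two]
    ring
  have hzl : ‖z‖ ≤ 4 * |s| * |y| := by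
    rw [hzn]
    nlinarith [abs_nonneg s]
  have hz1 : ‖z‖ ≤ 1 := by nlinarith
  have e : Complex.exp z - 1 - (2 * s * y : ℝ) * Complex.I -
      (-2 * s ^ 2 - s * Complex.I) * (y : ℂ) ^ 2 =
      (Complex.exp z - 1 - z - z ^ 2 / 2) +
        ((2 * s * (ℓ - y + y ^ 2 / 2) : ℝ) * Complex.I +
          ((-2 * s ^ 2 * ((ℓ - y) * (ℓ + y)) : ℝ) : ℂ)) := by
    rw [hz, mul_pow, Complex.I_sq]
    push_cast
    ring
  have b1 : ‖Complex.exp z - 1 - z - z ^ 2 / 2‖ ≤ (4 * |s|) ^ 3 * |y| ^ 3 := by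
    refine (norm_cexp_sub_taylor_two_le hz1).trans ?_
    rw [← mul_pow]
    gcongr
  have b2 : ‖((2 * s * (ℓ - y + y ^ 2 / 2) : ℝ) : ℂ) * Complex.I‖ ≤ 4 * |s| * |y| ^ 3 := by
    rw [norm_mul, Complex.norm_I, mul_one, Complex.norm_real, Real.norm_eq_abs, abs_mul,
      abs_mul, abs_two]
    nlinarith [mul_le_mul_of_nonneg_left h1 (abs_nonneg s)]
  have b3 : ‖((-2 * s ^ 2 * ((ℓ - y) * (ℓ + y)) : ℝ) : ℂ)‖ ≤ 2 * s ^ 2 * (6 * |y| ^ 3) := by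
    rw [Complex.norm_real, Real.norm_eq_abs, abs_mul, abs_mul, abs_mul, abs_neg, abs_two,
      abs_of_nonneg (sq_nonneg s)]
    refine mul_le_mul_of_nonneg_left ?_ (by positivity)
    calc |ℓ - y| * |ℓ + y| ≤ (2 * |y| ^ 2) * (3 * |y|) := by gcongr
      _ = 6 * |y| ^ 3 := by ring
  rw [logRemainder, norm_div, norm_pow, Complex.norm_real, Real.norm_eq_abs,
    div_le_iff₀ (by positivity), e]
  refine (norm_add_le _ _).trans ((add_le_add b1 ((norm_add_le _ _).trans
    (add_le_add b2 b3))).trans ?_)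
  refine le_of_eq ?_
  ring

theorem logRemainder_bounded (s : ℝ) : ∃ C, ∀ y : ℝ, ‖logRemainder s y‖ ≤ C := by
  obtain ⟨δ, hδ, K, hK⟩ := logRemainder_small s
  refine ⟨max (|K| * δ) (2 / δ ^ 2 + 2 * |s| / δ + ‖(-2 * s ^ 2 - s * Complex.I : ℂ)‖),
    fun y => ?_⟩
  by_cases hy : |y| ≤ δ
  · refine ((hK y hy).trans ?_).trans (le_max_left _ _)
    calc K * |y| ≤ |K| * |y| := by gcongr; exact le_abs_self K
      _ ≤ |K| * δ := by gcongr
  · push Not at hy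
    refine le_trans ?_ (le_max_right _ _)
    have hy0 : 0 < |y| := hδ.trans hy
    rw [logRemainder, norm_div, norm_pow, Complex.norm_real, Real.norm_eq_abs,
      div_le_iff₀ (by positivity)]
    have e1 : ‖Complex.exp ((s * (2 * Real.log (1 + y)) : ℝ) * Complex.I) - 1‖ ≤ 2 := by
      refine (norm_sub_le _ _).trans ?_
      rw [Complex.norm_exp_ofReal_mul_I, norm_one]
      norm_num
    have e2 : ‖((2 * s * y : ℝ) : ℂ) * Complex.I‖ = 2 * |s| * |y| := by
      rw [norm_mul, Complex.norm_I, mul_one, Complex.norm_real, Real.norm_eq_abs, abs_mul,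
        abs_mul, abs_two]
    have e3 : ‖(-2 * s ^ 2 - s * Complex.I : ℂ) * (y : ℂ) ^ 2‖ =
        ‖(-2 * s ^ 2 - s * Complex.I : ℂ)‖ * |y| ^ 2 := by
      rw [norm_mul, norm_pow, Complex.norm_real, Real.norm_eq_abs]
    refine (norm_sub_le _ _).trans ((add_le_add ((norm_sub_le _ _).trans
      (add_le_add e1 e2.le)) e3.le).trans ?_)
    have f1 : 2 ≤ 2 / δ ^ 2 * |y| ^ 2 := by
      rw [div_mul_eq_mul_div, le_div_iff₀ (by positivity)]
      gcongr
    have f2 : 2 * |s| * |y| ≤ 2 * |s| / δ * |y| ^ 2 := by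
      rw [div_mul_eq_mul_div, le_div_iff₀ hδ, sq, mul_assoc, mul_assoc, mul_assoc]
      gcongr
    linarith

theorem tendsto_logRemainder_zero (s : ℝ) : Tendsto (logRemainder s) (𝓝 0) (𝓝 0) := by
  obtain ⟨δ, hδ, K, hK⟩ := logRemainder_small s
  have h1 : Tendsto (fun y : ℝ => K * |y|) (𝓝 0) (𝓝 0) := by
    have := (continuous_abs.tendsto (0 : ℝ)).const_mul K
    rwa [abs_zero, mul_zero] at this
  refine squeeze_zero_norm' ?_ h1
  have : ∀ᶠ y : ℝ in 𝓝 0, |y| ≤ δ := by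
    have := (continuous_abs.tendsto (0 : ℝ)).eventually_le_const (by rwa [abs_zero] : |(0:ℝ)| < δ)
    exact this
  filter_upwards [this] with y hy
  exact hK y hy

theorem measurable_logRemainder (s : ℝ) : Measurable (logRemainder s) := by
  unfold logRemainder
  fun_prop

variable {Ω : Type*} [MeasurableSpace Ω]

/-- Bounded functions of the half density that vanish at the centre of expansion do not contribute
to second order. -/
theorem HasLocalTangent.tendsto_integral_comp_mul_sq {R : ℕ → ProbabilityMeasure Ω}
    {R₀ : ProbabilityMeasure Ω} {h : Lp ℝ 2 (R₀ : Measure Ω)}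
    (hR : HasLocalTangent atTop (fun n : ℕ => √(n : ℝ)) R R₀ h) {G : ℝ → ℂ} (hGm : Measurable G)
    {C : ℝ} (hC : ∀ y, ‖G y‖ ≤ C) (hG0 : Tendsto G (𝓝 0) (𝓝 0)) :
    Tendsto (fun n : ℕ => ∫ ω,
      G (√((R n : Measure Ω).rnDeriv (R₀ : Measure Ω) ω).toReal - 1) *
        (scaledScore n (R n) R₀ ω : ℂ) ^ 2 ∂(R₀ : Measure Ω)) atTop (𝓝 0) := by
  set y : ℕ → Ω → ℝ := fun n ω =>
    √((R n : Measure Ω).rnDeriv (R₀ : Measure Ω) ω).toReal - 1 with hy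
  have hym : ∀ n, Measurable (y n) := fun n =>
    ((Measure.measurable_rnDeriv _ _).ennreal_toReal.sqrt).sub_const 1
  have hρm : ∀ n, Measurable fun ω => G (y n ω) := fun n =>
    hGm.comp (hym n)
  have hlp : Tendsto (fun n => halfDensity (R n) R₀ - oneLp (R₀ : Measure Ω)) atTop (𝓝 0) := by
    have h1 : Tendsto (fun n : ℕ => (2 * √(n : ℝ))⁻¹) atTop (𝓝 0) :=
      tendsto_inv_atTop_zero.comp ((Real.tendsto_sqrt_atTop.comp
        tendsto_natCast_atTop_atTop).const_mul_atTop two_pos)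
    have h2 := h1.smul hR.1
    rw [zero_smul] at h2
    refine h2.congr' ?_
    filter_upwards [eventually_gt_atTop 0] with n hn
    have : 2 * √(n : ℝ) ≠ 0 := mul_ne_zero two_ne_zero (Real.sqrt_pos.2 (Nat.cast_pos.2 hn)).ne'
    rw [smul_smul, inv_mul_cancel₀ this, one_smul]
  have hye : ∀ n, (halfDensity (R n) R₀ - oneLp (R₀ : Measure Ω) : Lp ℝ 2 (R₀ : Measure Ω))
      =ᵐ[(R₀ : Measure Ω)] y n := fun n => by
    filter_upwards [coeFn_halfDensity (R n) R₀, coeFn_oneLp (R₀ : Measure Ω),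
      Lp.coeFn_sub (halfDensity (R n) R₀) (oneLp (R₀ : Measure Ω))] with ω h1 h2 h3
    rw [h3, Pi.sub_apply, h1, h2]
  -- the scores tend to zero in measure only, so almost everywhere along subsequences
  refine tendsto_of_subseq_tendsto fun ns hns => ?_
  obtain ⟨ms, hms, hae⟩ := (tendstoInMeasure_of_tendsto_Lp
    (hlp.comp hns)).exists_seq_tendsto_ae
  refine ⟨ms, tendsto_integral_mul_sq_zero (C := C) (fun n => (hρm _).aestronglyMeasurable)
    (fun n => ae_of_all _ fun ω => hC _) ?_ (hR.1.comp (hns.comp hms.tendsto_atTop))⟩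
  have hall : ∀ᵐ ω ∂(R₀ : Measure Ω), ∀ n,
      (halfDensity (R n) R₀ - oneLp (R₀ : Measure Ω) : Lp ℝ 2 (R₀ : Measure Ω)) ω = y n ω :=
    ae_all_iff.2 hye
  filter_upwards [hae, hall, Lp.coeFn_zero ℝ 2 (R₀ : Measure Ω)] with ω h1 h2 h3
  rw [h3] at h1
  simp only [Function.comp, h2] at h1
  exact hG0.comp h1

/-- The null probability that the density vanishes is `o(1 / n)`. -/
theorem HasLocalTangent.tendsto_nat_mul_measure_density_zero {R : ℕ → ProbabilityMeasure Ω}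
    {R₀ : ProbabilityMeasure Ω} {h : Lp ℝ 2 (R₀ : Measure Ω)}
    (hR : HasLocalTangent atTop (fun n : ℕ => √(n : ℝ)) R R₀ h) :
    Tendsto (fun n : ℕ => (n : ℝ) * (R₀ : Measure Ω).real
      {ω | ((R n : Measure Ω).rnDeriv (R₀ : Measure Ω) ω).toReal = 0}) atTop (𝓝 0) := by
  have hG : Measurable (({-1} : Set ℝ).indicator fun _ => (1 : ℂ)) :=
    measurable_const.indicator (measurableSet_singleton _)
  -- where the density vanishes the half density is `0`, so the squared score equals `4 n` there
  have h1 := (hR.tendsto_integral_comp_mul_sq hG (C := 1) (fun y => ?_) ?_).norm.const_mul (1 / 4)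
  · rw [norm_zero, mul_zero] at h1
    refine h1.congr fun n => ?_
    set A : Set Ω := {ω | ((R n : Measure Ω).rnDeriv (R₀ : Measure Ω) ω).toReal = 0} with hA
    have hAm : MeasurableSet A :=
      (Measure.measurable_rnDeriv _ _).ennreal_toReal (measurableSet_singleton 0)
    have h2 : ∫ ω, (({-1} : Set ℝ).indicator fun _ => (1 : ℂ))
        (√((R n : Measure Ω).rnDeriv (R₀ : Measure Ω) ω).toReal - 1) *
          (scaledScore n (R n) R₀ ω : ℂ) ^ 2 ∂(R₀ : Measure Ω) =
        ∫ ω, A.indicator (fun _ => (4 * n : ℂ)) ω ∂(R₀ : Measure Ω) := by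
      refine integral_congr_ae ?_
      filter_upwards [coeFn_scaledScore n (R n) R₀] with ω hω
      rw [hω]
      have hn : ((√(n : ℝ) : ℝ) : ℂ) ^ 2 = n := by
        rw [← Complex.ofReal_pow, Real.sq_sqrt (Nat.cast_nonneg n)]; simp
      by_cases h0 : ((R n : Measure Ω).rnDeriv (R₀ : Measure Ω) ω).toReal = 0
      · rw [indicator_of_mem (show ω ∈ A from h0), h0, Real.sqrt_zero, zero_sub,
          indicator_of_mem (mem_singleton _)]
        push_cast
        rw [mul_pow, mul_pow, hn]
        ring
      · rw [indicator_of_notMem (show ω ∉ A from h0), indicator_of_notMem, zero_mul]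
        rw [mem_singleton_iff]
        intro h3
        have : 0 < √((R n : Measure Ω).rnDeriv (R₀ : Measure Ω) ω).toReal :=
          Real.sqrt_pos.2 (lt_of_le_of_ne ENNReal.toReal_nonneg (Ne.symm h0))
        linarith
    rw [h2, integral_indicator_const _ hAm, norm_smul, norm_mul, Complex.norm_natCast,
      Real.norm_of_nonneg measureReal_nonneg]
    norm_num
    ring
  · refine (norm_indicator_le_norm_self _ _).trans ?_
    simp
  · refine tendsto_const_nhds.congr' ?_
    filter_upwards [lt_mem_nhds (show (-1 : ℝ) < 0 by norm_num)] with y hy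
    rw [indicator_of_notMem]
    exact hy.ne'

/-- The characteristic function of the log-likelihood ratio under the null measure, to the order
`1 / n`. The value `Real.log 0 = 0` at points of vanishing density is harmless, since only bounded
functions of the logarithm are integrated and such points lie far from the centre of expansion. -/
theorem HasLocalTangent.tendsto_charFun_log {R : ℕ → ProbabilityMeasure Ω}
    {R₀ : ProbabilityMeasure Ω} {h : Lp ℝ 2 (R₀ : Measure Ω)}
    (hR : HasLocalTangent atTop (fun n : ℕ => √(n : ℝ)) R R₀ h) (s : ℝ) :
    Tendsto (fun n : ℕ => (n : ℂ) * (∫ ω, Complex.exp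
        ((s * Real.log ((R n : Measure Ω).rnDeriv (R₀ : Measure Ω) ω).toReal : ℝ) * Complex.I)
          ∂(R₀ : Measure Ω) - 1)) atTop
      (𝓝 (((-s ^ 2 / 2 * ‖h‖ ^ 2 : ℝ) : ℂ) + ((-s / 2 * ‖h‖ ^ 2 : ℝ) : ℂ) * Complex.I)) := by
  set y : ℕ → Ω → ℝ := fun n ω =>
    √((R n : Measure Ω).rnDeriv (R₀ : Measure Ω) ω).toReal - 1 with hy
  have hym : ∀ n, Measurable (y n) := fun n =>
    ((Measure.measurable_rnDeriv _ _).ennreal_toReal.sqrt).sub_const 1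
  obtain ⟨C, hC⟩ := logRemainder_bounded s
  have hρm : ∀ n, Measurable fun ω => logRemainder s (y n ω) := fun n =>
    (measurable_logRemainder s).comp (hym n)
  have h1 := hR.tendsto_integral_comp_mul_sq (measurable_logRemainder s) hC
    (tendsto_logRemainder_zero s)
  -- the linear term of the expansion integrates to the affinity defect, which is second order
  have h2 : Tendsto (fun n : ℕ => (n : ℝ) * (affinity (R n) R₀ - 1)) atTop
      (𝓝 (-(1 / 8) * ‖h‖ ^ 2)) := by
    have := ((hR.1.norm.pow 2).const_mul (-(1 / 8))).add (hR.2.const_mul (-(1 / 2)))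
    rw [mul_zero, add_zero] at this
    refine this.congr fun n => ?_
    have h3 := two_mul_one_sub_affinity (R n) R₀
    rw [norm_smul, Real.norm_eq_abs, mul_pow, sq_abs, mul_pow, Real.sq_sqrt (Nat.cast_nonneg n)]
    linear_combination (1 / 2 * (n : ℝ)) * h3
  have h3 : Tendsto (fun n : ℕ => ‖scaledScore n (R n) R₀‖ ^ 2) atTop (𝓝 (‖h‖ ^ 2)) :=
    hR.1.norm.pow 2
  have h4 := (((Complex.continuous_ofReal.tendsto _).comp h2).const_mul
    (2 * s * Complex.I)).add (((((Complex.continuous_ofReal.tendsto _).comp h3).const_mul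
      ((-2 * s ^ 2 - s * Complex.I : ℂ) / 4))).add (h1.const_mul (1 / 4)))
  have e : (2 * s * Complex.I) * ((-(1 / 8) * ‖h‖ ^ 2 : ℝ) : ℂ) +
      ((-2 * s ^ 2 - s * Complex.I : ℂ) / 4 * ((‖h‖ ^ 2 : ℝ) : ℂ) + 1 / 4 * 0) =
      ((-s ^ 2 / 2 * ‖h‖ ^ 2 : ℝ) : ℂ) + ((-s / 2 * ‖h‖ ^ 2 : ℝ) : ℂ) * Complex.I := by
    push_cast
    ring
  rw [e] at h4
  refine h4.congr fun n => ?_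
  have hyi : Integrable (y n) (R₀ : Measure Ω) :=
    ((memLp_sqrt_rnDeriv (R n) R₀).integrable one_le_two).sub (integrable_const 1)
  have i0 : Integrable (fun ω => ((n : ℂ) * (2 * s * Complex.I)) * (y n ω : ℂ))
      (R₀ : Measure Ω) := hyi.ofReal.const_mul _
  have i1 : Integrable (fun ω => ((-2 * s ^ 2 - s * Complex.I : ℂ) / 4) *
      ((scaledScore n (R n) R₀ ω ^ 2 : ℝ) : ℂ)) (R₀ : Measure Ω) :=
    ((Lp.memLp (scaledScore n (R n) R₀)).integrable_sq.ofReal).const_mul _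
  have i2 : Integrable (fun ω => (1 / 4 : ℂ) * (logRemainder s (y n ω) *
      (scaledScore n (R n) R₀ ω : ℂ) ^ 2)) (R₀ : Measure Ω) :=
    (integrable_bounded_mul_sq (hρm n).aestronglyMeasurable (ae_of_all _ fun ω => hC _)
      (scaledScore n (R n) R₀)).const_mul _
  have i12 : Integrable (fun ω => ((-2 * s ^ 2 - s * Complex.I : ℂ) / 4) *
      ((scaledScore n (R n) R₀ ω ^ 2 : ℝ) : ℂ) + (1 / 4 : ℂ) * (logRemainder s (y n ω) *
      (scaledScore n (R n) R₀ ω : ℂ) ^ 2)) (R₀ : Measure Ω) := i1.add i2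
  have i3 : Integrable (fun ω => Complex.exp
      ((s * Real.log ((R n : Measure Ω).rnDeriv (R₀ : Measure Ω) ω).toReal : ℝ) * Complex.I))
      (R₀ : Measure Ω) := by
    refine Integrable.of_bound (Measurable.aestronglyMeasurable ?_) 1 (ae_of_all _ fun ω => ?_)
    · have := Measure.measurable_rnDeriv (R n : Measure Ω) (R₀ : Measure Ω)
      fun_prop
    · rw [Complex.norm_exp_ofReal_mul_I]
  have hyint : ∫ ω, y n ω ∂(R₀ : Measure Ω) = affinity (R n) R₀ - 1 := by
    rw [affinity_eq_integral, integral_congr_ae (coeFn_halfDensity (R n) R₀), hy,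
      integral_sub ((memLp_sqrt_rnDeriv (R n) R₀).integrable one_le_two) (integrable_const 1)]
    simp
  have e1 : ∫ ω, (1 : ℂ) ∂(R₀ : Measure Ω) = 1 := by simp
  conv_rhs => rw [← e1, ← integral_sub i3 (integrable_const 1), ← integral_const_mul]
  simp only [Function.comp]
  have e2 : 2 * (s : ℂ) * Complex.I * (((n : ℝ) * (affinity (R n) R₀ - 1) : ℝ) : ℂ) =
      ((n : ℂ) * (2 * s * Complex.I)) * ((∫ ω, y n ω ∂(R₀ : Measure Ω) : ℝ) : ℂ) := by
    rw [hyint]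
    push_cast
    ring
  rw [e2, norm_sq_eq_integral_sq, ← integral_complex_ofReal, ← integral_complex_ofReal,
    ← integral_const_mul, ← integral_const_mul, ← integral_const_mul, ← integral_add i1 i2,
    ← integral_add i0 i12]
  refine integral_congr_ae ?_
  filter_upwards [coeFn_scaledScore n (R n) R₀] with ω hω
  set L := ((R n : Measure Ω).rnDeriv (R₀ : Measure Ω) ω).toReal with hL
  have hyω : √L = 1 + y n ω := by rw [hy]; ring
  have hlog : Real.log L = 2 * Real.log (1 + y n ω) := by
    rw [← hyω, Real.log_sqrt ENNReal.toReal_nonneg]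
    ring
  have hw : scaledScore n (R n) R₀ ω = 2 * √(n : ℝ) * y n ω := hω
  have hn : ((√(n : ℝ) : ℝ) : ℂ) ^ 2 = n := by
    rw [← Complex.ofReal_pow, Real.sq_sqrt (Nat.cast_nonneg n)]; simp
  rw [hlog, hw]
  have hrem : logRemainder s (y n ω) * (y n ω : ℂ) ^ 2 =
      Complex.exp ((s * (2 * Real.log (1 + y n ω)) : ℝ) * Complex.I) - 1 -
    (2 * s * y n ω : ℝ) * Complex.I - (-2 * s ^ 2 - s * Complex.I) * (y n ω : ℂ) ^ 2 := by
    by_cases h0 : y n ω = 0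
    · simp [h0]
    · rw [logRemainder, div_mul_cancel₀]
      exact pow_ne_zero 2 (Complex.ofReal_ne_zero.2 h0)
  have hexp := sub_eq_iff_eq_add.1 (sub_eq_iff_eq_add.1 hrem.symm)
  rw [hexp]
  push_cast
  rw [mul_pow, mul_pow, hn]
  ring

end LogLikelihood

/-! ### Sums of independent observations and weak limits -/

section SampleSums

/-- If `n (z n - 1) → w` and `m n / n → r`, then `z n ^ m n → exp (r w)`. -/
theorem tendsto_pow_exp_of_ratio {z : ℕ → ℂ} {w : ℂ}
    (hz : Tendsto (fun n : ℕ => (n : ℂ) * (z n - 1)) atTop (𝓝 w)) {m : ℕ → ℕ} {r : ℝ}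
    (hm : Tendsto (fun n : ℕ => (m n : ℝ) / n) atTop (𝓝 r)) :
    Tendsto (fun n => z n ^ m n) atTop (𝓝 (Complex.exp (r * w))) := by
  have h1 := Complex.tendsto_nat_mul_log_one_add_of_tendsto hz
  have h2 := ((Complex.continuous_ofReal.tendsto _).comp hm).mul h1
  have h3 := (Complex.continuous_exp.tendsto _).comp h2
  have hz1 : Tendsto z atTop (𝓝 1) := by
    have h4 : Tendsto (fun n : ℕ => ((n : ℂ))⁻¹) atTop (𝓝 0) := by
      have := (Complex.continuous_ofReal.tendsto 0).comp tendsto_inv_atTop_nhds_zero_nat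
      simpa [Function.comp_def] using this
    have h5 := (h4.mul hz).add_const 1
    rw [zero_mul, zero_add] at h5
    refine h5.congr' ?_
    filter_upwards [eventually_gt_atTop 0] with n hn
    have : (n : ℂ) ≠ 0 := Nat.cast_ne_zero.2 hn.ne'
    rw [inv_mul_cancel_left₀ this, sub_add_cancel]
  refine h3.congr' ?_
  filter_upwards [eventually_gt_atTop 0, hz1.eventually_ne one_ne_zero] with n hn hzn
  have hn' : (n : ℂ) ≠ 0 := Nat.cast_ne_zero.2 hn.ne'
  simp only [Function.comp]
  rw [add_sub_cancel]
  push_cast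
  rw [← mul_assoc, div_mul_cancel₀ _ hn', Complex.exp_nat_mul, Complex.exp_log hzn]

variable {Ω₁ Ω₂ : Type*} [MeasurableSpace Ω₁] [MeasurableSpace Ω₂]

instance isProbabilityMeasure_sampleLaw (P : ProbabilityMeasure Ω₁) (Q : ProbabilityMeasure Ω₂)
    (m₁ m₂ : ℕ) : IsProbabilityMeasure (sampleLaw P Q m₁ m₂) := by
  unfold sampleLaw
  infer_instance

/-- The sum of the values of `X₁` on the first and of `X₂` on the second sample. -/
def sampleSum {m₁ m₂ : ℕ} (X₁ : Ω₁ → ℝ) (X₂ : Ω₂ → ℝ) (x : SampleSpace Ω₁ Ω₂ m₁ m₂) : ℝ :=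
  ∑ i, X₁ (x.1 i) + ∑ j, X₂ (x.2 j)

theorem measurable_sampleSum {m₁ m₂ : ℕ} {X₁ : Ω₁ → ℝ} {X₂ : Ω₂ → ℝ} (h₁ : Measurable X₁)
    (h₂ : Measurable X₂) :
    Measurable (sampleSum X₁ X₂ : SampleSpace Ω₁ Ω₂ m₁ m₂ → ℝ) := by
  unfold sampleSum
  fun_prop

theorem integral_cexp_sampleSum (P : ProbabilityMeasure Ω₁) (Q : ProbabilityMeasure Ω₂)
    (m₁ m₂ : ℕ) (X₁ : Ω₁ → ℝ) (X₂ : Ω₂ → ℝ) (s : ℝ) :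
    ∫ x, Complex.exp (s * (sampleSum X₁ X₂ x : ℝ) * Complex.I) ∂(sampleLaw P Q m₁ m₂) =
      (∫ ω, Complex.exp ((s * X₁ ω : ℝ) * Complex.I) ∂(P : Measure Ω₁)) ^ m₁ *
        (∫ ω, Complex.exp ((s * X₂ ω : ℝ) * Complex.I) ∂(Q : Measure Ω₂)) ^ m₂ := by
  have h : ∀ x : SampleSpace Ω₁ Ω₂ m₁ m₂,
      Complex.exp (s * (sampleSum X₁ X₂ x : ℝ) * Complex.I) =
      (∏ i, Complex.exp ((s * X₁ (x.1 i) : ℝ) * Complex.I)) *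
        ∏ j, Complex.exp ((s * X₂ (x.2 j) : ℝ) * Complex.I) := fun x => by
    rw [← Complex.exp_sum, ← Complex.exp_sum, ← Complex.exp_add, sampleSum]
    congr 1
    push_cast
    rw [mul_add, add_mul, Finset.mul_sum, Finset.sum_mul, Finset.mul_sum, Finset.sum_mul]
  simp_rw [h]
  rw [sampleLaw, integral_prod_mul
    (f := fun x : Fin m₁ → Ω₁ => ∏ i, Complex.exp ((s * X₁ (x i) : ℝ) * Complex.I))
    (g := fun x : Fin m₂ → Ω₂ => ∏ j, Complex.exp ((s * X₂ (x j) : ℝ) * Complex.I)),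
    integral_fintype_prod_eq_pow (fun ω => Complex.exp ((s * X₁ ω : ℝ) * Complex.I)),
    integral_fintype_prod_eq_pow (fun ω => Complex.exp ((s * X₂ ω : ℝ) * Complex.I))]
  simp

/-- The law of `sampleSum X₁ X₂` under `P^{m₁} ⊗ Q^{m₂}`. -/
def sampleSumLaw (P : ProbabilityMeasure Ω₁) (Q : ProbabilityMeasure Ω₂) (m₁ m₂ : ℕ)
    {X₁ : Ω₁ → ℝ} {X₂ : Ω₂ → ℝ} (h₁ : Measurable X₁) (h₂ : Measurable X₂) :
    ProbabilityMeasure ℝ :=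
  ⟨(sampleLaw P Q m₁ m₂).map (sampleSum X₁ X₂),
    Measure.isProbabilityMeasure_map (measurable_sampleSum h₁ h₂).aemeasurable⟩

/-- The Gaussian distribution as an element of `ProbabilityMeasure ℝ`. -/
def gaussianProb (m : ℝ) (v : NNReal) : ProbabilityMeasure ℝ := ⟨gaussianReal m v, inferInstance⟩

/-- Central limit theorem for two triangular arrays, in terms of the expansion to order `1 / n` of
the characteristic functions of the summands. -/
theorem tendsto_sampleSumLaw {P : ℕ → ProbabilityMeasure Ω₁} {Q : ℕ → ProbabilityMeasure Ω₂}
    {n₁ n₂ : ℕ → ℕ} {r₁ r₂ : ℝ}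
    (hr₁ : Tendsto (fun n : ℕ => (n₁ n : ℝ) / n) atTop (𝓝 r₁))
    (hr₂ : Tendsto (fun n : ℕ => (n₂ n : ℝ) / n) atTop (𝓝 r₂))
    {X₁ : ℕ → Ω₁ → ℝ} {X₂ : ℕ → Ω₂ → ℝ} (hX₁ : ∀ n, Measurable (X₁ n))
    (hX₂ : ∀ n, Measurable (X₂ n)) {w₁ w₂ : ℝ → ℂ}
    (hw₁ : ∀ s : ℝ, Tendsto (fun n : ℕ => (n : ℂ) *
      (∫ ω, Complex.exp ((s * X₁ n ω : ℝ) * Complex.I) ∂(P n : Measure Ω₁) - 1)) atTop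
      (𝓝 (w₁ s)))
    (hw₂ : ∀ s : ℝ, Tendsto (fun n : ℕ => (n : ℂ) *
      (∫ ω, Complex.exp ((s * X₂ n ω : ℝ) * Complex.I) ∂(Q n : Measure Ω₂) - 1)) atTop
      (𝓝 (w₂ s)))
    {m : ℝ} {v : NNReal}
    (hmv : ∀ s : ℝ, r₁ * w₁ s + r₂ * w₂ s = s * m * Complex.I - v * s ^ 2 / 2) :
    Tendsto (fun n => sampleSumLaw (P n) (Q n) (n₁ n) (n₂ n) (hX₁ n) (hX₂ n)) atTop
      (𝓝 (gaussianProb m v)) := by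
  refine ProbabilityMeasure.tendsto_of_tendsto_charFun fun s => ?_
  have h1 := (tendsto_pow_exp_of_ratio (hw₁ s) hr₁).mul (tendsto_pow_exp_of_ratio (hw₂ s) hr₂)
  rw [← Complex.exp_add, hmv s] at h1
  change Tendsto _ _ (𝓝 (charFun (gaussianReal m v) s))
  rw [charFun_gaussianReal]
  refine h1.congr fun n => ?_
  change _ = charFun ((sampleLaw (P n) (Q n) (n₁ n) (n₂ n)).map (sampleSum (X₁ n) (X₂ n))) s
  rw [charFun_apply_real, integral_map (measurable_sampleSum (hX₁ n) (hX₂ n)).aemeasurable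
    (Measurable.aestronglyMeasurable (by fun_prop)), integral_cexp_sampleSum]

end SampleSums

/-! ### Product densities and the Neyman–Pearson bound -/

section NeymanPearson

variable {ι α : Type*} [Fintype ι] [MeasurableSpace α]

/-- Product measures are monotone: the product of `ν` is built from the largest outer measure that
is dominated by the product formula on boxes. -/
theorem pi_mono_measure {μ ν : Measure α} [SigmaFinite μ] [SigmaFinite ν] (h : μ ≤ ν) :
    Measure.pi (fun _ : ι => μ) ≤ Measure.pi (fun _ : ι => ν) := by
  have h1 : (Measure.pi (fun _ : ι => μ)).toOuterMeasure ≤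
      OuterMeasure.pi (fun _ : ι => ν.toOuterMeasure) := by
    rw [OuterMeasure.le_pi]
    intro s _
    change Measure.pi (fun _ : ι => μ) (univ.pi s) ≤ _
    rw [Measure.pi_pi]
    exact Finset.prod_le_prod' fun i _ => h (s i)
  refine Measure.le_iff.2 fun s hs => ?_
  rw [Measure.pi_def (fun _ : ι => ν), toMeasure_apply _ _ hs]
  exact h1 s

theorem pi_withDensity {μ : Measure α} [IsProbabilityMeasure μ] {L : α → ENNReal}
    (hL : Measurable L) [IsFiniteMeasure (μ.withDensity L)] :
    Measure.pi (fun _ : ι => μ.withDensity L) =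
      (Measure.pi (fun _ : ι => μ)).withDensity fun x => ∏ i, L (x i) := by
  refine Measure.pi_eq fun s hs => ?_
  have hind : ∀ x : ι → α, (univ.pi s).indicator (fun x => ∏ i, L (x i)) x =
      ∏ i, (s i).indicator L (x i) := fun x => by
    by_cases hx : x ∈ univ.pi s
    · rw [indicator_of_mem hx]
      exact Finset.prod_congr rfl fun i _ => (indicator_of_mem (hx i (mem_univ i)) L).symm
    · rw [indicator_of_notMem hx]
      simp only [Set.mem_pi, mem_univ, true_imp_iff, not_forall] at hx
      obtain ⟨i, hi⟩ := hx
      exact (Finset.prod_eq_zero (Finset.mem_univ i) (indicator_of_notMem hi L)).symm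
  have hbox : MeasurableSet (univ.pi s) := MeasurableSet.univ_pi hs
  rw [withDensity_apply _ hbox, ← lintegral_indicator hbox]
  simp_rw [hind]
  have hm : ∀ i, Measurable ((s i).indicator L) := fun i => hL.indicator (hs i)
  have hprod := lintegral_prod_eq_prod_lintegral_of_indepFun Finset.univ
    (fun i (x : ι → α) => (s i).indicator L (x i))
    (iIndepFun_pi (μ := fun _ : ι => μ) (X := fun i => (s i).indicator L)
      fun i => (hm i).aemeasurable)
    (fun i => (hm i).comp (measurable_pi_apply i))
  rw [hprod]
  refine Finset.prod_congr rfl fun i _ => ?_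
  rw [withDensity_apply _ (hs i), ← lintegral_indicator (hs i),
    (measurePreserving_eval (fun _ : ι => μ) i).lintegral_comp (hm i)]

variable {Ω₁ Ω₂ : Type*} [MeasurableSpace Ω₁] [MeasurableSpace Ω₂]

/-- The density of the absolutely continuous part of `P^{m₁} ⊗ Q^{m₂}` with respect to
`P₀^{m₁} ⊗ Q₀^{m₂}`. -/
def sampleDensity (P P₀ : ProbabilityMeasure Ω₁) (Q Q₀ : ProbabilityMeasure Ω₂) {m₁ m₂ : ℕ}
    (x : SampleSpace Ω₁ Ω₂ m₁ m₂) : ENNReal :=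
  (∏ i, (P : Measure Ω₁).rnDeriv (P₀ : Measure Ω₁) (x.1 i)) *
    ∏ j, (Q : Measure Ω₂).rnDeriv (Q₀ : Measure Ω₂) (x.2 j)

theorem measurable_sampleDensity (P P₀ : ProbabilityMeasure Ω₁) (Q Q₀ : ProbabilityMeasure Ω₂)
    {m₁ m₂ : ℕ} : Measurable (sampleDensity P P₀ Q Q₀ (m₁ := m₁) (m₂ := m₂)) := by
  have := Measure.measurable_rnDeriv (P : Measure Ω₁) (P₀ : Measure Ω₁)
  have := Measure.measurable_rnDeriv (Q : Measure Ω₂) (Q₀ : Measure Ω₂)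
  unfold sampleDensity
  fun_prop

theorem withDensity_sampleDensity_le (P P₀ : ProbabilityMeasure Ω₁) (Q Q₀ : ProbabilityMeasure Ω₂)
    (m₁ m₂ : ℕ) :
    (sampleLaw P₀ Q₀ m₁ m₂).withDensity (sampleDensity P P₀ Q Q₀) ≤ sampleLaw P Q m₁ m₂ := by
  have hP := Measure.withDensity_rnDeriv_le (P : Measure Ω₁) (P₀ : Measure Ω₁)
  have hQ := Measure.withDensity_rnDeriv_le (Q : Measure Ω₂) (Q₀ : Measure Ω₂)
  have mP := Measure.measurable_rnDeriv (P : Measure Ω₁) (P₀ : Measure Ω₁)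
  have mQ := Measure.measurable_rnDeriv (Q : Measure Ω₂) (Q₀ : Measure Ω₂)
  have : IsFiniteMeasure ((P₀ : Measure Ω₁).withDensity
      ((P : Measure Ω₁).rnDeriv (P₀ : Measure Ω₁))) := isFiniteMeasure_of_le _ hP
  have : IsFiniteMeasure ((Q₀ : Measure Ω₂).withDensity
      ((Q : Measure Ω₂).rnDeriv (Q₀ : Measure Ω₂))) := isFiniteMeasure_of_le _ hQ
  have h := Measure.prod_mono (pi_mono_measure (ι := Fin m₁) hP) (pi_mono_measure (ι := Fin m₂) hQ)
  rw [pi_withDensity mP, pi_withDensity mQ] at h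
  have : SFinite ((Measure.pi fun _ : Fin m₂ => (Q₀ : Measure Ω₂)).withDensity
    fun x => ∏ i, (Q : Measure Ω₂).rnDeriv (Q₀ : Measure Ω₂) (x i)) := by
      rw [← pi_withDensity mQ]; infer_instance
  rw [prod_withDensity (by fun_prop) (by fun_prop)] at h
  exact h

/-- One half of the Neyman–Pearson lemma, in integrated form: the power of any test is bounded in
terms of its level and the truncated likelihood ratio. -/
theorem power_le_of_withDensity_le {X : Type*} [MeasurableSpace X] {μ₀ μ : Measure X}
    [IsProbabilityMeasure μ₀] [IsProbabilityMeasure μ] {M : X → ENNReal} (hM : Measurable M)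
    (hle : μ₀.withDensity M ≤ μ) {φ : X → ℝ} (hφ : Measurable φ) (h01 : ∀ x, φ x ∈ Icc (0 : ℝ) 1)
    (c : ℝ) :
    ∫ x, φ x ∂μ ≤ c * ∫ x, φ x ∂μ₀ + (1 - ∫ x, min (M x).toReal c ∂μ₀) := by
  have hi : ∀ ν : Measure X, IsFiniteMeasure ν → Integrable φ ν := fun ν _ =>
    Integrable.of_bound hφ.aestronglyMeasurable 1 (ae_of_all _ fun x => by
      rw [Real.norm_of_nonneg (h01 x).1]; exact (h01 x).2)
  have : IsFiniteMeasure (μ₀.withDensity M) := isFiniteMeasure_of_le _ hle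
  have hMfin : ∫⁻ x, M x ∂μ₀ ≠ ⊤ := by
    have := measure_ne_top (μ₀.withDensity M) univ
    rwa [withDensity_apply _ .univ, setLIntegral_univ] at this
  have hMlt : ∀ᵐ x ∂μ₀, M x < ⊤ := ae_lt_top hM hMfin
  have hMi : Integrable (fun x => (M x).toReal) μ₀ :=
    integrable_toReal_of_lintegral_ne_top hM.aemeasurable hMfin
  have hmin : Integrable (fun x => min (M x).toReal c) μ₀ := hMi.inf (integrable_const c)
  have h1 : ∫ x, (1 - φ x) ∂(μ₀.withDensity M) ≤ ∫ x, (1 - φ x) ∂μ :=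
    integral_mono_measure hle (ae_of_all _ fun x => sub_nonneg.2 (h01 x).2)
      ((integrable_const 1).sub (hi μ inferInstance))
  rw [integral_withDensity_eq_integral_toReal_smul hM hMlt, integral_sub (integrable_const 1)
    (hi μ inferInstance)] at h1
  have h2 : ∫ x, (min (M x).toReal c - c * φ x) ∂μ₀ ≤ ∫ x, (M x).toReal • (1 - φ x) ∂μ₀ := by
    refine integral_mono (hmin.sub ((hi μ₀ inferInstance).const_mul c)) ?_ fun x => ?_
    · exact hMi.mul_bdd (c := 1) (hφ.const_sub 1).aestronglyMeasurable (ae_of_all _ fun x => by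
        rw [Real.norm_of_nonneg (sub_nonneg.2 (h01 x).2)]; linarith [(h01 x).1])
    · beta_reduce
      rw [smul_eq_mul]
      have a1 := (h01 x).1
      have a2 := (h01 x).2
      have a3 := min_le_left (M x).toReal c
      have a4 := min_le_right (M x).toReal c
      nlinarith [mul_le_mul_of_nonneg_right a3 (sub_nonneg.2 a2),
        mul_le_mul_of_nonneg_right a4 a1]
  rw [integral_sub hmin ((hi μ₀ inferInstance).const_mul c), integral_const_mul] at h2
  simp only [smul_eq_mul, integral_const, probReal_univ, mul_one] at h1 h2
  linarith

end NeymanPearson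

/-! ### The standard normal distribution -/

section Gaussian

/-- The upper tail probability `1 - Φ(x)` of the standard normal distribution. -/
def normalTail (x : ℝ) : ℝ := (gaussianReal 0 1).real (Ioi x)

theorem normalTail_eq_one_sub_cdf (x : ℝ) : normalTail x = 1 - cdf (gaussianReal 0 1) x := by
  rw [cdf_eq_real, normalTail, ← compl_Iic, probReal_compl_eq_one_sub measurableSet_Iic]

theorem continuous_cdf_gaussianReal : Continuous (cdf (gaussianReal 0 1)) := by
  refine continuous_iff_continuousAt.2 fun x => ?_
  rw [(monotone_cdf _).continuousAt_iff_leftLim_eq_rightLim, StieltjesFunction.rightLim_eq]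
  have : NullSingletonClass (gaussianReal 0 1) := nullSingletonClass_gaussianReal one_ne_zero
  have h1 := (cdf (gaussianReal 0 1)).measure_singleton x
  rw [measure_cdf, measure_singleton, eq_comm, ENNReal.ofReal_eq_zero] at h1
  exact le_antisymm ((monotone_cdf _).leftLim_le le_rfl) (by linarith)

theorem continuous_normalTail : Continuous normalTail := by
  have : normalTail = fun x => 1 - cdf (gaussianReal 0 1) x := funext normalTail_eq_one_sub_cdf
  rw [this]
  exact continuous_const.sub continuous_cdf_gaussianReal

theorem normalTail_stdNormalQuantile {α : ℝ} (hα : α ∈ Ioo (0 : ℝ) 1) :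
    normalTail (stdNormalQuantile (1 - α)) = α := by
  set F := cdf (gaussianReal 0 1) with hF
  have hFc : Continuous F := continuous_cdf_gaussianReal
  set S : Set ℝ := {x : ℝ | 1 - α ≤ F x} with hS
  have hne : S.Nonempty := by
    obtain ⟨x, hx⟩ := ((tendsto_cdf_atTop (gaussianReal 0 1)).eventually_const_le
      (show 1 - α < 1 by linarith [hα.1])).exists
    exact ⟨x, hx⟩
  have hbdd : BddBelow S := by
    obtain ⟨x, hx⟩ := ((tendsto_cdf_atBot (gaussianReal 0 1)).eventually_lt_const
      (show 0 < 1 - α by linarith [hα.2])).exists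
    refine ⟨x, fun y hy => ?_⟩
    by_contra hlt
    push Not at hlt
    exact absurd (hy.trans ((monotone_cdf (gaussianReal 0 1)) hlt.le)) (not_le.2 hx)
  have hclosed : IsClosed S := isClosed_le continuous_const hFc
  have hmem : stdNormalQuantile (1 - α) ∈ S := hclosed.csInf_mem hne hbdd
  have hle : F (stdNormalQuantile (1 - α)) ≤ 1 - α := by
    refine le_of_tendsto (hFc.continuousWithinAt (s := Iio (stdNormalQuantile (1 - α)))) ?_
    filter_upwards [self_mem_nhdsWithin] with y hy
    have : y ∉ S := fun h => absurd (csInf_le hbdd h) (not_le.2 hy)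
    exact (not_le.1 this).le
  rw [normalTail_eq_one_sub_cdf, ← hF, le_antisymm hle hmem]
  ring

theorem gaussianReal_eq_map (m σ : ℝ) :
    gaussianReal m (σ ^ 2).toNNReal = (gaussianReal 0 1).map fun z => σ * z + m := by
  have h : (fun z : ℝ => σ * z + m) = (fun z => z + m) ∘ fun z => σ * z := rfl
  rw [h, ← Measure.map_map (by fun_prop) (by fun_prop), gaussianReal_map_const_mul,
    gaussianReal_map_add_const]
  congr 1
  · ring
  · rw [mul_one]
    ext
    simp [Real.coe_toNNReal _ (sq_nonneg σ)]

theorem gaussianReal_real_Ioi (m : ℝ) {σ : ℝ} (hσ : 0 < σ) (c : ℝ) :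
    (gaussianReal m (σ ^ 2).toNNReal).real (Ioi c) = normalTail ((c - m) / σ) := by
  rw [gaussianReal_eq_map, map_measureReal_apply (by fun_prop) measurableSet_Ioi, normalTail]
  congr 1
  ext z
  simp only [mem_preimage, mem_Ioi]
  rw [div_lt_iff₀ hσ, sub_lt_iff_lt_add, mul_comm]

/-- Exponential tilting of the standard normal distribution is a shift. -/
theorem setIntegral_exp_gaussianReal (σ u : ℝ) :
    ∫ z in Iic u, Real.exp (σ * z - σ ^ 2 / 2) ∂(gaussianReal 0 1) = 1 - normalTail (u - σ) := by
  have h1 : (gaussianReal σ 1).real (Iic u) = 1 - normalTail (u - σ) := by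
    have h2 := gaussianReal_real_Ioi σ one_pos u
    rw [div_one, one_pow, Real.toNNReal_one] at h2
    rw [← h2, ← compl_Iic, probReal_compl_eq_one_sub measurableSet_Iic]
    ring
  have e : ∀ m : ℝ, gaussianReal m 1 =
      volume.withDensity fun x => ENNReal.ofReal (gaussianPDFReal m 1 x) := fun m => by
    rw [gaussianReal_of_var_ne_zero m one_ne_zero]
    rfl
  rw [← h1, e 0, restrict_withDensity measurableSet_Iic,
    integral_withDensity_eq_integral_toReal_smul (by fun_prop) (ae_of_all _ fun _ => by simp),
    e σ, measureReal_def, withDensity_apply _ measurableSet_Iic,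
    ← integral_eq_lintegral_of_nonneg_ae (ae_of_all _ fun _ => gaussianPDFReal_nonneg _ _ _)
      (Measurable.aestronglyMeasurable (by fun_prop))]
  refine setIntegral_congr_fun measurableSet_Iic fun z _ => ?_
  simp only [smul_eq_mul, ENNReal.toReal_ofReal (gaussianPDFReal_nonneg _ _ _)]
  rw [gaussianPDFReal, gaussianPDFReal, mul_assoc, ← Real.exp_add]
  congr 2
  push_cast
  ring

/-- The truncated mean of the limiting likelihood ratio. At this truncation level the Neyman–Pearson
bound turns into the power `1 - Φ(u - σ)` of the Gaussian shift test. -/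
theorem integral_min_exp_gaussianReal (u : ℝ) {σ : ℝ} (hσ : 0 ≤ σ) :
    ∫ z, min (Real.exp z) (Real.exp (σ * u - σ ^ 2 / 2))
        ∂(gaussianReal (-σ ^ 2 / 2) (σ ^ 2).toNNReal) =
      1 - normalTail (u - σ) + Real.exp (σ * u - σ ^ 2 / 2) * normalTail u := by
  rw [gaussianReal_eq_map, integral_map (by fun_prop)
    (Measurable.aestronglyMeasurable (by fun_prop))]
  set c := Real.exp (σ * u - σ ^ 2 / 2) with hc
  have hint : Integrable (fun z : ℝ => min (Real.exp (σ * z + -σ ^ 2 / 2)) c)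
      (gaussianReal 0 1) := by
    refine Integrable.of_bound (Measurable.aestronglyMeasurable (by fun_prop)) c
      (ae_of_all _ fun z => ?_)
    rw [Real.norm_of_nonneg (le_min (Real.exp_pos _).le (Real.exp_pos _).le)]
    exact min_le_right _ _
  rw [← integral_add_compl measurableSet_Iic hint, ← setIntegral_exp_gaussianReal]
  congr 1
  · refine setIntegral_congr_fun measurableSet_Iic fun z (hz : z ≤ u) => ?_
    rw [min_eq_left]
    · congr 1; ring
    · refine Real.exp_le_exp.2 ?_
      nlinarith
  · have : ∫ z in (Iic u)ᶜ, min (Real.exp (σ * z + -σ ^ 2 / 2)) c ∂(gaussianReal 0 1) =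
        ∫ z in (Iic u)ᶜ, c ∂(gaussianReal 0 1) := by
      refine setIntegral_congr_fun measurableSet_Iic.compl fun z hz => ?_
      rw [min_eq_right]
      refine Real.exp_le_exp.2 ?_
      have hz' : u < z := not_le.1 hz
      nlinarith
    rw [this, setIntegral_const, smul_eq_mul, compl_Iic, mul_comm]
    rfl

end Gaussian

/-! ### Asymptotic power of arbitrary tests and of the one-sided test -/

section Power

variable {Ω₁ Ω₂ : Type*} [MeasurableSpace Ω₁] [MeasurableSpace Ω₂]

theorem integral_sampleSum (P : ProbabilityMeasure Ω₁) (Q : ProbabilityMeasure Ω₂) (m₁ m₂ : ℕ)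
    {X₁ : Ω₁ → ℝ} {X₂ : Ω₂ → ℝ} (h₁ : Integrable X₁ (P : Measure Ω₁))
    (h₂ : Integrable X₂ (Q : Measure Ω₂)) :
    Integrable (sampleSum X₁ X₂) (sampleLaw P Q m₁ m₂) ∧
    ∫ x, sampleSum X₁ X₂ x ∂(sampleLaw P Q m₁ m₂) =
      m₁ * ∫ ω, X₁ ω ∂(P : Measure Ω₁) + m₂ * ∫ ω, X₂ ω ∂(Q : Measure Ω₂) := by
  have hp₁ : ∀ i, MeasurePreserving (fun x : SampleSpace Ω₁ Ω₂ m₁ m₂ => x.1 i)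
      (sampleLaw P Q m₁ m₂) (P : Measure Ω₁) := fun i =>
    (measurePreserving_eval (fun _ : Fin m₁ => (P : Measure Ω₁)) i).comp
      (measurePreserving_fst (ν := Measure.pi fun _ : Fin m₂ => (Q : Measure Ω₂)))
  have hp₂ : ∀ j, MeasurePreserving (fun x : SampleSpace Ω₁ Ω₂ m₁ m₂ => x.2 j)
      (sampleLaw P Q m₁ m₂) (Q : Measure Ω₂) := fun j =>
    (measurePreserving_eval (fun _ : Fin m₂ => (Q : Measure Ω₂)) j).comp
      (measurePreserving_snd (μ := Measure.pi fun _ : Fin m₁ => (P : Measure Ω₁)))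
  have hi₁ : ∀ i ∈ Finset.univ, Integrable (fun x : SampleSpace Ω₁ Ω₂ m₁ m₂ => X₁ (x.1 i))
      (sampleLaw P Q m₁ m₂) := fun i _ => (hp₁ i).integrable_comp_of_integrable h₁
  have hi₂ : ∀ j ∈ Finset.univ, Integrable (fun x : SampleSpace Ω₁ Ω₂ m₁ m₂ => X₂ (x.2 j))
      (sampleLaw P Q m₁ m₂) := fun j _ => (hp₂ j).integrable_comp_of_integrable h₂
  have e₁ : ∀ i, ∫ x : SampleSpace Ω₁ Ω₂ m₁ m₂, X₁ (x.1 i) ∂(sampleLaw P Q m₁ m₂) =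
      ∫ ω, X₁ ω ∂(P : Measure Ω₁) := fun i => by
    rw [← (hp₁ i).map_eq, integral_map (hp₁ i).aemeasurable
      (by rw [(hp₁ i).map_eq]; exact h₁.aestronglyMeasurable)]
  have e₂ : ∀ j, ∫ x : SampleSpace Ω₁ Ω₂ m₁ m₂, X₂ (x.2 j) ∂(sampleLaw P Q m₁ m₂) =
      ∫ ω, X₂ ω ∂(Q : Measure Ω₂) := fun j => by
    rw [← (hp₂ j).map_eq, integral_map (hp₂ j).aemeasurable
      (by rw [(hp₂ j).map_eq]; exact h₂.aestronglyMeasurable)]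
  unfold sampleSum
  refine ⟨(integrable_finsetSum _ hi₁).add (integrable_finsetSum _ hi₂), ?_⟩
  rw [integral_add (integrable_finsetSum _ hi₁) (integrable_finsetSum _ hi₂),
    integral_finsetSum _ hi₁, integral_finsetSum _ hi₂]
  simp [e₁, e₂]

theorem tendsto_fst_ratio {n₁ n₂ : ℕ → ℕ} (hn : ∀ n, n₁ n + n₂ n = n) {d : ℝ}
    (hnd : Tendsto (fun n : ℕ => (n₂ n : ℝ) / n) atTop (𝓝 d)) :
    Tendsto (fun n : ℕ => (n₁ n : ℝ) / n) atTop (𝓝 (1 - d)) := by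
  refine (hnd.const_sub 1).congr' ?_
  filter_upwards [eventually_gt_atTop 0] with n h0
  have h1 : (n₁ n : ℝ) + n₂ n = n := by exact_mod_cast hn n
  have h2 : (n : ℝ) ≠ 0 := Nat.cast_ne_zero.2 h0.ne'
  field_simp
  linarith

variable {P : ℕ → ProbabilityMeasure Ω₁} {Q : ℕ → ProbabilityMeasure Ω₂}
  {P₀ : ProbabilityMeasure Ω₁} {Q₀ : ProbabilityMeasure Ω₂}
  {h₁ : Lp ℝ 2 (P₀ : Measure Ω₁)} {h₂ : Lp ℝ 2 (Q₀ : Measure Ω₂)}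

/-- The log density `log dR/dR₀`, with value `0` where the density vanishes or is infinite. -/
def logDensity {Ω : Type*} [MeasurableSpace Ω] (R R₀ : ProbabilityMeasure Ω) (ω : Ω) : ℝ :=
  Real.log ((R : Measure Ω).rnDeriv (R₀ : Measure Ω) ω).toReal

theorem measurable_logDensity {Ω : Type*} [MeasurableSpace Ω] (R R₀ : ProbabilityMeasure Ω) :
    Measurable (logDensity R R₀) :=
  (Measure.measurable_rnDeriv _ _).ennreal_toReal.log

/-- The set where the density `dR/dR₀` vanishes (or is infinite). -/
def zeroDensitySet {Ω : Type*} [MeasurableSpace Ω] (R R₀ : ProbabilityMeasure Ω) : Set Ω :=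
  {ω | ((R : Measure Ω).rnDeriv (R₀ : Measure Ω) ω).toReal = 0}

theorem measurableSet_zeroDensitySet {Ω : Type*} [MeasurableSpace Ω]
    (R R₀ : ProbabilityMeasure Ω) : MeasurableSet (zeroDensitySet R R₀) :=
  (Measure.measurable_rnDeriv _ _).ennreal_toReal (measurableSet_singleton 0)

/-- Away from the points of vanishing density, the likelihood ratio of the samples is the
exponential of the sum of the log densities. -/
theorem min_exp_sampleSum_le (P P₀ : ProbabilityMeasure Ω₁) (Q Q₀ : ProbabilityMeasure Ω₂)
    {m₁ m₂ : ℕ} {c : ℝ} (hc : 0 ≤ c) (x : SampleSpace Ω₁ Ω₂ m₁ m₂) :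
    min (Real.exp (sampleSum (logDensity P P₀) (logDensity Q Q₀) x)) c ≤
      min (sampleDensity P P₀ Q Q₀ x).toReal c +
        c * sampleSum ((zeroDensitySet P P₀).indicator fun _ => 1)
          ((zeroDensitySet Q Q₀).indicator fun _ => 1) x := by
  have hn₁ : ∀ ω, 0 ≤ (zeroDensitySet P P₀).indicator (fun _ => (1 : ℝ)) ω := fun ω =>
    indicator_nonneg (fun _ _ => zero_le_one) ω
  have hn₂ : ∀ ω, 0 ≤ (zeroDensitySet Q Q₀).indicator (fun _ => (1 : ℝ)) ω := fun ω =>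
    indicator_nonneg (fun _ _ => zero_le_one) ω
  have hs₁ := Finset.sum_nonneg fun i (_ : i ∈ Finset.univ) => hn₁ (x.1 i)
  have hs₂ := Finset.sum_nonneg fun j (_ : j ∈ Finset.univ) => hn₂ (x.2 j)
  have hmin : 0 ≤ min (sampleDensity P P₀ Q Q₀ x).toReal c := le_min ENNReal.toReal_nonneg hc
  by_cases hx : (∃ i, x.1 i ∈ zeroDensitySet P P₀) ∨ ∃ j, x.2 j ∈ zeroDensitySet Q Q₀
  · have h1 : 1 ≤ sampleSum ((zeroDensitySet P P₀).indicator fun _ => 1)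
          ((zeroDensitySet Q Q₀).indicator fun _ => (1 : ℝ)) x := by
      unfold sampleSum
      rcases hx with ⟨i, hi⟩ | ⟨j, hj⟩
      · have := Finset.single_le_sum (fun i (_ : i ∈ Finset.univ) => hn₁ (x.1 i))
          (Finset.mem_univ i)
        rw [indicator_of_mem hi] at this
        linarith
      · have := Finset.single_le_sum (fun j (_ : j ∈ Finset.univ) => hn₂ (x.2 j))
          (Finset.mem_univ j)
        rw [indicator_of_mem hj] at this
        linarith
    refine (min_le_right _ _).trans ?_
    nlinarith
  · push Not at hx
    have h1 : Real.exp (sampleSum (logDensity P P₀) (logDensity Q Q₀) x) =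
        (sampleDensity P P₀ Q Q₀ x).toReal := by
      rw [sampleSum, Real.exp_add, Real.exp_sum, Real.exp_sum, sampleDensity, ENNReal.toReal_mul,
        ENNReal.toReal_prod, ENNReal.toReal_prod]
      congr 1
      · exact Finset.prod_congr rfl fun i _ => Real.exp_log
          (lt_of_le_of_ne ENNReal.toReal_nonneg (Ne.symm (hx.1 i)))
      · exact Finset.prod_congr rfl fun j _ => Real.exp_log
          (lt_of_le_of_ne ENNReal.toReal_nonneg (Ne.symm (hx.2 j)))
    rw [h1]
    have : 0 ≤ c * sampleSum ((zeroDensitySet P P₀).indicator fun _ => 1)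
          ((zeroDensitySet Q Q₀).indicator fun _ => (1 : ℝ)) x :=
      mul_nonneg hc (add_nonneg hs₁ hs₂)
    linarith

/-- The expected number of null observations at which the density vanishes tends to zero. -/
theorem tendsto_integral_zeroDensity {r₁ r₂ : ℝ} {n₁ n₂ : ℕ → ℕ}
    (hr₁ : Tendsto (fun n : ℕ => (n₁ n : ℝ) / n) atTop (𝓝 r₁))
    (hr₂ : Tendsto (fun n : ℕ => (n₂ n : ℝ) / n) atTop (𝓝 r₂))
    (hP : HasLocalTangent atTop (fun n : ℕ => √(n : ℝ)) P P₀ h₁)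
    (hQ : HasLocalTangent atTop (fun n : ℕ => √(n : ℝ)) Q Q₀ h₂) :
    Tendsto (fun n => ∫ x, sampleSum ((zeroDensitySet (P n) P₀).indicator fun _ => 1)
          ((zeroDensitySet (Q n) Q₀).indicator fun _ => (1 : ℝ)) x
            ∂(sampleLaw P₀ Q₀ (n₁ n) (n₂ n))) atTop (𝓝 0) := by
  have h := (hr₁.mul hP.tendsto_nat_mul_measure_density_zero).add
    (hr₂.mul hQ.tendsto_nat_mul_measure_density_zero)
  rw [mul_zero, mul_zero, add_zero] at h
  refine h.congr' ?_
  filter_upwards [eventually_gt_atTop 0] with n h0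
  have h2 : (n : ℝ) ≠ 0 := Nat.cast_ne_zero.2 h0.ne'
  rw [(integral_sampleSum P₀ Q₀ (n₁ n) (n₂ n)
    ((integrable_const 1).indicator (measurableSet_zeroDensitySet (P n) P₀))
    ((integrable_const 1).indicator (measurableSet_zeroDensitySet (Q n) Q₀))).2,
    integral_indicator_const _ (measurableSet_zeroDensitySet (P n) P₀),
    integral_indicator_const _ (measurableSet_zeroDensitySet (Q n) Q₀), ← mul_assoc, ← mul_assoc,
    div_mul_cancel₀ _ h2, div_mul_cancel₀ _ h2]
  simp [zeroDensitySet]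

/-- Asymptotic Neyman–Pearson bound: no asymptotically similar test beats the limiting Gaussian
shift experiment, whose shift is the norm of the tangent weighted by the sample proportions. -/
theorem limsup_power_le {n₁ n₂ : ℕ → ℕ} (hn : ∀ n, n₁ n + n₂ n = n) {d : ℝ}
    (hnd : Tendsto (fun n : ℕ => (n₂ n : ℝ) / n) atTop (𝓝 d))
    (hP : HasLocalTangent atTop (fun n : ℕ => √(n : ℝ)) P P₀ h₁)
    (hQ : HasLocalTangent atTop (fun n : ℕ => √(n : ℝ)) Q Q₀ h₂)
    {σ : ℝ} (hσ : 0 ≤ σ) (hσ2 : σ ^ 2 = (1 - d) * ‖h₁‖ ^ 2 + d * ‖h₂‖ ^ 2)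
    {α u : ℝ} (hu : normalTail u = α)
    {φ : ∀ n, SampleSpace Ω₁ Ω₂ (n₁ n) (n₂ n) → ℝ} (hφ : IsAsympSimilar P₀ Q₀ α φ) :
    limsup (power φ fun n => (P n, Q n)) atTop ≤ normalTail (u - σ) := by
  -- the likelihood-ratio threshold at which the limiting Neyman–Pearson test has level `α`
  set c := Real.exp (σ * u - σ ^ 2 / 2) with hc
  have hc0 : 0 ≤ c := (Real.exp_pos _).le
  have hr₁ := tendsto_fst_ratio hn hnd
  have hlaw : Tendsto (fun n => sampleSumLaw P₀ Q₀ (n₁ n) (n₂ n)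
      (measurable_logDensity (P n) P₀) (measurable_logDensity (Q n) Q₀)) atTop
      (𝓝 (gaussianProb (-σ ^ 2 / 2) (σ ^ 2).toNNReal)) := by
    refine tendsto_sampleSumLaw hr₁ hnd (fun n => measurable_logDensity (P n) P₀)
      (fun n => measurable_logDensity (Q n) Q₀) (fun s => hP.tendsto_charFun_log s)
      (fun s => hQ.tendsto_charFun_log s) fun s => ?_
    rw [Real.coe_toNNReal _ (sq_nonneg σ), hσ2]
    push_cast
    ring
  let f : BoundedContinuousFunction ℝ ℝ :=
    BoundedContinuousFunction.ofNormedAddCommGroup (fun z => min (Real.exp z) c) (by fun_prop) c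
      fun z => by
        rw [Real.norm_of_nonneg (le_min (Real.exp_pos _).le hc0)]
        exact min_le_right _ _
  have h1 := (ProbabilityMeasure.tendsto_iff_forall_integral_tendsto.1 hlaw) f
  have h2 : ∫ z, f z ∂(gaussianProb (-σ ^ 2 / 2) (σ ^ 2).toNNReal : Measure ℝ) =
      1 - normalTail (u - σ) + c * normalTail u := integral_min_exp_gaussianReal u hσ
  rw [h2, hu] at h1
  have h3 := ((hφ.2.const_mul c).add (h1.const_sub 1)).add
    ((tendsto_integral_zeroDensity hr₁ hnd hP hQ).const_mul c)
  have e : c * α + (1 - (1 - normalTail (u - σ) + c * α)) + c * 0 = normalTail (u - σ) := by ring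
  rw [e] at h3
  rw [← h3.limsup_eq]
  have hpos : ∀ n, 0 ≤ power φ (fun n => (P n, Q n)) n := fun n =>
    integral_nonneg fun x => ((hφ.1 n).2 x).1
  refine limsup_le_limsup (Eventually.of_forall fun n => ?_)
    (isBoundedUnder_of ⟨0, hpos⟩).isCoboundedUnder_flip h3.isBoundedUnder_le
  have h4 := power_le_of_withDensity_le (measurable_sampleDensity (P n) P₀ (Q n) Q₀)
    (withDensity_sampleDensity_le (P n) P₀ (Q n) Q₀ (n₁ n) (n₂ n)) (hφ.1 n).1 (hφ.1 n).2 c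
  have h5 : ∫ z, f z ∂(sampleSumLaw P₀ Q₀ (n₁ n) (n₂ n)
      (measurable_logDensity (P n) P₀) (measurable_logDensity (Q n) Q₀) : Measure ℝ) =
      ∫ x, min (Real.exp (sampleSum (logDensity (P n) P₀) (logDensity (Q n) Q₀) x)) c
        ∂(sampleLaw P₀ Q₀ (n₁ n) (n₂ n)) :=
    integral_map (measurable_sampleSum (measurable_logDensity _ _)
      (measurable_logDensity _ _)).aemeasurable f.continuous.measurable.aestronglyMeasurable
  have hz := integral_sampleSum P₀ Q₀ (n₁ n) (n₂ n)
    ((integrable_const (1 : ℝ)).indicator (measurableSet_zeroDensitySet (P n) P₀))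
    ((integrable_const (1 : ℝ)).indicator (measurableSet_zeroDensitySet (Q n) Q₀))
  have hmin : Integrable (fun x => min (sampleDensity (P n) P₀ (Q n) Q₀ x).toReal c)
      (sampleLaw P₀ Q₀ (n₁ n) (n₂ n)) := by
    have := measurable_sampleDensity (P n) P₀ (Q n) Q₀ (m₁ := n₁ n) (m₂ := n₂ n)
    refine Integrable.of_bound (Measurable.aestronglyMeasurable (by fun_prop)) c
      (ae_of_all _ fun x => ?_)
    rw [Real.norm_of_nonneg (le_min ENNReal.toReal_nonneg hc0)]
    exact min_le_right _ _
  have h6 : ∫ x, min (Real.exp (sampleSum (logDensity (P n) P₀) (logDensity (Q n) Q₀) x)) c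
        ∂(sampleLaw P₀ Q₀ (n₁ n) (n₂ n)) ≤
      ∫ x, min (sampleDensity (P n) P₀ (Q n) Q₀ x).toReal c ∂(sampleLaw P₀ Q₀ (n₁ n) (n₂ n)) +
      c * ∫ x, sampleSum ((zeroDensitySet (P n) P₀).indicator fun _ => 1)
          ((zeroDensitySet (Q n) Q₀).indicator fun _ => (1 : ℝ)) x
            ∂(sampleLaw P₀ Q₀ (n₁ n) (n₂ n)) := by
    rw [← integral_const_mul, ← integral_add hmin (hz.1.const_mul c)]
    refine integral_mono ?_ (hmin.add (hz.1.const_mul c)) fun x =>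
      min_exp_sampleSum_le (P n) P₀ (Q n) Q₀ hc0 x
    have := measurable_sampleSum (measurable_logDensity (P n) P₀) (measurable_logDensity (Q n) Q₀)
      (m₁ := n₁ n) (m₂ := n₂ n)
    refine Integrable.of_bound (Measurable.aestronglyMeasurable (by fun_prop)) c
      (ae_of_all _ fun x => ?_)
    rw [Real.norm_of_nonneg (le_min (Real.exp_pos _).le hc0)]
    exact min_le_right _ _
  beta_reduce
  rw [h5]
  refine h4.trans ?_
  change c * power φ (fun _ => (P₀, Q₀)) n + _ ≤ _
  linarith

theorem measurable_gradFst (Q₀ : ProbabilityMeasure Ω₂) {κ : Ω₁ × Ω₂ → ℝ} (hκ : Measurable κ) :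
    Measurable (gradFst Q₀ κ) :=
  (hκ.stronglyMeasurable.integral_prod_right' (ν := (Q₀ : Measure Ω₂))).measurable

theorem measurable_gradSnd (P₀ : ProbabilityMeasure Ω₁) {κ : Ω₁ × Ω₂ → ℝ} (hκ : Measurable κ) :
    Measurable (gradSnd P₀ κ) :=
  (hκ.stronglyMeasurable.integral_prod_left' (μ := (P₀ : Measure Ω₁))).measurable

/-- The scaling of the summands of the test statistic, in the form needed for
`HasLocalTangent.tendsto_charFun_statistic`. -/
theorem tendsto_sqrt_mul_scale {m : ℕ → ℕ} {r : ℝ} (hr : 0 < r)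
    (hm : Tendsto (fun n : ℕ => (m n : ℝ) / n) atTop (𝓝 r)) (s : ℝ) :
    Tendsto (fun n : ℕ => √(n : ℝ) * (s * (√(n : ℝ) / m n))) atTop (𝓝 (s / r)) := by
  have h := (hm.inv₀ hr.ne').const_mul s
  rw [← div_eq_mul_inv] at h
  refine h.congr fun n => ?_
  rw [inv_div]
  calc s * ((n : ℝ) / m n) = s * ((√(n : ℝ) * √(n : ℝ)) / m n) := by
        rw [Real.mul_self_sqrt (Nat.cast_nonneg n)]
    _ = _ := by ring

theorem measurable_oneSidedTest (n₁ n₂ : ℕ → ℕ) {κ : Ω₁ × Ω₂ → ℝ} (hκ : Measurable κ)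
    (d α : ℝ) (n : ℕ) : Measurable (oneSidedTest n₁ n₂ P₀ Q₀ κ d α n) := by
  have h1 := measurable_gradFst Q₀ hκ
  have h2 := measurable_gradSnd P₀ hκ
  have h3 : Measurable (testStatistic P₀ Q₀ κ (n₁ n) (n₂ n)) := by
    unfold testStatistic
    fun_prop
  unfold oneSidedTest
  exact Measurable.ite (measurableSet_lt measurable_const h3) measurable_const measurable_const

/-- The asymptotic power of the one-sided test along local alternatives with marginal tangents `h₁`
and `h₂`: the statistic is asymptotically normal, with the inner products of the gradient components
with the tangents as its mean. -/
theorem tendsto_power_oneSidedTest {n₁ n₂ : ℕ → ℕ} (hn : ∀ n, n₁ n + n₂ n = n) {d : ℝ}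
    (hd : d ∈ Ioo (0 : ℝ) 1)
    (hnd : Tendsto (fun n : ℕ => (n₂ n : ℝ) / n) atTop (𝓝 d))
    (hP : HasLocalTangent atTop (fun n : ℕ => √(n : ℝ)) P P₀ h₁)
    (hQ : HasLocalTangent atTop (fun n : ℕ => √(n : ℝ)) Q Q₀ h₂)
    {κ : Ω₁ × Ω₂ → ℝ} (hκ : Measurable κ)
    (hκ₁ : MemLp (gradFst Q₀ κ) 2 (P₀ : Measure Ω₁))
    (hκ₂ : MemLp (gradSnd P₀ κ) 2 (Q₀ : Measure Ω₂))
    (h0₁ : ∫ ω, gradFst Q₀ κ ω ∂(P₀ : Measure Ω₁) = 0)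
    (h0₂ : ∫ ω, gradSnd P₀ κ ω ∂(Q₀ : Measure Ω₂) = 0)
    {σ : ℝ} (hσ : 0 < σ)
    (hσ2 : σ ^ 2 = 1 / (1 - d) * ∫ ω, gradFst Q₀ κ ω ^ 2 ∂(P₀ : Measure Ω₁) +
      1 / d * ∫ ω, gradSnd P₀ κ ω ^ 2 ∂(Q₀ : Measure Ω₂)) (α : ℝ) :
    Tendsto (power (oneSidedTest n₁ n₂ P₀ Q₀ κ d α) fun n => (P n, Q n)) atTop
      (𝓝 (normalTail (stdNormalQuantile (1 - α) -
        (∫ ω, gradFst Q₀ κ ω * h₁ ω ∂(P₀ : Measure Ω₁) +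
          ∫ ω, gradSnd P₀ κ ω * h₂ ω ∂(Q₀ : Measure Ω₂)) / σ))) := by
  have hd1 : 0 < 1 - d := sub_pos.2 hd.2
  have hd0 : 0 < d := hd.1
  set m := ∫ ω, gradFst Q₀ κ ω * h₁ ω ∂(P₀ : Measure Ω₁) +
    ∫ ω, gradSnd P₀ κ ω * h₂ ω ∂(Q₀ : Measure Ω₂) with hm
  have hr₁ := tendsto_fst_ratio hn hnd
  have mκ₁ := measurable_gradFst Q₀ hκ
  have mκ₂ := measurable_gradSnd P₀ hκ
  set X₁ : ℕ → Ω₁ → ℝ := fun n ω => √(n : ℝ) / n₁ n * gradFst Q₀ κ ω with hX₁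
  set X₂ : ℕ → Ω₂ → ℝ := fun n ω => √(n : ℝ) / n₂ n * gradSnd P₀ κ ω with hX₂
  have mX₁ : ∀ n, Measurable (X₁ n) := fun n => mκ₁.const_mul _
  have mX₂ : ∀ n, Measurable (X₂ n) := fun n => mκ₂.const_mul _
  have hlaw : Tendsto (fun n => sampleSumLaw (P n) (Q n) (n₁ n) (n₂ n) (mX₁ n) (mX₂ n)) atTop
      (𝓝 (gaussianProb m (σ ^ 2).toNNReal)) := by
    refine tendsto_sampleSumLaw hr₁ hnd mX₁ mX₂
      (fun s => (hP.tendsto_charFun_statistic mκ₁ hκ₁ h0₁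
        (tendsto_sqrt_mul_scale hd1 hr₁ s)).congr fun n => ?_)
      (fun s => (hQ.tendsto_charFun_statistic mκ₂ hκ₂ h0₂
        (tendsto_sqrt_mul_scale hd0 hnd s)).congr fun n => ?_) fun s => ?_
    · simp only [hX₁, mul_assoc]
    · simp only [hX₂, mul_assoc]
    · rw [Real.coe_toNNReal _ (sq_nonneg σ), hσ2, hm]
      have e1 : (1 - d : ℂ) ≠ 0 := by exact_mod_cast hd1.ne'
      have e2 : (d : ℂ) ≠ 0 := by exact_mod_cast hd0.ne'
      push_cast
      field_simp
      ring
  set c := criticalValue P₀ Q₀ κ d α with hc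
  have hcσ : c = stdNormalQuantile (1 - α) * σ := by
    rw [hc, criticalValue, ← hσ2, Real.sqrt_sq hσ.le]
  have hfr : ((gaussianProb m (σ ^ 2).toNNReal : ProbabilityMeasure ℝ) : Measure ℝ)
      (frontier (Ioi c)) = 0 := by
    have : NullSingletonClass
        ((gaussianProb m (σ ^ 2).toNNReal : ProbabilityMeasure ℝ) : Measure ℝ) :=
      nullSingletonClass_gaussianReal (by
        rw [ne_eq, Real.toNNReal_eq_zero, not_le]; positivity)
    rw [frontier_Ioi]
    exact measure_singleton c
  have h1 := (ENNReal.tendsto_toReal (measure_ne_top _ _)).comp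
    (ProbabilityMeasure.tendsto_measure_of_null_frontier_of_tendsto' hlaw hfr)
  have h2 : ((gaussianProb m (σ ^ 2).toNNReal : Measure ℝ) (Ioi c)).toReal =
      normalTail (stdNormalQuantile (1 - α) - m / σ) := by
    change (gaussianReal m (σ ^ 2).toNNReal).real (Ioi c) = _
    rw [gaussianReal_real_Ioi m hσ, hcσ, sub_div, mul_div_cancel_right₀ _ hσ.ne']
  rw [h2] at h1
  refine h1.congr fun n => ?_
  have hT : ∀ x : SampleSpace Ω₁ Ω₂ (n₁ n) (n₂ n),
      testStatistic P₀ Q₀ κ (n₁ n) (n₂ n) x = sampleSum (X₁ n) (X₂ n) x := fun x => by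
    rw [testStatistic, sampleSum, hn n, Finset.mul_sum, Finset.mul_sum]
  have hS := measurable_sampleSum (mX₁ n) (mX₂ n) (m₁ := n₁ n) (m₂ := n₂ n)
  have hset : MeasurableSet (sampleSum (X₁ n) (X₂ n) ⁻¹' Ioi c :
      Set (SampleSpace Ω₁ Ω₂ (n₁ n) (n₂ n))) := hS measurableSet_Ioi
  have hψ : oneSidedTest n₁ n₂ P₀ Q₀ κ d α n =
      (sampleSum (X₁ n) (X₂ n) ⁻¹' Ioi c).indicator fun _ => (1 : ℝ) := by
    classical
    ext x
    simp only [oneSidedTest, hT, indicator, mem_preimage, mem_Ioi, ← hc]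
  change ((sampleLaw (P n) (Q n) (n₁ n) (n₂ n)).map (sampleSum (X₁ n) (X₂ n)) (Ioi c)).toReal = _
  rw [Measure.map_apply hS measurableSet_Ioi, power, hψ, integral_indicator_const _ hset,
    smul_eq_mul, mul_one]
  rfl

end Power

/-! ### The tangent cone of a product family -/

section Cone

theorem HasLocalTangent.congr' {Ω ι : Type*} [MeasurableSpace Ω] {l : Filter ι} {c : ι → ℝ}
    {R R' : ι → ProbabilityMeasure Ω} {R₀ : ProbabilityMeasure Ω} {h : Lp ℝ 2 (R₀ : Measure Ω)}
    (hR : HasLocalTangent l c R R₀ h) (he : ∀ᶠ i in l, R i = R' i) :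
    HasLocalTangent l c R' R₀ h := by
  refine ⟨hR.1.congr' ?_, hR.2.congr' ?_⟩ <;>
  · filter_upwards [he] with i hi
    rw [hi]

theorem tendsto_inv_inv_nhdsNE :
    Tendsto (fun t : ℝ => (t⁻¹)⁻¹) (𝓝[≠] (0 : ℝ)) (𝓝 0) := by
  simp only [inv_inv]
  exact tendsto_id.mono_left nhdsWithin_le_nhds

variable {Ω₁ Ω₂ : Type*} [MeasurableSpace Ω₁] [MeasurableSpace Ω₂]
  {𝓜₁ : Set (ProbabilityMeasure Ω₁)} {𝓜₂ : Set (ProbabilityMeasure Ω₂)}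
  {P₀ : ProbabilityMeasure Ω₁} {Q₀ : ProbabilityMeasure Ω₂}

/-- The first marginal of a measure on the product space. -/
def fstMarginal (R : ProbabilityMeasure (Ω₁ × Ω₂)) : ProbabilityMeasure Ω₁ :=
  R.map measurable_fst.aemeasurable

/-- The second marginal of a measure on the product space. -/
def sndMarginal (R : ProbabilityMeasure (Ω₁ × Ω₂)) : ProbabilityMeasure Ω₂ :=
  R.map measurable_snd.aemeasurable

@[simp] theorem fstMarginal_prod (P : ProbabilityMeasure Ω₁) (Q : ProbabilityMeasure Ω₂) :
    fstMarginal (P.prod Q) = P := ProbabilityMeasure.map_fst_prod P Q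

@[simp] theorem sndMarginal_prod (P : ProbabilityMeasure Ω₁) (Q : ProbabilityMeasure Ω₂) :
    sndMarginal (P.prod Q) = Q := ProbabilityMeasure.map_snd_prod P Q

theorem marginals_of_mem_productFamily {R : ProbabilityMeasure (Ω₁ × Ω₂)}
    (hR : R ∈ productFamily 𝓜₁ 𝓜₂) :
    fstMarginal R ∈ 𝓜₁ ∧ sndMarginal R ∈ 𝓜₂ ∧ R = (fstMarginal R).prod (sndMarginal R) := by
  obtain ⟨P, hP, Q, hQ, rfl⟩ := hR
  simp [hP, hQ]

theorem IsL2CurveIn.hasLocalTangent_marginals {ε : ℝ} {f : ℝ → ProbabilityMeasure (Ω₁ × Ω₂)}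
    {g : Lp ℝ 2 (P₀.prod Q₀ : Measure (Ω₁ × Ω₂))}
    (hf : IsL2CurveIn (productFamily 𝓜₁ 𝓜₂) (P₀.prod Q₀) ε f g) :
    HasLocalTangent (𝓝[≠] 0) (fun t => t⁻¹)
      (fun t => (fstMarginal (f t)).prod (sndMarginal (f t))) (P₀.prod Q₀) g := by
  refine (isL2DifferentiableAt_iff.1 hf.2.2).2.congr' ?_
  have : Ioo (-ε) ε ∈ 𝓝[≠] (0 : ℝ) :=
    nhdsWithin_le_nhds (Ioo_mem_nhds (neg_lt_zero.2 hf.1) hf.1)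
  filter_upwards [this] with t ht
  exact (marginals_of_mem_productFamily (hf.2.1 t ht)).2.2

theorem eq_add_of_mem_tangentCone {g : Lp ℝ 2 (P₀.prod Q₀ : Measure (Ω₁ × Ω₂))}
    (hg : g ∈ tangentCone (P₀.prod Q₀) (productFamily 𝓜₁ 𝓜₂)) :
    g = liftFst P₀ Q₀ (margFst P₀ Q₀ g) + liftSnd P₀ Q₀ (margSnd P₀ Q₀ g) := by
  obtain ⟨-, ε, f, hf⟩ := hg
  exact hf.hasLocalTangent_marginals.eq_add tendsto_inv_inv_nhdsNE

theorem inner_oneLp_of_integral_eq_zero {g : Lp ℝ 2 (P₀.prod Q₀ : Measure (Ω₁ × Ω₂))}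
    (hg : ∫ ω, g ω ∂(P₀.prod Q₀ : Measure (Ω₁ × Ω₂)) = 0) :
    inner ℝ (margFst P₀ Q₀ g) (oneLp (P₀ : Measure Ω₁)) = (0 : ℝ) ∧
      inner ℝ (margSnd P₀ Q₀ g) (oneLp (Q₀ : Measure Ω₂)) = (0 : ℝ) := by
  rw [inner_margFst, inner_margSnd, liftFst_eq_tensorLp, liftSnd_eq_tensorLp, ← oneLp_prod,
    inner_oneLp]
  exact ⟨hg, hg⟩

theorem integral_liftFst (a : Lp ℝ 2 (P₀ : Measure Ω₁)) :
    ∫ ω, liftFst P₀ Q₀ a ω ∂(P₀.prod Q₀ : Measure (Ω₁ × Ω₂)) =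
      inner ℝ a (oneLp (P₀ : Measure Ω₁)) := by
  rw [← inner_oneLp, liftFst_eq_tensorLp, oneLp_prod, inner_tensorLp, inner_oneLp_self, mul_one]

theorem integral_liftSnd (b : Lp ℝ 2 (Q₀ : Measure Ω₂)) :
    ∫ ω, liftSnd P₀ Q₀ b ω ∂(P₀.prod Q₀ : Measure (Ω₁ × Ω₂)) =
      inner ℝ b (oneLp (Q₀ : Measure Ω₂)) := by
  rw [← inner_oneLp, liftSnd_eq_tensorLp, oneLp_prod, inner_tensorLp, inner_oneLp_self, one_mul]

/-- The tangent cone contains the first component of each of its elements: the curve obtained by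
freezing the second factor stays in the product family. -/
theorem liftFst_margFst_mem_tangentCone (hQ₀ : Q₀ ∈ 𝓜₂)
    {g : Lp ℝ 2 (P₀.prod Q₀ : Measure (Ω₁ × Ω₂))}
    (hg : g ∈ tangentCone (P₀.prod Q₀) (productFamily 𝓜₁ 𝓜₂)) :
    liftFst P₀ Q₀ (margFst P₀ Q₀ g) ∈ tangentCone (P₀.prod Q₀) (productFamily 𝓜₁ 𝓜₂) := by
  obtain ⟨h0, ε, f, hf⟩ := hg
  refine ⟨by rw [integral_liftFst, (inner_oneLp_of_integral_eq_zero h0).1], ε,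
    fun t => (fstMarginal (f t)).prod Q₀, hf.1, fun t ht => ?_, ?_⟩
  · exact ⟨_, (marginals_of_mem_productFamily (hf.2.1 t ht)).1, Q₀, hQ₀, rfl⟩
  · refine isL2DifferentiableAt_iff.2 ⟨?_, ?_⟩
    · rw [hf.2.2.1, fstMarginal_prod]
    · exact (hf.hasLocalTangent_marginals.fst tendsto_inv_inv_nhdsNE).prod_const

/-- The tangent cone contains the second component of each of its elements. -/
theorem liftSnd_margSnd_mem_tangentCone (hP₀ : P₀ ∈ 𝓜₁)
    {g : Lp ℝ 2 (P₀.prod Q₀ : Measure (Ω₁ × Ω₂))}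
    (hg : g ∈ tangentCone (P₀.prod Q₀) (productFamily 𝓜₁ 𝓜₂)) :
    liftSnd P₀ Q₀ (margSnd P₀ Q₀ g) ∈ tangentCone (P₀.prod Q₀) (productFamily 𝓜₁ 𝓜₂) := by
  obtain ⟨h0, ε, f, hf⟩ := hg
  refine ⟨by rw [integral_liftSnd, (inner_oneLp_of_integral_eq_zero h0).2], ε,
    fun t => P₀.prod (sndMarginal (f t)), hf.1, fun t ht => ?_, ?_⟩
  · exact ⟨P₀, hP₀, _, (marginals_of_mem_productFamily (hf.2.1 t ht)).2.1, rfl⟩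
  · refine isL2DifferentiableAt_iff.2 ⟨?_, ?_⟩
    · rw [hf.2.2.1, sndMarginal_prod]
    · exact (hf.hasLocalTangent_marginals.snd tendsto_inv_inv_nhdsNE).const_prod

variable {Ω : Type*} [MeasurableSpace Ω] {R₀ : ProbabilityMeasure Ω}
  {𝓕 : Set (ProbabilityMeasure Ω)}

/-- The tangent cone is invariant under all real scalars, since curves are two-sided and can be run
at any speed. -/
theorem smul_mem_tangentCone (hR₀ : R₀ ∈ 𝓕) {g : Lp ℝ 2 (R₀ : Measure Ω)}
    (hg : g ∈ tangentCone R₀ 𝓕) (c : ℝ) : c • g ∈ tangentCone R₀ 𝓕 := by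
  obtain ⟨h0, ε, f, hf⟩ := hg
  refine ⟨by rw [← inner_oneLp, real_inner_smul_left, inner_oneLp, h0, mul_zero], ?_⟩
  by_cases hc : c = 0
  · refine ⟨1, fun _ => R₀, one_pos, fun _ _ => hR₀, isL2DifferentiableAt_iff.2 ⟨rfl, ?_⟩⟩
    rw [hc, zero_smul]
    exact hasLocalTangent_self _ _ _
  · have hc' : 0 < |c| := abs_pos.2 hc
    refine ⟨ε / |c|, fun t => f (c * t), div_pos hf.1 hc', fun t ht => hf.2.1 _ ?_,
      isL2DifferentiableAt_iff.2 ⟨by rw [mul_zero]; exact hf.2.2.1, ?_⟩⟩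
    · rw [mem_Ioo, ← abs_lt, abs_mul, mul_comm, ← lt_div_iff₀ hc']
      exact abs_lt.2 ht
    · refine (isL2DifferentiableAt_iff.1 hf.2.2).2.comp (t := fun t => c * t) ?_ ?_ ?_
      · refine tendsto_nhdsWithin_iff.2 ⟨?_, ?_⟩
        · have : Tendsto (fun t : ℝ => c * t) (𝓝 0) (𝓝 (c * 0)) :=
            (continuous_const.mul continuous_id).tendsto 0
          rw [mul_zero] at this
          exact this.mono_left nhdsWithin_le_nhds
        · filter_upwards [self_mem_nhdsWithin] with t (ht : t ≠ 0)
          exact mul_ne_zero hc ht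
      · refine tendsto_const_nhds.congr' ?_
        filter_upwards [self_mem_nhdsWithin] with t (ht : t ≠ 0)
        rw [inv_inv]
        field_simp
      · filter_upwards [self_mem_nhdsWithin] with t (ht : t ≠ 0)
        exact inv_ne_zero (mul_ne_zero hc ht)

theorem add_mem_tangentCone (hR₀ : R₀ ∈ 𝓕) (hconv : Convex ℝ (tangentCone R₀ 𝓕))
    {g g' : Lp ℝ 2 (R₀ : Measure Ω)} (hg : g ∈ tangentCone R₀ 𝓕) (hg' : g' ∈ tangentCone R₀ 𝓕) :
    g + g' ∈ tangentCone R₀ 𝓕 := by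
  have h := smul_mem_tangentCone hR₀ (hconv hg hg' (by norm_num : (0 : ℝ) ≤ 1 / 2)
    (by norm_num : (0 : ℝ) ≤ 1 / 2) (by norm_num)) 2
  rwa [smul_add, smul_smul, smul_smul, show (2 : ℝ) * (1 / 2) = 1 by norm_num, one_smul,
    one_smul] at h

theorem zero_mem_tangentCone (hR₀ : R₀ ∈ 𝓕) :
    (0 : Lp ℝ 2 (R₀ : Measure Ω)) ∈ tangentCone R₀ 𝓕 := by
  exact ⟨by rw [← inner_oneLp, inner_zero_left], 1, fun _ => R₀, one_pos, fun _ _ => hR₀,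
    isL2DifferentiableAt_iff.2 ⟨rfl, hasLocalTangent_self _ _ _⟩⟩

/-- A convex tangent cone is a linear subspace, so it is dense in the tangent space. -/
theorem tangentSpace_subset_closure (hR₀ : R₀ ∈ 𝓕) (hconv : Convex ℝ (tangentCone R₀ 𝓕)) :
    (tangentSpace R₀ 𝓕 : Set (Lp ℝ 2 (R₀ : Measure Ω))) ⊆ closure (tangentCone R₀ 𝓕) := by
  rw [tangentSpace, Submodule.topologicalClosure_coe]
  refine closure_mono ?_
  let S : Submodule ℝ (Lp ℝ 2 (R₀ : Measure Ω)) :=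
    { carrier := tangentCone R₀ 𝓕
      add_mem' := fun ha hb => add_mem_tangentCone hR₀ hconv ha hb
      zero_mem' := zero_mem_tangentCone hR₀
      smul_mem' := fun c _ hx => smul_mem_tangentCone hR₀ hx c }
  exact (Submodule.span_le (p := S)).2 subset_rfl

end Cone

/-! ### Implicit alternatives -/

section Alternatives

variable {Ω₁ Ω₂ : Type*} [MeasurableSpace Ω₁] [MeasurableSpace Ω₂]
  {𝓜₁ : Set (ProbabilityMeasure Ω₁)} {𝓜₂ : Set (ProbabilityMeasure Ω₂)}
  {P₀ : ProbabilityMeasure Ω₁} {Q₀ : ProbabilityMeasure Ω₂}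
  {k : ProbabilityMeasure (Ω₁ × Ω₂) → ℝ} {κ : Lp ℝ 2 (P₀.prod Q₀ : Measure (Ω₁ × Ω₂))} {ϑ : ℝ}

theorem tendsto_inv_sqrt_nat : Tendsto (fun n : ℕ => (√(n : ℝ))⁻¹) atTop (𝓝 0) :=
  tendsto_inv_atTop_zero.comp (Real.tendsto_sqrt_atTop.comp tendsto_natCast_atTop_atTop)

/-- Evaluating an `L₂`-differentiable curve at `t n` with `t n √n → t' > 0` gives a local sequence
of measures with tangent `t' g`, along which the functional changes by `t' ⟨κ, g⟩ / √n`. -/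
theorem IsL2CurveIn.local_sequence {𝓕 : Set (ProbabilityMeasure (Ω₁ × Ω₂))}
    (hκ : IsGradient 𝓕 k (P₀.prod Q₀) κ) {ε : ℝ} {f : ℝ → ProbabilityMeasure (Ω₁ × Ω₂)}
    {g : Lp ℝ 2 (P₀.prod Q₀ : Measure (Ω₁ × Ω₂))}
    (hf : IsL2CurveIn 𝓕 (P₀.prod Q₀) ε f g) {t : ℕ → ℝ} {t' : ℝ} (ht : Tendsto t atTop (𝓝 0))
    (ht' : Tendsto (fun n : ℕ => t n * √(n : ℝ)) atTop (𝓝 t')) (hpos : 0 < t') :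
    HasLocalTangent atTop (fun n : ℕ => √(n : ℝ)) (fun n => f (t n)) (P₀.prod Q₀) (t' • g) ∧
    Tendsto (fun n : ℕ => √(n : ℝ) * (k (f (t n)) - k (P₀.prod Q₀))) atTop
      (𝓝 (inner ℝ κ (t' • g))) := by
  have htpos : ∀ᶠ n in atTop, 0 < t n := by
    filter_upwards [ht'.eventually_const_lt hpos] with n hn
    exact pos_of_mul_pos_left hn (Real.sqrt_nonneg _)
  refine ⟨(isL2DifferentiableAt_iff.1 hf.2.2).2.comp (t := t) ?_ ?_ ?_, ?_⟩
  · refine tendsto_nhdsWithin_iff.2 ⟨ht, ?_⟩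
    filter_upwards [htpos] with n hn using hn.ne'
  · simpa only [inv_inv, mul_comm] using ht'
  · filter_upwards [htpos] with n hn using inv_ne_zero hn.ne'
  · have h1 : Tendsto t atTop (𝓝[>] 0) := tendsto_nhdsWithin_iff.2 ⟨ht, htpos⟩
    have h2 := ht'.mul ((hκ.2 ε f g hf).comp h1)
    rw [← inner_eq_integral_mul, ← real_inner_smul_right] at h2
    refine h2.congr' ?_
    filter_upwards [htpos] with n hn
    simp only [Function.comp]
    field_simp

/-- Along an implicit alternative the tangent `h` of the local sequence satisfies
`⟨κ, h⟩ = ϑ`. -/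
theorem exists_tangent_of_mem_implicitAlternatives
    (hκ : IsGradient (productFamily 𝓜₁ 𝓜₂) k (P₀.prod Q₀) κ)
    {R : ℕ → ProbabilityMeasure Ω₁ × ProbabilityMeasure Ω₂}
    (hR : R ∈ implicitAlternatives 𝓜₁ 𝓜₂ k P₀ Q₀ ϑ) :
    ∃ h : Lp ℝ 2 (P₀.prod Q₀ : Measure (Ω₁ × Ω₂)), inner ℝ κ h = ϑ ∧
      HasLocalTangent atTop (fun n : ℕ => √(n : ℝ)) (fun n => (R n).1.prod (R n).2)
        (P₀.prod Q₀) h := by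
  obtain ⟨⟨t, t', ε, f, g, ht, ht', hpos, hf, hfR⟩, hk⟩ := hR
  obtain ⟨h1, h2⟩ := hf.local_sequence hκ ht ht' hpos
  simp only [fun n => (hfR n).2] at h1 h2
  exact ⟨t' • g, tendsto_nhds_unique h2 hk, h1⟩

/-- Every tangent with a positive derivative of the functional carries an implicit alternative. -/
theorem exists_implicitAlternative (hκ : IsGradient (productFamily 𝓜₁ 𝓜₂) k (P₀.prod Q₀) κ)
    (hϑ : 0 < ϑ) {g : Lp ℝ 2 (P₀.prod Q₀ : Measure (Ω₁ × Ω₂))}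
    (hg : g ∈ tangentCone (P₀.prod Q₀) (productFamily 𝓜₁ 𝓜₂)) (hpos : 0 < (inner ℝ κ g : ℝ)) :
    ∃ R ∈ implicitAlternatives 𝓜₁ 𝓜₂ k P₀ Q₀ ϑ,
      HasLocalTangent atTop (fun n : ℕ => √(n : ℝ)) (fun n => (R n).1.prod (R n).2)
        (P₀.prod Q₀) ((ϑ / inner ℝ κ g) • g) := by
  obtain ⟨-, ε, f, hf⟩ := hg
  set t' : ℝ := ϑ / inner ℝ κ g with ht'
  have ht'0 : 0 < t' := div_pos hϑ hpos
  -- the curve is only controlled on `(-ε, ε)`, so the early terms are placed at the base point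
  set t : ℕ → ℝ := fun n => if t' * (√(n : ℝ))⁻¹ < ε then t' * (√(n : ℝ))⁻¹ else 0 with ht
  have hlim : Tendsto (fun n : ℕ => t' * (√(n : ℝ))⁻¹) atTop (𝓝 0) := by
    have := tendsto_inv_sqrt_nat.const_mul t'
    rwa [mul_zero] at this
  have hev : ∀ᶠ n in atTop, t n = t' * (√(n : ℝ))⁻¹ := by
    filter_upwards [hlim.eventually_lt_const hf.1] with n hn
    exact if_pos hn
  have htmem : ∀ n, t n ∈ Ioo (-ε) ε := fun n => by
    by_cases h : t' * (√(n : ℝ))⁻¹ < ε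
    · have h0 : 0 ≤ t' * (√(n : ℝ))⁻¹ := by positivity
      simp only [ht, if_pos h]
      exact ⟨by linarith [hf.1], h⟩
    · simp only [ht, if_neg h]
      exact ⟨neg_lt_zero.2 hf.1, hf.1⟩
  have h1 : Tendsto t atTop (𝓝 0) := hlim.congr' (hev.mono fun n hn => hn.symm)
  have h2 : Tendsto (fun n : ℕ => t n * √(n : ℝ)) atTop (𝓝 t') := by
    refine tendsto_const_nhds.congr' ?_
    filter_upwards [hev, eventually_gt_atTop 0] with n hn h0
    rw [hn, inv_mul_cancel_right₀ (Real.sqrt_pos.2 (Nat.cast_pos.2 h0)).ne']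
  obtain ⟨h3, h4⟩ := hf.local_sequence hκ h1 h2 ht'0
  have h5 : inner ℝ κ (t' • g) = ϑ := by
    rw [real_inner_smul_right, ht', div_mul_cancel₀ _ hpos.ne']
  rw [h5] at h4
  have h6 : ∀ n, f (t n) = (fstMarginal (f (t n))).prod (sndMarginal (f (t n))) := fun n =>
    (marginals_of_mem_productFamily (hf.2.1 _ (htmem n))).2.2
  refine ⟨fun n => (fstMarginal (f (t n)), sndMarginal (f (t n))),
    ⟨⟨t, t', ε, f, g, h1, h2, ht'0, hf, fun n => ⟨htmem n, h6 n⟩⟩, ?_⟩, ?_⟩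
  · simpa only [← h6] using h4
  · simpa only [← h6] using h3

end Alternatives

/-! ### Optimality of the one-sided test -/

section Optimality

variable {Ω₁ Ω₂ : Type*} [MeasurableSpace Ω₁] [MeasurableSpace Ω₂]
  {P₀ : ProbabilityMeasure Ω₁} {Q₀ : ProbabilityMeasure Ω₂}

theorem margFst_liftFst (a : Lp ℝ 2 (P₀ : Measure Ω₁)) :
    margFst P₀ Q₀ (liftFst P₀ Q₀ a) = a := by
  rw [liftFst_eq_tensorLp, margFst_tensorLp, inner_oneLp_self, one_smul]

theorem margSnd_liftSnd (b : Lp ℝ 2 (Q₀ : Measure Ω₂)) :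
    margSnd P₀ Q₀ (liftSnd P₀ Q₀ b) = b := by
  rw [liftSnd_eq_tensorLp, margSnd_tensorLp, inner_oneLp_self, one_smul]

theorem margFst_liftSnd {b : Lp ℝ 2 (Q₀ : Measure Ω₂)}
    (hb : inner ℝ b (oneLp (Q₀ : Measure Ω₂)) = (0 : ℝ)) :
    margFst P₀ Q₀ (liftSnd P₀ Q₀ b) = 0 := by
  rw [liftSnd_eq_tensorLp, margFst_tensorLp, hb, zero_smul]

theorem margSnd_liftFst {a : Lp ℝ 2 (P₀ : Measure Ω₁)}
    (ha : inner ℝ a (oneLp (P₀ : Measure Ω₁)) = (0 : ℝ)) :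
    margSnd P₀ Q₀ (liftFst P₀ Q₀ a) = 0 := by
  rw [liftFst_eq_tensorLp, margSnd_tensorLp, ha, zero_smul]

/-- The direction `(1 - d)⁻¹ h₁ + d⁻¹ h₂` built from the components of `h`. At the canonical
gradient it is the least favourable direction: it minimizes the weighted norm
`(1 - d) ‖g₁‖² + d ‖g₂‖²` for a given value of `⟨κ, g⟩`. -/
def weightedDirection (d : ℝ) (h : Lp ℝ 2 (P₀.prod Q₀ : Measure (Ω₁ × Ω₂))) :
    Lp ℝ 2 (P₀.prod Q₀ : Measure (Ω₁ × Ω₂)) :=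
  (1 - d)⁻¹ • liftFst P₀ Q₀ (margFst P₀ Q₀ h) + d⁻¹ • liftSnd P₀ Q₀ (margSnd P₀ Q₀ h)

/-- The bilinear form `(1 - d)⁻¹ ⟨g₁, h₁⟩ + d⁻¹ ⟨g₂, h₂⟩`; on the diagonal at the canonical gradient
it is the asymptotic variance of the test statistic. -/
def weightedInner (d : ℝ) (g h : Lp ℝ 2 (P₀.prod Q₀ : Measure (Ω₁ × Ω₂))) : ℝ :=
  (1 - d)⁻¹ * inner ℝ (margFst P₀ Q₀ g) (margFst P₀ Q₀ h) +
    d⁻¹ * inner ℝ (margSnd P₀ Q₀ g) (margSnd P₀ Q₀ h)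

theorem inner_weightedDirection (d : ℝ) (g h : Lp ℝ 2 (P₀.prod Q₀ : Measure (Ω₁ × Ω₂))) :
    inner ℝ g (weightedDirection d h) = weightedInner d g h := by
  rw [weightedDirection, weightedInner, inner_add_right, real_inner_smul_right,
    real_inner_smul_right, inner_margFst, inner_margSnd]

theorem weightedInner_self_nonneg {d : ℝ} (hd : d ∈ Ioo (0 : ℝ) 1)
    (h : Lp ℝ 2 (P₀.prod Q₀ : Measure (Ω₁ × Ω₂))) : 0 ≤ weightedInner d h h := by
  have h1 : 0 < 1 - d := sub_pos.2 hd.2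
  have h2 : 0 < d := hd.1
  rw [weightedInner, real_inner_self_eq_norm_sq, real_inner_self_eq_norm_sq]
  positivity

theorem continuous_weightedInner_right (d : ℝ) (g : Lp ℝ 2 (P₀.prod Q₀ : Measure (Ω₁ × Ω₂))) :
    Continuous fun h => weightedInner d g h := by
  unfold weightedInner
  fun_prop

theorem continuous_weightedInner_self (d : ℝ) :
    Continuous fun h : Lp ℝ 2 (P₀.prod Q₀ : Measure (Ω₁ × Ω₂)) => weightedInner d h h := by
  unfold weightedInner
  fun_prop

variable {𝓜₁ : Set (ProbabilityMeasure Ω₁)} {𝓜₂ : Set (ProbabilityMeasure Ω₂)}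
  {k : ProbabilityMeasure (Ω₁ × Ω₂) → ℝ} {ϑ : ℝ}

/-- With each tangent, a convex tangent cone of a product family contains all reweightings of its
two components. -/
theorem weightedDirection_mem_tangentCone (hP₀ : P₀ ∈ 𝓜₁) (hQ₀ : Q₀ ∈ 𝓜₂)
    (hconv : Convex ℝ (tangentCone (P₀.prod Q₀) (productFamily 𝓜₁ 𝓜₂))) (d : ℝ)
    {h : Lp ℝ 2 (P₀.prod Q₀ : Measure (Ω₁ × Ω₂))}
    (hh : h ∈ tangentCone (P₀.prod Q₀) (productFamily 𝓜₁ 𝓜₂)) :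
    weightedDirection d h ∈ tangentCone (P₀.prod Q₀) (productFamily 𝓜₁ 𝓜₂) := by
  have hR : P₀.prod Q₀ ∈ productFamily 𝓜₁ 𝓜₂ := ⟨P₀, hP₀, Q₀, hQ₀, rfl⟩
  exact add_mem_tangentCone hR hconv
    (smul_mem_tangentCone hR (liftFst_margFst_mem_tangentCone hQ₀ hh) _)
    (smul_mem_tangentCone hR (liftSnd_margSnd_mem_tangentCone hP₀ hh) _)

theorem isCanonicalGradient_mem_closure (hP₀ : P₀ ∈ 𝓜₁) (hQ₀ : Q₀ ∈ 𝓜₂)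
    (hconv : Convex ℝ (tangentCone (P₀.prod Q₀) (productFamily 𝓜₁ 𝓜₂)))
    {κ : Lp ℝ 2 (P₀.prod Q₀ : Measure (Ω₁ × Ω₂))}
    (hκ : IsCanonicalGradient (productFamily 𝓜₁ 𝓜₂) k (P₀.prod Q₀) κ) :
    κ ∈ closure (tangentCone (P₀.prod Q₀) (productFamily 𝓜₁ 𝓜₂)) := by
  have hR : P₀.prod Q₀ ∈ productFamily 𝓜₁ 𝓜₂ := ⟨P₀, hP₀, Q₀, hQ₀, rfl⟩
  exact tangentSpace_subset_closure hR hconv hκ.2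

theorem eq_add_of_mem_closure {κ : Lp ℝ 2 (P₀.prod Q₀ : Measure (Ω₁ × Ω₂))}
    (hκ : κ ∈ closure (tangentCone (P₀.prod Q₀) (productFamily 𝓜₁ 𝓜₂))) :
    κ = liftFst P₀ Q₀ (margFst P₀ Q₀ κ) + liftSnd P₀ Q₀ (margSnd P₀ Q₀ κ) := by
  have hcl : IsClosed {g : Lp ℝ 2 (P₀.prod Q₀ : Measure (Ω₁ × Ω₂)) |
      g = liftFst P₀ Q₀ (margFst P₀ Q₀ g) + liftSnd P₀ Q₀ (margSnd P₀ Q₀ g)} :=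
    isClosed_eq continuous_id (((liftFst P₀ Q₀).continuous.comp (margFst P₀ Q₀).continuous).add
      ((liftSnd P₀ Q₀).continuous.comp (margSnd P₀ Q₀).continuous))
  exact closure_minimal (fun g hg => eq_add_of_mem_tangentCone hg) hcl hκ

/-- If `κ` is the sum of its components, its inner products are computed componentwise. -/
theorem inner_eq_of_eq_add {κ : Lp ℝ 2 (P₀.prod Q₀ : Measure (Ω₁ × Ω₂))}
    (hκ : κ = liftFst P₀ Q₀ (margFst P₀ Q₀ κ) + liftSnd P₀ Q₀ (margSnd P₀ Q₀ κ))
    (h : Lp ℝ 2 (P₀.prod Q₀ : Measure (Ω₁ × Ω₂))) :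
    inner ℝ κ h = inner ℝ (margFst P₀ Q₀ κ) (margFst P₀ Q₀ h) +
      (inner ℝ (margSnd P₀ Q₀ κ) (margSnd P₀ Q₀ h) : ℝ) := by
  conv_lhs => rw [hκ, inner_add_left]
  rw [real_inner_comm h, real_inner_comm h, ← inner_margFst, ← inner_margSnd,
    real_inner_comm (margFst P₀ Q₀ κ), real_inner_comm (margSnd P₀ Q₀ κ)]

theorem weightedInner_self_pos {d : ℝ} (hd : d ∈ Ioo (0 : ℝ) 1)
    {κ : Lp ℝ 2 (P₀.prod Q₀ : Measure (Ω₁ × Ω₂))}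
    (hκ : κ = liftFst P₀ Q₀ (margFst P₀ Q₀ κ) + liftSnd P₀ Q₀ (margSnd P₀ Q₀ κ)) (h0 : κ ≠ 0) :
    0 < weightedInner d κ κ := by
  refine lt_of_le_of_ne (weightedInner_self_nonneg hd κ) fun h => h0 ?_
  have h1 : 0 < (1 - d)⁻¹ := inv_pos.2 (sub_pos.2 hd.2)
  have h2 : 0 < d⁻¹ := inv_pos.2 hd.1
  rw [weightedInner, real_inner_self_eq_norm_sq, real_inner_self_eq_norm_sq] at h
  have h3 : ‖margFst P₀ Q₀ κ‖ ^ 2 = 0 := by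
    nlinarith [mul_nonneg h1.le (sq_nonneg ‖margFst P₀ Q₀ κ‖),
      mul_nonneg h2.le (sq_nonneg ‖margSnd P₀ Q₀ κ‖), sq_nonneg ‖margFst P₀ Q₀ κ‖]
  have h4 : ‖margSnd P₀ Q₀ κ‖ ^ 2 = 0 := by
    nlinarith [mul_nonneg h1.le (sq_nonneg ‖margFst P₀ Q₀ κ‖),
      mul_nonneg h2.le (sq_nonneg ‖margSnd P₀ Q₀ κ‖), sq_nonneg ‖margSnd P₀ Q₀ κ‖]
  rw [hκ, norm_eq_zero.1 (pow_eq_zero_iff two_ne_zero |>.1 h3),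
    norm_eq_zero.1 (pow_eq_zero_iff two_ne_zero |>.1 h4), map_zero, map_zero, add_zero]

/-- The infimum over the implicit alternatives of the limsup of the power of a test. -/
def maximinPower (𝓜₁ : Set (ProbabilityMeasure Ω₁)) (𝓜₂ : Set (ProbabilityMeasure Ω₂))
    (k : ProbabilityMeasure (Ω₁ × Ω₂) → ℝ) (P₀ : ProbabilityMeasure Ω₁)
    (Q₀ : ProbabilityMeasure Ω₂) (ϑ : ℝ) {n₁ n₂ : ℕ → ℕ}
    (φ : ∀ n, SampleSpace Ω₁ Ω₂ (n₁ n) (n₂ n) → ℝ) : ℝ :=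
  ⨅ R : implicitAlternatives 𝓜₁ 𝓜₂ k P₀ Q₀ ϑ, limsup (power φ R) atTop

theorem limsup_power_nonneg {n₁ n₂ : ℕ → ℕ} {φ : ∀ n, SampleSpace Ω₁ Ω₂ (n₁ n) (n₂ n) → ℝ}
    (hφ : IsTestSequence φ) (R : ℕ → ProbabilityMeasure Ω₁ × ProbabilityMeasure Ω₂) :
    0 ≤ limsup (power φ R) atTop := by
  have h0 : ∀ n, 0 ≤ power φ R n := fun n => integral_nonneg fun x => ((hφ n).2 x).1
  have h1 : ∀ n, power φ R n ≤ 1 := fun n => by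
    refine (integral_mono_of_nonneg (ae_of_all _ fun x => ((hφ n).2 x).1) (integrable_const 1)
      (ae_of_all _ fun x => ((hφ n).2 x).2)).trans ?_
    simp
  exact le_limsup_of_frequently_le (Frequently.of_forall h0) (isBoundedUnder_of ⟨1, h1⟩)

/-- The maximin power of a similar test is bounded by its power bound along the alternatives in the
direction `weightedDirection d h`, for every tangent `h`. -/
theorem maximinPower_le_of_mem_tangentCone (hP₀ : P₀ ∈ 𝓜₁) (hQ₀ : Q₀ ∈ 𝓜₂)
    (hconv : Convex ℝ (tangentCone (P₀.prod Q₀) (productFamily 𝓜₁ 𝓜₂)))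
    {κ : Lp ℝ 2 (P₀.prod Q₀ : Measure (Ω₁ × Ω₂))}
    (hκ : IsGradient (productFamily 𝓜₁ 𝓜₂) k (P₀.prod Q₀) κ)
    {n₁ n₂ : ℕ → ℕ} (hn : ∀ n, n₁ n + n₂ n = n) {d : ℝ} (hd : d ∈ Ioo (0 : ℝ) 1)
    (hnd : Tendsto (fun n : ℕ => (n₂ n : ℝ) / n) atTop (𝓝 d)) (hϑ : 0 < ϑ)
    {α u : ℝ} (hu : normalTail u = α)
    {φ : ∀ n, SampleSpace Ω₁ Ω₂ (n₁ n) (n₂ n) → ℝ} (hφ : IsAsympSimilar P₀ Q₀ α φ)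
    {h : Lp ℝ 2 (P₀.prod Q₀ : Measure (Ω₁ × Ω₂))}
    (hh : h ∈ tangentCone (P₀.prod Q₀) (productFamily 𝓜₁ 𝓜₂)) (hpos : 0 < weightedInner d κ h) :
    maximinPower 𝓜₁ 𝓜₂ k P₀ Q₀ ϑ φ ≤
      normalTail (u - ϑ / weightedInner d κ h * √(weightedInner d h h)) := by
  have hd1 : 1 - d ≠ 0 := (sub_pos.2 hd.2).ne'
  have hd0 : d ≠ 0 := hd.1.ne'
  rw [← inner_weightedDirection] at hpos ⊢
  obtain ⟨R, hR, hloc⟩ := exists_implicitAlternative hκ hϑ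
    (weightedDirection_mem_tangentCone hP₀ hQ₀ hconv d hh) hpos
  set t' : ℝ := ϑ / inner ℝ κ (weightedDirection d h) with ht'
  have ht'0 : 0 < t' := div_pos hϑ hpos
  refine (ciInf_le ⟨0, ?_⟩ (⟨R, hR⟩ : implicitAlternatives 𝓜₁ 𝓜₂ k P₀ Q₀ ϑ)).trans ?_
  · rintro _ ⟨R', rfl⟩
    exact limsup_power_nonneg hφ.1 _
  refine limsup_power_le hn hnd (hloc.fst tendsto_inv_sqrt_nat) (hloc.snd tendsto_inv_sqrt_nat)
    (mul_nonneg ht'0.le (Real.sqrt_nonneg _)) ?_ hu hφ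
  obtain ⟨z₁, z₂⟩ := inner_oneLp_of_integral_eq_zero hh.1
  have e₁ : margFst P₀ Q₀ (weightedDirection d h) = (1 - d)⁻¹ • margFst P₀ Q₀ h := by
    rw [weightedDirection, map_add, map_smul, map_smul, margFst_liftFst, margFst_liftSnd z₂,
      smul_zero, add_zero]
  have e₂ : margSnd P₀ Q₀ (weightedDirection d h) = d⁻¹ • margSnd P₀ Q₀ h := by
    rw [weightedDirection, map_add, map_smul, map_smul, margSnd_liftFst z₁, margSnd_liftSnd,
      smul_zero, zero_add]
  rw [map_smul, map_smul, e₁, e₂, mul_pow, Real.sq_sqrt (weightedInner_self_nonneg hd h),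
    weightedInner, real_inner_self_eq_norm_sq, real_inner_self_eq_norm_sq]
  simp only [norm_smul, mul_pow, Real.norm_eq_abs, sq_abs]
  field_simp

/-- The maximin power bound, obtained by letting the tangents approach the canonical gradient. -/
theorem maximinPower_le (hP₀ : P₀ ∈ 𝓜₁) (hQ₀ : Q₀ ∈ 𝓜₂)
    (hconv : Convex ℝ (tangentCone (P₀.prod Q₀) (productFamily 𝓜₁ 𝓜₂)))
    {κ : Lp ℝ 2 (P₀.prod Q₀ : Measure (Ω₁ × Ω₂))}
    (hκ : IsCanonicalGradient (productFamily 𝓜₁ 𝓜₂) k (P₀.prod Q₀) κ)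
    {n₁ n₂ : ℕ → ℕ} (hn : ∀ n, n₁ n + n₂ n = n) {d : ℝ} (hd : d ∈ Ioo (0 : ℝ) 1)
    (hnd : Tendsto (fun n : ℕ => (n₂ n : ℝ) / n) atTop (𝓝 d)) (hϑ : 0 < ϑ)
    {α u : ℝ} (hu : normalTail u = α)
    {φ : ∀ n, SampleSpace Ω₁ Ω₂ (n₁ n) (n₂ n) → ℝ} (hφ : IsAsympSimilar P₀ Q₀ α φ)
    {σ : ℝ} (hσ : 0 < σ) (hσ2 : σ ^ 2 = weightedInner d κ κ) :
    maximinPower 𝓜₁ 𝓜₂ k P₀ Q₀ ϑ φ ≤ normalTail (u - ϑ / σ) := by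
  obtain ⟨h, hh, hlim⟩ :=
    mem_closure_iff_seq_limit.1 (isCanonicalGradient_mem_closure hP₀ hQ₀ hconv hκ)
  have hpos : 0 < weightedInner d κ κ := by rw [← hσ2]; positivity
  have h1 := ((continuous_weightedInner_right d κ).tendsto κ).comp hlim
  have h2 := ((continuous_weightedInner_self d).tendsto κ).comp hlim
  have h3 : Tendsto (fun n => normalTail (u - ϑ / weightedInner d κ (h n) *
      √(weightedInner d (h n) (h n)))) atTop
      (𝓝 (normalTail (u - ϑ / weightedInner d κ κ * √(weightedInner d κ κ)))) :=
    (continuous_normalTail.tendsto _).comp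
      (((tendsto_const_nhds.div h1 hpos.ne').mul h2.sqrt).const_sub u)
  have e : ϑ / weightedInner d κ κ * √(weightedInner d κ κ) = ϑ / σ := by
    rw [← hσ2, Real.sqrt_sq hσ.le]
    field_simp
  rw [e] at h3
  refine ge_of_tendsto h3 ?_
  filter_upwards [h1.eventually_const_lt hpos] with n hpn
  exact maximinPower_le_of_mem_tangentCone hP₀ hQ₀ hconv hκ.1 hn hd hnd hϑ hu hφ (hh n) hpn

end Optimality

end TwoSample

end

theorem mainTheorem3 {Ω₁ Ω₂ : Type*} [MeasurableSpace Ω₁] [MeasurableSpace Ω₂]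
    (𝓜₁ : Set (ProbabilityMeasure Ω₁)) (𝓜₂ : Set (ProbabilityMeasure Ω₂))
    (P₀ : ProbabilityMeasure Ω₁) (hP₀ : P₀ ∈ 𝓜₁)
    (Q₀ : ProbabilityMeasure Ω₂) (hQ₀ : Q₀ ∈ 𝓜₂)
    -- the statistical functional and its canonical gradient
    (k : ProbabilityMeasure (Ω₁ × Ω₂) → ℝ)
    (κ : Ω₁ × Ω₂ → ℝ) (hκm : Measurable κ)
    (hκ : MemLp κ 2 (P₀.prod Q₀ : Measure (Ω₁ × Ω₂)))
    (hgrad : IsCanonicalGradient (productFamily 𝓜₁ 𝓜₂) k (P₀.prod Q₀) (hκ.toLp κ))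
    (hκ0 : ∫ ω, κ ω ^ 2 ∂(P₀.prod Q₀ : Measure (Ω₁ × Ω₂)) ≠ 0)
    -- the sample sizes
    (n₁ n₂ : ℕ → ℕ) (hn : ∀ n, n₁ n + n₂ n = n)
    (d : ℝ) (hd : d ∈ Set.Ioo (0 : ℝ) 1)
    (hnd : Tendsto (fun n : ℕ => (n₂ n : ℝ) / n) atTop (𝓝 d))
    -- the level and the implicit parameter
    (α : ℝ) (hα : α ∈ Set.Ioo (0 : ℝ) 1)
    (ϑ : ℝ) (hϑ : 0 < ϑ)
    (hconv : Convex ℝ (tangentCone (P₀.prod Q₀) (productFamily 𝓜₁ 𝓜₂))) :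
    -- the infima below range over a nonempty set of implicit alternatives
    (implicitAlternatives 𝓜₁ 𝓜₂ k P₀ Q₀ ϑ).Nonempty ∧
    IsAsympSimilar P₀ Q₀ α (oneSidedTest n₁ n₂ P₀ Q₀ κ d α) ∧
    -- the limits on the left-hand side exist
    (∀ R ∈ implicitAlternatives 𝓜₁ 𝓜₂ k P₀ Q₀ ϑ,
      ∃ β : ℝ, Tendsto (power (oneSidedTest n₁ n₂ P₀ Q₀ κ d α) R) atTop (𝓝 β)) ∧
    IsGreatest
      {b : ℝ | ∃ φ : ∀ n, SampleSpace Ω₁ Ω₂ (n₁ n) (n₂ n) → ℝ, IsAsympSimilar P₀ Q₀ α φ ∧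
        b = ⨅ R : implicitAlternatives 𝓜₁ 𝓜₂ k P₀ Q₀ ϑ, limsup (power φ R) atTop}
      (⨅ R : implicitAlternatives 𝓜₁ 𝓜₂ k P₀ Q₀ ϑ,
        limUnder atTop (power (oneSidedTest n₁ n₂ P₀ Q₀ κ d α) R)) := by
  set κ' := hκ.toLp κ with hκ'
  set u := stdNormalQuantile (1 - α)
  have hu : normalTail u = α := normalTail_stdNormalQuantile hα
  have hcl := isCanonicalGradient_mem_closure hP₀ hQ₀ hconv hgrad
  -- `κ` is the sum of its two components, so they do not both vanish and `σ` is positive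
  have hdec := eq_add_of_mem_closure hcl
  have hne : κ' ≠ 0 := by
    intro h
    refine hκ0 ?_
    have h1 : ‖κ'‖ ^ 2 = 0 := by rw [h, norm_zero, zero_pow two_ne_zero]
    rw [norm_sq_eq_integral_sq] at h1
    rw [← h1]
    refine integral_congr_ae ?_
    filter_upwards [hκ.coeFn_toLp] with ω hω
    rw [hκ', hω]
  have hv := weightedInner_self_pos hd hdec hne
  set σ := √(weightedInner d κ' κ') with hσdef
  have hσ : 0 < σ := Real.sqrt_pos.2 hv
  have hσ2 : σ ^ 2 = weightedInner d κ' κ' := Real.sq_sqrt hv.le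
  -- the components of the canonical gradient as elements of the marginal `L₂` spaces
  have hm₁ : margFst P₀ Q₀ κ' =ᵐ[(P₀ : Measure Ω₁)] gradFst Q₀ κ := margFst_ae_eq hκ
  have hm₂ : margSnd P₀ Q₀ κ' =ᵐ[(Q₀ : Measure Ω₂)] gradSnd P₀ κ := margSnd_ae_eq hκ
  have hκ₁ : MemLp (gradFst Q₀ κ) 2 (P₀ : Measure Ω₁) := (Lp.memLp _).ae_eq hm₁
  have hκ₂ : MemLp (gradSnd P₀ κ) 2 (Q₀ : Measure Ω₂) := (Lp.memLp _).ae_eq hm₂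
  obtain ⟨hz₁, hz₂⟩ := inner_oneLp_of_integral_eq_zero hgrad.1.1
  have h0₁ : ∫ ω, gradFst Q₀ κ ω ∂(P₀ : Measure Ω₁) = 0 := by
    rw [← integral_congr_ae hm₁, ← inner_oneLp, hz₁]
  have h0₂ : ∫ ω, gradSnd P₀ κ ω ∂(Q₀ : Measure Ω₂) = 0 := by
    rw [← integral_congr_ae hm₂, ← inner_oneLp, hz₂]
  have hin₁ : ∀ a : Lp ℝ 2 (P₀ : Measure Ω₁),
      ∫ ω, gradFst Q₀ κ ω * a ω ∂(P₀ : Measure Ω₁) = inner ℝ (margFst P₀ Q₀ κ') a := fun a => by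
    rw [inner_eq_integral_mul]
    exact integral_congr_ae (hm₁.symm.mul (ae_eq_refl _))
  have hin₂ : ∀ b : Lp ℝ 2 (Q₀ : Measure Ω₂),
      ∫ ω, gradSnd P₀ κ ω * b ω ∂(Q₀ : Measure Ω₂) = inner ℝ (margSnd P₀ Q₀ κ') b := fun b => by
    rw [inner_eq_integral_mul]
    exact integral_congr_ae (hm₂.symm.mul (ae_eq_refl _))
  have hvar : σ ^ 2 = 1 / (1 - d) * ∫ ω, gradFst Q₀ κ ω ^ 2 ∂(P₀ : Measure Ω₁) +
      1 / d * ∫ ω, gradSnd P₀ κ ω ^ 2 ∂(Q₀ : Measure Ω₂) := by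
    have e₁ : ∫ ω, margFst P₀ Q₀ κ' ω ^ 2 ∂(P₀ : Measure Ω₁) =
        ∫ ω, gradFst Q₀ κ ω ^ 2 ∂(P₀ : Measure Ω₁) :=
      integral_congr_ae (hm₁.mono fun ω h => congrArg (· ^ 2) h)
    have e₂ : ∫ ω, margSnd P₀ Q₀ κ' ω ^ 2 ∂(Q₀ : Measure Ω₂) =
        ∫ ω, gradSnd P₀ κ ω ^ 2 ∂(Q₀ : Measure Ω₂) :=
      integral_congr_ae (hm₂.mono fun ω h => congrArg (· ^ 2) h)
    rw [hσ2, weightedInner, real_inner_self_eq_norm_sq, real_inner_self_eq_norm_sq,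
      norm_sq_eq_integral_sq, norm_sq_eq_integral_sq, one_div, one_div, e₁, e₂]
  -- the power of the one-sided test has the same limit along all implicit alternatives
  have hpow : ∀ R ∈ implicitAlternatives 𝓜₁ 𝓜₂ k P₀ Q₀ ϑ,
      Tendsto (power (oneSidedTest n₁ n₂ P₀ Q₀ κ d α) R) atTop (𝓝 (normalTail (u - ϑ / σ))) := by
    intro R hR
    obtain ⟨h, hϑh, hloc⟩ := exists_tangent_of_mem_implicitAlternatives hgrad.1 hR
    have := tendsto_power_oneSidedTest hn hd hnd (hloc.fst tendsto_inv_sqrt_nat)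
      (hloc.snd tendsto_inv_sqrt_nat) hκm hκ₁ hκ₂ h0₁ h0₂ hσ hvar α
    rwa [hin₁, hin₂, ← inner_eq_of_eq_add hdec, hϑh] at this
  have hsim : IsAsympSimilar P₀ Q₀ α (oneSidedTest n₁ n₂ P₀ Q₀ κ d α) := by
    refine ⟨fun n => ⟨measurable_oneSidedTest n₁ n₂ hκm d α n, fun x => ?_⟩, ?_⟩
    · unfold oneSidedTest
      split_ifs <;> simp
    · have := tendsto_power_oneSidedTest hn hd hnd (hasLocalTangent_self _ _ P₀)
        (hasLocalTangent_self _ _ Q₀) hκm hκ₁ hκ₂ h0₁ h0₂ hσ hvar α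
      rwa [hin₁, hin₂, inner_zero_right, inner_zero_right, add_zero, zero_div, sub_zero,
        hu] at this
  -- tangents close to `κ` have a least favourable direction along which `k` increases
  have hnonempty : (implicitAlternatives 𝓜₁ 𝓜₂ k P₀ Q₀ ϑ).Nonempty := by
    obtain ⟨h, hh, hlim⟩ := mem_closure_iff_seq_limit.1 hcl
    have h1 := ((continuous_weightedInner_right d κ').tendsto κ').comp hlim
    obtain ⟨n, hpn⟩ := (h1.eventually_const_lt hv).exists
    obtain ⟨R, hR, -⟩ := exists_implicitAlternative hgrad.1 hϑ
      (weightedDirection_mem_tangentCone hP₀ hQ₀ hconv d (hh n))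
      (by rw [inner_weightedDirection]; exact hpn)
    exact ⟨R, hR⟩
  have : Nonempty (implicitAlternatives 𝓜₁ 𝓜₂ k P₀ Q₀ ϑ) := hnonempty.to_subtype
  have hval : (⨅ R : implicitAlternatives 𝓜₁ 𝓜₂ k P₀ Q₀ ϑ,
      limUnder atTop (power (oneSidedTest n₁ n₂ P₀ Q₀ κ d α) R)) = normalTail (u - ϑ / σ) := by
    rw [iInf_congr fun R : implicitAlternatives 𝓜₁ 𝓜₂ k P₀ Q₀ ϑ => (hpow R R.2).limUnder_eq,
      ciInf_const]
  refine ⟨hnonempty, hsim, fun R hR => ⟨_, hpow R hR⟩, ⟨_, hsim, ?_⟩, ?_⟩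
  · rw [hval, iInf_congr fun R : implicitAlternatives 𝓜₁ 𝓜₂ k P₀ Q₀ ϑ => (hpow R R.2).limsup_eq,
      ciInf_const]
  · rintro b ⟨φ, hφ, rfl⟩
    rw [hval]
    exact maximinPower_le hP₀ hQ₀ hconv hgrad hn hd hnd hϑ hu hφ hσ hσ2
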